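/- Let $p\ge 2$ be a number of processors, numbered $0,1,\dots,p-1$, with root $0$, and let $q=\lceil\log_2 p\rceil$. Define skips by $s_q=p$ and $s_{k}=\lceil s_{k+1}/2\rceil$ for $k=q-1,\dots,0$. In round $k$, $0\le k<q$, processor $r$ sends to $t_r^k=(r+s_k)\bmod p$ and receives from $f_r^k=(r-s_k)\bmod p$. The directed circulant graph with the edges $(r,t^k_r)$ is $q$-regular: every processor has exactly $q$ out-neighbours and exactly $q$ in-neighbours. Consider the following algorithm for processor $r$. Arrays are $\mathit{skip}[0..q]$, $\mathit{next}[-1..q]$, $\mathit{prev}[-1..q]$, $\mathit{recv}[0..q-1]$. To unlink $e$ means to assign simultaneously $\mathit{next}[\mathit{prev}[e]],\mathit{prev}[\mathit{next}[e]]\gets \mathit{next}[e],\mathit{prev}[e]$. - Skips: set $\mathit{skip}[q]\gets p$ and, for $k=q,\dots,1$, $\mathit{skip}[k-1]\gets \mathit{skip}[k]-\lfloor \mathit{skip}[k]/2\rfloor$. - $\mathrm{baseblock}(r)$: start with $r'=0$; for $k=q-1,\dots,0$: if $r'+\mathit{skip}[k]=r$, return $k$; if $r'+\mathit{skip}[k]<r$,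 set $r'\gets r'+\mathit{skip}[k]$. If the loop ends, return $q$. - $\mathrm{allblocks}(R,r',s,e,k)$: while $e\ne -1$: if $r'+\mathit{skip}[e]\le R-\mathit{skip}[k]$ and $r'+\mathit{skip}[e]<s$, then {if $r'+\mathit{skip}[e]\le R-\mathit{skip}[k+1]$, set $k\gets\mathrm{allblocks}(R,r'+\mathit{skip}[e],s,e,k)$; then, if $r'>R-\mathit{skip}[k+1]$, return $k$; then $s\gets r'+\mathit{skip}[e]$, $\mathit{recv}[k]\gets e$, $k\gets k+1$, unlink $e$}; in every case then $e\gets \mathit{next}[e]$. After the loop return $k$. - $\mathrm{recvschedule}(r)$: for $e=0,\dots,q$ set $\mathit{next}[e]\gets e-1$, $\mathit{prev}[e]\gets e+1$; set $\mathit{prev}[q]\gets-1$, $\mathit{next}[-1]\gets q$, $\mathit{prev}[-1]\gets 0$; set $b\gets\mathrm{baseblock}(r)$ and unlink $b$; call $\mathrm{allblocks}(p+r,0,2p,q,0)$; finally, for $k=0,\dots,q-1$, replace $\mathit{recv}[k]$ by $b$ if $\mathit{recv}[k]=q$, and by $\mathit{recv}[k]-q$ otherwise. There is a constant $C$ such that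 for every $p\ge2$ the following holds. For every processor $0\le r<p$ this computation (skips, then $\mathrm{recvschedule}(r)$), given $p$, $q$ and $r$, terminates, accesses arrays only within their bounds and only at entries already written, and takes at most $C\log_2 p$ steps, each arithmetic operation, comparison, array access and procedure call counting as one step. It leaves the skips $s_0,\dots,s_q$ in $\mathit{skip}$. Write $\mathrm{recv}_r[k]$, $0\le k<q$, for the final content of $\mathit{recv}$, let $\mathrm{send}_r[k]=\mathrm{recv}_{t_r^k}[k]$ be the induced send schedule, and let $b_r=\mathrm{baseblock}(r)$. Then the four correctness conditions hold: 1. $\mathrm{recv}_r[k]=\mathrm{send}_{f_r^k}[k]$ for all $r$ and $0\le k<q$. 2. $\mathrm{send}_r[k]=\mathrm{recv}_{t_r^k}[k]$ for all $r$ and $0\le k<q$. 3. For every $r$, the blocks $\mathrm{recv}_r[0],\dots,\mathrm{recv}_r[q-1]$ are pairwise different. For $r>0$ one has $0\le b_r<q$ and $\{\mathrm{recv}_r[k]:0\le k<q\}=(\{-1,\dots,-q\}\setminus\{b_r-q\})\cup\{b_r\}$. For the root, $\{\mathrm{recv}_0[k]:0\le k<q\}=\{-1,\dots,-q\}$. 4.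 For every $r>0$ and $0\le k<q$, either $\mathrm{send}_r[k]=\mathrm{recv}_r[j]$ for some $0\le j<k$, or $\mathrm{send}_r[k]=b_r-q$. The root, which owns all blocks, has $\mathrm{send}_0[k]=k$ for $0\le k<q$. -/

import Mathlib

namespace CirculantBroadcast

/-! ## The circulant graph -/

/-- The number of communication rounds, `q = ⌈log₂ p⌉`. -/
def rounds (p : ℕ) : ℕ := Nat.clog 2 p

/-- `p` halved `i` times, each time rounding up. -/
def halvings (p : ℕ) : ℕ → ℕ
  | 0 => p
  | i + 1 => (halvings p i + 1) / 2

/-- The skips: `skip p q = p` and `skip p k = ⌈skip p (k + 1) / 2⌉` for `k < q`. -/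
def skip (p k : ℕ) : ℕ := halvings p (rounds p - k)

/-- The to-processor of `r` in round `k`. -/
def toProc (p r k : ℕ) : ℕ := (r + skip p k) % p

/-- The from-processor of `r` in round `k`
(the natural-number subtraction is exact, as `skip p k ≤ p`). -/
def fromProc (p r k : ℕ) : ℕ := (r + p - skip p k) % p

/-- The directed circulant graph on the processors `0, …, p - 1` with an edge from each processor
to its to-processor of every round `k < q`. -/
def circulantGraph (p : ℕ) : Digraph (Fin p) where
  Adj u v := ∃ k < rounds p, (v : ℕ) = toProc p u k

/-- Every vertex has exactly `d` outgoing and exactly `d` incoming neighbours. -/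
def IsRegularOfDegree {V : Type*} (G : Digraph V) (d : ℕ) : Prop :=
  ∀ v, {w | G.Adj v w}.encard = d ∧ {w | G.Adj w v}.encard = d

/-! ## Correctness of schedules -/

/-- The send schedule induced by the receive schedules of all processors: in round `k`, processor
`r` sends what its to-processor receives. -/
def inducedSend (p : ℕ) (recv : ℕ → ℕ → ℤ) (r k : ℕ) : ℤ := recv (toProc p r k) k

/-- The four correctness conditions for broadcast from root `0`. Here `recv r k` and `send r k`
are the blocks that processor `r` receives and sends in round `k`, and `b r` is the baseblock of
the non-root processor `r`. The root owns all blocks from the start and has no baseblock of its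
own: it receives negative (dummy) blocks only, and sends block `k` in round `k`. -/
structure IsCorrect (p : ℕ) (b : ℕ → ℤ) (recv send : ℕ → ℕ → ℤ) : Prop where
  recv_eq : ∀ r < p, ∀ k < rounds p, recv r k = send (fromProc p r k) k
  send_eq : ∀ r < p, ∀ k < rounds p, send r k = recv (toProc p r k) k
  recv_distinct : ∀ r < p, Set.InjOn (recv r) (Set.Iio (rounds p))
  base_mem : ∀ r < p, 0 < r → 0 ≤ b r ∧ b r < rounds p
  recv_set : ∀ r < p, 0 < r → recv r '' Set.Iio (rounds p) =
    (Set.Icc (-(rounds p : ℤ)) (-1) \ {b r - rounds p}) ∪ {b r}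
  recv_set_root : recv 0 '' Set.Iio (rounds p) = Set.Icc (-(rounds p : ℤ)) (-1)
  send_known : ∀ r < p, 0 < r → ∀ k < rounds p,
    (∃ j < k, send r k = recv r j) ∨ send r k = b r - rounds p
  send_root : ∀ k < rounds p, send 0 k = k

/-! ## A sequential machine with unit-cost operations

Integer-valued local variables are Lean variables; arrays live in a memory. Every arithmetic
operation, comparison, array read, array write and procedure call costs one step. A computation
has no result (`none`) if it reads a cell that was not written before or accesses an array out of
its bounds. Loops and recursive procedures carry a bound `fuel` on the depth of their unfolding, and
have no result if it is exceeded. So a program terminates without failure exactly if it has a result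
for some `fuel`; the result and the number of steps do not depend on `fuel`, which is not part of
the step count. -/

/-- The names of the arrays of the algorithm. -/
inductive ArrayName
  | skips | next | prev | recv
  deriving DecidableEq

/-- The index ranges: `skips[0..q]`, `next[-1..q]`, `prev[-1..q]`, `recv[0..q-1]`. -/
def InBounds (q : ℤ) : ArrayName → ℤ → Prop
  | .skips, i => 0 ≤ i ∧ i ≤ q
  | .next, i => -1 ≤ i ∧ i ≤ q
  | .prev, i => -1 ≤ i ∧ i ≤ q
  | .recv, i => 0 ≤ i ∧ i < q

instance (q : ℤ) (a : ArrayName) (i : ℤ) : Decidable (InBounds q a i) := by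
  cases a <;> unfold InBounds <;> infer_instance

/-- Contents of the arrays (`none` in cells that have not been written) and the number of steps
performed so far. -/
structure Memory where
  cell : ArrayName → ℤ → Option ℤ
  steps : ℕ

/-- The memory at the start: nothing is written, no step has been performed. -/
def Memory.init : Memory := ⟨fun _ _ => none, 0⟩

/-- Computations that act on the memory and may fail or diverge. -/
abbrev Comp (α : Type) : Type := StateT Memory Option α

/-- Out of fuel. -/
def noFuel {α : Type} : Comp α := fun _ => none

/-- Charge one step. -/
def tick : Comp Unit := fun m => some ((), { m with steps := m.steps + 1 })

def add (x y : ℤ) : Comp ℤ := do tick; pure (x + y)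

def sub (x y : ℤ) : Comp ℤ := do tick; pure (x - y)

/-- Integer division by two, rounding down. -/
def half (x : ℤ) : Comp ℤ := do tick; pure (x / 2)

def isEq (x y : ℤ) : Comp Bool := do tick; pure (decide (x = y))

def isLe (x y : ℤ) : Comp Bool := do tick; pure (decide (x ≤ y))

def isLt (x y : ℤ) : Comp Bool := do tick; pure (decide (x < y))

/-- Read `a[i]`. -/
def load (a : ArrayName) (i : ℤ) : Comp ℤ := do
  tick
  fun m => (m.cell a i).map fun x => (x, m)

/-- Write `a[i] ← x`; `q` determines the array bounds. -/
def store (q : ℤ) (a : ArrayName) (i x : ℤ) : Comp Unit := do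
  tick
  fun m =>
    if InBounds q a i then
      some ((), { m with cell := fun c j => if c = a ∧ j = i then some x else m.cell c j })
    else none

/-- `for i = i, …, hi do body i`. -/
def forUp (body : ℤ → Comp Unit) : (fuel : ℕ) → (i hi : ℤ) → Comp Unit
  | 0, _, _ => noFuel
  | fuel + 1, i, hi => do
    if ← isLe i hi then
      body i
      let j ← add i 1
      forUp body fuel j hi
    else
      pure ()

/-! ## The algorithms -/

/-- The `while k > 0` loop of the skip computation. -/
def skipsLoop (q : ℤ) : (fuel : ℕ) → (k : ℤ) → Comp Unit
  | 0, _ => noFuel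
  | fuel + 1, k => do
    if ← isLt 0 k then
      let x ← load .skips k
      let h ← half x
      let y ← sub x h
      let j ← sub k 1
      store q .skips j y
      skipsLoop q fuel j
    else
      pure ()

/-- Computation of the skips by repeated halving of `p`. -/
def computeSkips (fuel : ℕ) (p q : ℤ) : Comp Unit := do
  tick
  store q .skips q p
  skipsLoop q fuel q

/-- The `repeat … until k = 0` loop of `baseblock`; `rc` is the sum of the skips taken so far. -/
def baseblockLoop (q r : ℤ) : (fuel : ℕ) → (k rc : ℤ) → Comp ℤ
  | 0, _, _ => noFuel
  | fuel + 1, k, rc => do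
    let k ← sub k 1
    let x ← load .skips k
    let t ← add rc x
    if ← isEq t r then
      pure k
    else
      let less ← isLt t r
      let rc := if less then t else rc
      if ← isEq k 0 then
        pure q
      else
        baseblockLoop q r fuel k rc

/-- The baseblock (smallest index of the canonical skip sequence) of processor `r`. -/
def baseblock (fuel : ℕ) (q r : ℤ) : Comp ℤ := do
  tick
  baseblockLoop q r fuel q 0

/-- Remove `e` from the doubly linked list:
`next[prev[e]], prev[next[e]] ← next[e], prev[e]`. -/
def unlink (q e : ℤ) : Comp Unit := do
  let a ← load .prev e
  let n ← load .next e
  store q .next a n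
  store q .prev n a

/-- The backtracking search `allblocks(r, rc, s, e, k)` with current intermediate processor `rc`.
Its `while e ≠ -1` loop, over the variables `s`, `e`, `k`, is written as tail recursion (the last
call in each of the two branches); the remaining call, to which a step for the procedure call is
charged, is the recursive call of the algorithm. -/
def allblocks (q r : ℤ) : (fuel : ℕ) → (rc s e k : ℤ) → Comp ℤ
  | 0, _, _, _, _ => noFuel
  | fuel + 1, rc, s, e, k => do
    if ← isEq e (-1) then
      pure k
    else
      let t ← add rc (← load .skips e)
      let d ← sub r (← load .skips k)
      let near ← isLe t d
      let fresh ← isLt t s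
      if near && fresh then
        let u ← sub r (← load .skips (← add k 1))
        let k ← (do
          if ← isLe t u then
            tick
            allblocks q r fuel t s e k
          else
            pure k)
        let u ← sub r (← load .skips (← add k 1))
        if ← isLt u rc then
          pure k
        else
          store q .recv k e
          let k ← add k 1
          unlink q e
          let n ← load .next e
          allblocks q r fuel rc t n k
      else
        let n ← load .next e
        allblocks q r fuel rc s n k

/-- The receive schedule of processor `r`; the skips have to be in memory. -/
def recvschedule (fuel : ℕ) (p q r : ℤ) : Comp Unit := do
  tick
  forUp (fun e => do
    let d ← sub e 1
    store q .next e d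
    let u ← add e 1
    store q .prev e u) fuel 0 q
  store q .prev q (-1)
  store q .next (-1) q
  store q .prev (-1) 0
  let b ← baseblock fuel q r
  unlink q b
  let pr ← add p r
  let pp ← add p p
  tick
  let _ ← allblocks q pr fuel 0 pp q 0
  let last ← sub q 1
  forUp (fun k => do
    let x ← load .recv k
    if ← isEq x q then
      store q .recv k b
    else
      let y ← sub x q
      store q .recv k y) fuel 0 last

/-- What processor `r` does: compute the skips, then its receive schedule. The argument `q` is
meant to be `⌈log₂ p⌉`. -/
def recvProgram (fuel : ℕ) (p q r : ℤ) : Comp Unit := do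
  computeSkips fuel p q
  recvschedule fuel p q r

/-- Compute the skips, then the baseblock of processor `r`. -/
def baseblockProgram (fuel : ℕ) (p q r : ℤ) : Comp ℤ := do
  computeSkips fuel p q
  baseblock fuel q r

/-- Started on `p`, `q = ⌈log₂ p⌉` and `r` in the initial memory, the program terminates without
failure after `n` steps, with `skips[0..q]` holding the skips and with `recv[0..q-1]` holding
`f 0, …, f (q - 1)`. -/
def ComputesRecv (p r : ℕ) (f : ℕ → ℤ) (n : ℕ) : Prop :=
  ∃ (fuel : ℕ) (m : Memory), recvProgram fuel p (rounds p) r Memory.init = some ((), m) ∧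
    (∀ k ≤ rounds p, m.cell .skips k = some (skip p k : ℤ)) ∧
    (∀ k < rounds p, m.cell .recv k = some (f k)) ∧
    m.steps = n

/-- Started on `p`, `q = ⌈log₂ p⌉` and `r` in the initial memory, the baseblock computation
terminates without failure and returns `b`. -/
def ComputesBaseblock (p r : ℕ) (b : ℤ) : Prop :=
  ∃ (fuel : ℕ) (m : Memory), baseblockProgram fuel p (rounds p) r Memory.init = some (b, m)

end CirculantBroadcast

namespace CirculantBroadcast

/-! The proof replaces the program by a combinatorial description of the blocks. Processor `r`
becomes the node `R = p + r` of a tree on `[0, 2p)`. A node `t > 0` has the block `B t`, the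
smallest index in its greedy decomposition into skips `K i`, and the parent `t - K (B t)`. The root
`0` has block `q + 1`, and `p` has block `q`. Numerical order is a preorder, and blocks grow towards
the root. In round `k`, `R` gets the block of `source K B R k`: the largest node `t ≤ R - K k` such
that the edge from `t` to its parent covers `R - K (k + 1)` and `B t` is new, that is, different
from `B R` and from the blocks of earlier sources.

Existence of sources (`Receiver.good`) rests on `Receiver.round_cases`. Call a block above `k`
large. Either a new large block lies in the window `[R - K (k + 1), R - K k]`, or the last large
node `P` up to the far end of the window has enough room for children. Since `R` knows exactly `k +
1` blocks, knowing a large one means that some block of `0, …, k` is missing, and a child of `P` can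
supply it. The rounding of the skips disturbs this only at the ends of windows; `FarLarge` isolates
the delicate configuration. The `q` sources and `R` itself carry each of the blocks `0, …, q`
exactly once, which gives condition 3 after the final renaming.

Condition 4 is `Receiver.Window.mem_known`: the block that `R` receives in round `k` is already
known to its from-processor `F`. The nodes up to the from-processor are copied into the window of
`F` by a shift by `0` or `p`. If `F` had missed the block, then either it took a larger sibling that
`R` would have taken as well, or it knows too many blocks. The block `q` comes only from node `p`,
and then `R` and `F` have the same baseblock.

The procedure `allblocks` is a depth-first search for these sources. By `Receiver.ancestor_notMem`
no block on the path from the root to the next source is known, so all of them are still in the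
linked list; by `Receiver.block_add_of_near` a sum that passes the tests and may be accepted is a
genuine child. `allblocks_spec` turns this into a loop invariant together with an amortized step
count. After each accepted block a new scan begins, whose length is bounded by `potential`. Large
blocks are far apart (`BlockTree.gap`), so these potentials have a sum linear in `q`
(`Receiver.sum_potential_le`). -/

/-! ### Skip sequences. -/

/-- A sequence that starts with `1` and in which each term is, rounding up, half of the next. -/
structure SkipSeq (K : ℕ → ℕ) : Prop where
  zero : K 0 = 1
  lt_succ : ∀ i, K i < K (i + 1)
  le_double : ∀ i, K (i + 1) ≤ 2 * K i
  double_le : ∀ i, 2 * K i ≤ K (i + 1) + 1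

namespace SkipSeq
variable {K : ℕ → ℕ}

theorem strictMono (h : SkipSeq K) : StrictMono K := strictMono_nat_of_lt_succ h.lt_succ

theorem mono (h : SkipSeq K) {i j : ℕ} (hij : i ≤ j) : K i ≤ K j := h.strictMono.monotone hij

theorem lt (h : SkipSeq K) {i j : ℕ} (hij : i < j) : K i < K j := h.strictMono hij

theorem lt_iff (h : SkipSeq K) {i j : ℕ} : K i < K j ↔ i < j := h.strictMono.lt_iff_lt

theorem pos (h : SkipSeq K) (i : ℕ) : 0 < K i := by
  have := h.mono (Nat.zero_le i)
  rw [h.zero] at this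
  omega

theorem one (h : SkipSeq K) : K 1 = 2 := by
  have h0 := h.zero
  have h1 := h.lt_succ 0
  have h2 := h.le_double 0
  simp only [zero_add] at *
  omega

end SkipSeq

/-! ### Greedy decompositions and the block tree. -/

/-- The smallest index of the greedy decomposition of `x` into the skips `K 0, …, K (n - 1)`;
the number `0`, which has the empty decomposition, gets the value `top`. -/
def greedyBlock (K : ℕ → ℕ) (top : ℕ) : ℕ → ℕ → ℕ
  | 0, _ => top
  | n + 1, x =>
    if x = K n then n
    else if K n < x then greedyBlock K top n (x - K n) else greedyBlock K top n x

/-- The tree on `0, …, K (q + 1) - 1` in which the parent of `t` is `t - K (B t)`, numbered in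
preorder: the children of a node carry distinct blocks, all smaller than that of the node. -/
structure BlockTree (K : ℕ → ℕ) (q : ℕ) (B : ℕ → ℕ) : Prop extends SkipSeq K where
  root : B 0 = q + 1
  top_double : K (q + 1) = 2 * K q
  block_le : ∀ t, 0 < t → t < K (q + 1) → B t ≤ q
  skip_le : ∀ t, 0 < t → t < K (q + 1) → K (B t) ≤ t
  block_lt_parent : ∀ t, 0 < t → t < K (q + 1) → B t < B (t - K (B t))
  block_lt : ∀ t, 0 < t → t < K (q + 1) → ∀ x, t - K (B t) < x → x < t → B x < B t
  child : ∀ z e, z + K e < K (q + 1) → e < B z → (∀ x, z < x → x ≤ z + K e → B x < B z) →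
    B (z + K e) = e
  add_skip : ∀ k ≤ q, ∀ x, 0 < x → x + K k < K (k + 1) → B (x + K k) = B x

section greedy
variable {K : ℕ → ℕ} {top : ℕ}

theorem greedyBlock_zero (h : SkipSeq K) (n : ℕ) : greedyBlock K top n 0 = top := by
  induction n with
  | zero => rfl
  | succ n ih =>
    have := h.pos n
    rw [greedyBlock, if_neg (by omega), if_neg (by omega), ih]

theorem greedyBlock_eq (h : SkipSeq K) {m n x : ℕ} (hx : x < K m) (hmn : m ≤ n) :
    greedyBlock K top n x = greedyBlock K top m x := by
  induction n, hmn using Nat.le_induction with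
  | base => rfl
  | succ n hn ih =>
    have := h.mono hn
    rw [greedyBlock, if_neg (by omega), if_neg (by omega), ih]

theorem greedyBlock_skip (h : SkipSeq K) {e n : ℕ} (he : e < n) :
    greedyBlock K top n (K e) = e := by
  rw [greedyBlock_eq h (h.lt_succ e) he, greedyBlock, if_pos rfl]

/-- As `K (n + 1) ≤ 2 * K n`, the decompositions of numbers between `K n` and `K (n + 1)` are those
of numbers below `K n` with the index `n` added: the tree beyond `K n` is a copy of an initial
piece, hung below `K n`. -/
theorem greedyBlock_spec (h : SkipSeq K) (n : ℕ) (hn : n ≤ top) (t : ℕ) (h0 : 0 < t)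
    (ht : t < K n) :
    greedyBlock K top n t < n ∧ K (greedyBlock K top n t) ≤ t ∧
      greedyBlock K top n t < greedyBlock K top n (t - K (greedyBlock K top n t)) ∧
      ∀ x, t - K (greedyBlock K top n t) < x → x < t →
        greedyBlock K top n x < greedyBlock K top n t := by
  induction n generalizing t with
  | zero => rw [h.zero] at ht; omega
  | succ n ih =>
    have hd := h.le_double n
    rcases lt_trichotomy t (K n) with hlt | heq | hgt
    · obtain ⟨h1, h2, h3, h4⟩ := ih (by omega) t h0 hlt
      have e1 : ∀ x, x < K n → greedyBlock K top (n + 1) x = greedyBlock K top n x :=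
        fun x hx => greedyBlock_eq h hx (Nat.le_succ n)
      rw [e1 t hlt, e1 _ (by omega)]
      refine ⟨by omega, h2, h3, fun x hx hxt => ?_⟩
      rw [e1 x (by omega)]
      exact h4 x hx hxt
    · have e1 : greedyBlock K top (n + 1) t = n := by rw [greedyBlock, if_pos heq]
      rw [e1, heq, Nat.sub_self, greedyBlock_zero h]
      refine ⟨by omega, le_rfl, by omega, fun x hx hxt => ?_⟩
      rw [greedyBlock_eq h hxt (Nat.le_succ n)]
      exact (ih (by omega) x hx hxt).1
    · have e1 : ∀ x, K n < x → greedyBlock K top (n + 1) x = greedyBlock K top n (x - K n) :=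
        fun x hx => by rw [greedyBlock, if_neg (by omega), if_pos hx]
      obtain ⟨h1, h2, h3, h4⟩ := ih (by omega) (t - K n) (by omega) (by omega)
      rw [e1 t hgt]
      set b := greedyBlock K top n (t - K n) with hb
      refine ⟨by omega, by omega, ?_, fun x hx hxt => ?_⟩
      -- A child of `0` in the copied piece becomes a child of `K n`; all other parents are copied.
      · rcases Nat.eq_or_lt_of_le h2 with he | hl
        · have : t - K b = K n := by omega
          rw [this, greedyBlock_skip h (Nat.lt_succ_self n)]
          exact h1
        · rw [e1 _ (by omega)]
          rwa [show t - K b - K n = t - K n - K b by omega]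
      · rw [e1 x (by omega)]
        exact h4 _ (by omega) (by omega)

/-- The hypothesis says that the subtree of `z` is not cut off before `z + K e`. The only case not
inherited in the induction is `0 < z < K n ≤ z + K e`, and there the node `K n`, with block `n`,
violates it. -/
theorem greedyBlock_child (h : SkipSeq K) (n : ℕ) (hn : n ≤ top) (z e : ℕ)
    (hz : z + K e < K n) (he : e < greedyBlock K top n z)
    (hx : ∀ x, z < x → x ≤ z + K e → greedyBlock K top n x < greedyBlock K top n z) :
    greedyBlock K top n (z + K e) = e := by
  induction n generalizing z with
  | zero => rw [h.zero] at hz; have := h.pos e; omega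
  | succ n ih =>
    have hd := h.le_double n
    have hp := h.pos e
    have e0 : ∀ x, x < K n → greedyBlock K top (n + 1) x = greedyBlock K top n x :=
      fun x hx => greedyBlock_eq h hx (Nat.le_succ n)
    have e1 : ∀ x, K n < x → greedyBlock K top (n + 1) x = greedyBlock K top n (x - K n) :=
      fun x hx => by rw [greedyBlock, if_neg (by omega), if_pos hx]
    have e2 : greedyBlock K top (n + 1) (K n) = n := greedyBlock_skip h (Nat.lt_succ_self n)
    rcases lt_trichotomy z (K n) with hlt | heq | hgt
    · rcases Nat.eq_zero_or_pos z with rfl | hz0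
      · rw [zero_add] at hz ⊢
        exact greedyBlock_skip h (h.lt_iff.1 hz)
      · rcases lt_or_ge (z + K e) (K n) with hw | hw
        · rw [e0 _ hw]
          rw [e0 _ hlt] at he hx
          refine ih (by omega) z hw he fun x h1 h2 => ?_
          rw [← e0 x (by omega)]
          exact hx x h1 h2
        · have h1 := hx (K n) hlt hw
          rw [e2, e0 _ hlt] at h1
          have := (greedyBlock_spec (top := top) h n (by omega) z hz0 hlt).1
          omega
    · subst heq
      rw [e2] at he
      rw [e1 _ (by omega), show K n + K e - K n = K e by omega]
      exact greedyBlock_skip h he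
    · rw [e1 _ (by omega), show z + K e - K n = z - K n + K e by omega]
      rw [e1 _ hgt] at he hx
      refine ih (by omega) (z - K n) (by omega) he fun x h1 h2 => ?_
      have := hx (x + K n) (by omega) (by omega)
      rwa [e1 _ (by omega), Nat.add_sub_cancel] at this

theorem blockTree_greedyBlock (h : SkipSeq K) (q : ℕ) (hq : K (q + 1) = 2 * K q) :
    BlockTree K q (greedyBlock K (q + 1) (q + 1)) where
  toSkipSeq := h
  root := greedyBlock_zero h _
  top_double := hq
  block_le t h0 ht := Nat.le_of_lt_succ (greedyBlock_spec h _ le_rfl t h0 ht).1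
  skip_le t h0 ht := (greedyBlock_spec h _ le_rfl t h0 ht).2.1
  block_lt_parent t h0 ht := (greedyBlock_spec h _ le_rfl t h0 ht).2.2.1
  block_lt t h0 ht := (greedyBlock_spec h _ le_rfl t h0 ht).2.2.2
  child z e := greedyBlock_child h _ le_rfl z e
  add_skip k hk x h0 hx := by
    have hd := h.le_double k
    rw [greedyBlock_eq h hx (by omega), greedyBlock, if_neg (by omega), if_pos (by omega),
      Nat.add_sub_cancel]
    exact (greedyBlock_eq h (by omega) (by omega)).symm

end greedy

/-! ### Distances between nodes of given blocks. -/

namespace BlockTree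
variable {K : ℕ → ℕ} {q : ℕ} {B : ℕ → ℕ}

/-- Nodes strictly between `t` and its parent have blocks below `B t`, so `x` is not among them. -/
theorem add_le_of_block_le (h : BlockTree K q B) {x t : ℕ} (hxt : x < t) (ht : t < K (q + 1))
    (hb : B t ≤ B x) : x + K (B t) ≤ t := by
  by_contra hc
  have := h.skip_le t (by omega) ht
  have := h.block_lt t (by omega) ht x (by omega) hxt
  omega

/-- Equality would make `x` the parent of `t`, whose block is larger. This is why a large block
occurs only once in a window. -/
theorem add_lt_of_block_eq (h : BlockTree K q B) {x t : ℕ} (hxt : x < t) (ht : t < K (q + 1))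
    (hb : B t = B x) : x + K (B t) < t := by
  refine lt_of_le_of_ne (h.add_le_of_block_le hxt ht hb.le) fun he => ?_
  have := h.block_lt_parent t (by omega) ht
  rw [show t - K (B t) = x by omega] at this
  omega

/-- Parents of later nodes do not lie strictly between an earlier node and its parent. -/
theorem parent_nested (h : BlockTree K q B) {x t : ℕ} (hx : x < K (q + 1))
    (hpx : x - K (B x) < t) (htx : t < x) : x - K (B x) ≤ t - K (B t) := by
  by_contra hc
  have h1 := h.block_lt x (by omega) hx t hpx htx
  have h2 := h.block_lt t (by omega) (by omega) (x - K (B x)) (by omega) hpx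
  have h3 := h.block_lt_parent x (by omega) hx
  omega

/-- If `m < B z` and nothing intervenes, `z + K m` is a child of `z`. If `m = B z`, the parent `z -
K m` has a larger block, and the claim for it and `m + 1` gives a node beyond `z`, within reach
because `K (m + 1) ≤ 2 * K m`. -/
theorem exists_block_ge (h : BlockTree K q B) {z m : ℕ} (hm : m ≤ B z)
    (hz : z + K m < K (q + 1)) : ∃ x, z < x ∧ x ≤ z + K m ∧ m ≤ B x := by
  induction hj : q + 1 - m generalizing z m with
  | zero =>
    have := h.mono (show q + 1 ≤ m by omega)
    omega
  | succ j ih =>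
    by_contra hc
    push Not at hc
    have hpos := h.pos m
    rcases Nat.lt_or_eq_of_le hm with hlt | heq
    · have := h.child z m hz hlt fun x h1 h2 => lt_trans (hc x h1 h2) hlt
      have := hc (z + K m) (by omega) le_rfl
      omega
    · have hz0 : 0 < z := by
        rcases Nat.eq_zero_or_pos z with rfl | h0
        · rw [h.root] at heq
          subst heq
          omega
        · exact h0
      have hd := h.le_double m
      have h1 := h.skip_le z hz0 (by omega)
      have h2 := h.block_lt_parent z hz0 (by omega)
      have h3 := h.block_lt z hz0 (by omega)
      rw [← heq] at h1 h2 h3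
      obtain ⟨x, hx1, hx2, hx3⟩ := ih (z := z - K m) (m := m + 1) (by omega) (by omega) (by omega)
      rcases lt_trichotomy x z with hl | he | hg
      · have := h3 x hx1 hl
        omega
      · subst he; omega
      · have := hc x hg (by omega)
        omega

/-- The last node up to `R` whose block is at least `m`. -/
theorem exists_last_block_ge (h : BlockTree K q B) {m : ℕ} (hm : m ≤ q + 1) (R : ℕ) :
    ∃ P ≤ R, m ≤ B P ∧ ∀ x, P < x → x ≤ R → B x < m := by
  induction R with
  | zero => exact ⟨0, le_rfl, by rw [h.root]; exact hm, fun x h1 h2 => by omega⟩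
  | succ R ih =>
    by_cases hR : m ≤ B (R + 1)
    · exact ⟨R + 1, le_rfl, hR, fun x h1 h2 => by omega⟩
    · obtain ⟨P, h1, h2, h3⟩ := ih
      refine ⟨P, by omega, h2, fun x hx hxR => ?_⟩
      rcases Nat.lt_or_eq_of_le hxR with hl | he
      · exact h3 x hx (by omega)
      · rw [he]; omega

/-- The first node in an interval whose block is at least `m`. -/
theorem exists_first_block_ge (B : ℕ → ℕ) {m y X : ℕ} (hyX : y < X) (hX : m ≤ B X) :
    ∃ x, y < x ∧ x ≤ X ∧ m ≤ B x ∧ ∀ w, y < w → w < x → B w < m := by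
  classical
  have hex : ∃ x, y < x ∧ m ≤ B x := ⟨X, hyX, hX⟩
  refine ⟨Nat.find hex, (Nat.find_spec hex).1, Nat.find_min' hex ⟨hyX, hX⟩,
    (Nat.find_spec hex).2, fun w h1 h2 => ?_⟩
  have := Nat.find_min hex h2
  simp only [h1, true_and, not_le] at this
  exact this

/-- The parent of the first node with block at least `m` after `y` is at most `y`. -/
theorem parent_le_of_first (h : BlockTree K q B) {m y x : ℕ} (hyx : y < x) (hx : x < K (q + 1))
    (hm : m ≤ B x) (hf : ∀ w, y < w → w < x → B w < m) : x - K (B x) ≤ y := by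
  by_contra hc
  have h1 := h.block_lt_parent x (by omega) hx
  have h2 := hf (x - K (B x)) (by omega) (by have := h.pos (B x); omega)
  omega

theorem block_parent_ge (h : BlockTree K q B) {t P m : ℕ} (ht : t < K (q + 1)) (hPt : P < t)
    (hP : m ≤ B P) (hlt : B t < m) : P ≤ t - K (B t) := by
  by_contra hc
  have := h.block_lt t (by omega) ht P (by omega) hPt
  omega

/-- Up to rounding, nodes with blocks at least `m` are `K m` apart. When `B n = m` one passes to the
parent of `n` and to `m + 1`; each such level loses at most one, from `2 * K m ≤ K (m + 1) + 1`. -/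
theorem gap (h : BlockTree K q B) {n x m : ℕ} (hnx : n < x) (hx : x < K (q + 1)) (hn : m ≤ B n)
    (hmx : m ≤ B x) : n + K m ≤ x + (B x - m) := by
  induction hj : B x - m generalizing n m with
  | zero =>
    have : m = B x := by omega
    subst this
    simpa using h.add_le_of_block_le hnx hx hn
  | succ j ih =>
    rcases Nat.lt_or_eq_of_le hn with hl | he
    · have := ih hnx (m := m + 1) hl (by omega) (by omega)
      have := h.lt_succ m
      omega
    · have hn0 : 0 < n := by
        rcases Nat.eq_zero_or_pos n with rfl | h0
        · rw [h.root] at he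
          have := h.block_le x hnx hx
          omega
        · exact h0
      have h1 := h.skip_le n hn0 (by omega)
      have h2 := h.block_lt_parent n hn0 (by omega)
      rw [← he] at h1 h2
      have h3 := ih (n := n - K m) (m := m + 1) (by omega) h2 (by omega) (by omega)
      have := h.double_le m
      omega

theorem block_skip (h : BlockTree K q B) {e : ℕ} (he : e ≤ q) : B (K e) = e := by
  have hlt : K e < K (q + 1) := h.lt (by omega)
  have := h.child 0 e (by omega) (by rw [h.root]; omega) fun x h1 h2 => by
    rw [h.root]
    have := h.block_le x h1 (by omega)
    omega
  rwa [zero_add] at this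

/-- A child of `z` in a range where all blocks are below some bound. -/
theorem child' (h : BlockTree K q B) {z e m : ℕ} (hz : z + K e < K (q + 1)) (hm : m ≤ B z)
    (he : e < m) (hx : ∀ x, z < x → x ≤ z + K e → B x < m) : B (z + K e) = e :=
  h.child z e hz (by omega) fun x h1 h2 => lt_of_lt_of_le (hx x h1 h2) hm

theorem block_add (h : BlockTree K q B) {x : ℕ} (h0 : 0 < x) (hx : x < K q) :
    B (x + K q) = B x := by
  have := h.top_double
  exact h.add_skip q le_rfl x h0 (by omega)

end BlockTree

/-! ### Sources and known blocks. -/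

/-- The node `t` can be the source of the block received by `R` in round `k`, when the blocks in
`S` are already known: `R - K (k + 1)` lies on the edge from `t` to its parent, and `t` does not
exceed the from-processor `R - K k`. -/
def Eligible (K B : ℕ → ℕ) (R k : ℕ) (S : Finset ℕ) (t : ℕ) : Prop :=
  0 < t ∧ t + K k ≤ R ∧ R ≤ t + K (k + 1) ∧ t - K (B t) + K (k + 1) ≤ R ∧ B t ∉ S

open Classical in
/-- The largest eligible node. -/
noncomputable def pick (K B : ℕ → ℕ) (R k : ℕ) (S : Finset ℕ) : ℕ :=
  Nat.findGreatest (Eligible K B R k S) R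

/-- The blocks known to `R` before round `k`. -/
noncomputable def known (K B : ℕ → ℕ) (R : ℕ) : ℕ → Finset ℕ
  | 0 => {B R}
  | k + 1 => insert (B (pick K B R k (known K B R k))) (known K B R k)

/-- The node whose block `R` receives in round `k`. -/
noncomputable def source (K B : ℕ → ℕ) (R k : ℕ) : ℕ := pick K B R k (known K B R k)

/-- In each of the first `k` rounds there is an eligible node. -/
def Good (K B : ℕ → ℕ) (R k : ℕ) : Prop :=
  ∀ j < k, Eligible K B R j (known K B R j) (source K B R j)

/-- A receiver `R = p + r`, where `p = K q` is the copy of the root. -/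
structure Receiver (K : ℕ → ℕ) (q : ℕ) (B : ℕ → ℕ) (R : ℕ) : Prop extends BlockTree K q B where
  skip_le_self : K q ≤ R
  lt_top : R < K (q + 1)

section
variable {K B : ℕ → ℕ} {R k : ℕ}

theorem known_succ (j : ℕ) :
    known K B R (j + 1) = insert (B (source K B R j)) (known K B R j) := rfl

theorem known_subset {i j : ℕ} (hij : i ≤ j) : known K B R i ⊆ known K B R j := by
  induction j, hij using Nat.le_induction with
  | base => exact subset_rfl
  | succ j _ ih => exact ih.trans (Finset.subset_insert _ _)

theorem mem_known_succ {i j : ℕ} (hij : i < j) : B (source K B R i) ∈ known K B R j :=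
  known_subset hij (Finset.mem_insert_self _ _)

theorem self_mem_known (j : ℕ) : B R ∈ known K B R j :=
  known_subset (Nat.zero_le j) (Finset.mem_singleton_self _)

theorem le_source {t : ℕ} (ht : Eligible K B R k (known K B R k) t) : t ≤ source K B R k := by
  classical
  exact Nat.le_findGreatest (by have := ht.2.1; omega) ht

theorem source_eligible {t : ℕ} (ht : Eligible K B R k (known K B R k) t) :
    Eligible K B R k (known K B R k) (source K B R k) := by
  classical
  exact Nat.findGreatest_spec (P := Eligible K B R k (known K B R k)) (m := t)
    (by have := ht.2.1; omega) ht

theorem Good.mono {i : ℕ} (hg : Good K B R k) (hi : i ≤ k) : Good K B R i :=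
  fun j hj => hg j (by omega)

theorem mem_known_iff {e : ℕ} :
    e ∈ known K B R k ↔ e = B R ∨ ∃ j < k, e = B (source K B R j) := by
  induction k with
  | zero => simp [known]
  | succ k ih =>
    rw [known_succ, Finset.mem_insert, ih]
    constructor
    · rintro (h | h | ⟨j, hj, h⟩)
      · exact Or.inr ⟨k, by omega, h⟩
      · exact Or.inl h
      · exact Or.inr ⟨j, by omega, h⟩
    · rintro (h | ⟨j, hj, h⟩)
      · exact Or.inr (Or.inl h)
      · rcases Nat.lt_or_eq_of_le (Nat.le_of_lt_succ hj) with hl | rfl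
        · exact Or.inr (Or.inr ⟨j, hl, h⟩)
        · exact Or.inl h

end

/-! ### What a receiver knows before a given round. -/

namespace Receiver
variable {K : ℕ → ℕ} {q : ℕ} {B : ℕ → ℕ} {R k : ℕ}

theorem skip_le_R (c : Receiver K q B R) (hk : k ≤ q) : K k ≤ R := (c.mono hk).trans c.skip_le_self

theorem R_pos (c : Receiver K q B R) : 0 < R := (c.pos q).trans_le c.skip_le_self

theorem source_lt_R (c : Receiver K q B R) (hg : Good K B R k) {j : ℕ} (hj : j < k) :
    source K B R j < R := by
  have := (hg j hj).2.1
  have := c.pos j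
  omega

/-- The windows of different rounds share at most an endpoint, and a node is not chosen twice
because its block is known after the first time. -/
theorem source_anti (c : Receiver K q B R) (hg : Good K B R k) {i j : ℕ} (hij : i < j)
    (hj : j < k) : source K B R j < source K B R i := by
  have h1 := hg j hj
  have h2 := hg i (hij.trans hj)
  have h3 := c.mono (show i + 1 ≤ j from hij)
  refine lt_of_le_of_ne (by have := h1.2.1; have := h2.2.2.1; omega) fun he => ?_
  exact h1.2.2.2.2 (he ▸ mem_known_succ hij)

theorem source_anti' (c : Receiver K q B R) (hg : Good K B R k) {i j : ℕ} (hij : i ≤ j)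
    (hj : j < k) : source K B R j ≤ source K B R i := by
  rcases Nat.lt_or_eq_of_le hij with h | rfl
  · exact (c.source_anti hg h hj).le
  · exact le_rfl

theorem card_known (_ : Receiver K q B R) (hg : Good K B R k) :
    (known K B R k).card = k + 1 := by
  induction k with
  | zero => rfl
  | succ k ih =>
    rw [known_succ, Finset.card_insert_of_notMem (hg k (by omega)).2.2.2.2,
      ih (hg.mono (Nat.le_succ k))]

/-- Every known block stems from a node in the window of length `K k` below `R`. -/
theorem exists_witness (c : Receiver K q B R) (hg : Good K B R k) {e : ℕ}
    (he : e ∈ known K B R k) :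
    ∃ t, B t = e ∧ 0 < t ∧ t ≤ R ∧ R ≤ t + K k ∧ (∀ j < k, source K B R j ≤ t ∨
      ∃ i < k, j < i ∧ t = source K B R i) ∧ (t = R ∨ ∃ j < k, t = source K B R j) := by
  rcases mem_known_iff.1 he with h | ⟨i, hi, h⟩
  · exact ⟨R, h.symm, c.R_pos, le_rfl, by omega, fun j hj => Or.inl (c.source_lt_R hg hj).le,
      Or.inl rfl⟩
  · refine ⟨source K B R i, h.symm, (hg i hi).1, (c.source_lt_R hg hi).le, ?_, fun j hj => ?_,
      Or.inr ⟨i, hi, rfl⟩⟩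
    · have := (hg i hi).2.2.1
      have := c.mono (show i + 1 ≤ k from hi)
      omega
    · rcases le_or_gt i j with hij | hij
      · exact Or.inl (c.source_anti' hg hij hj)
      · exact Or.inr ⟨i, hi, hij, rfl⟩

theorem block_le_of_mem (c : Receiver K q B R) (hg : Good K B R k) {e : ℕ}
    (he : e ∈ known K B R k) : e ≤ q := by
  obtain ⟨t, rfl, h0, hR, -⟩ := c.exists_witness hg he
  exact c.block_le t h0 (lt_of_le_of_lt hR c.lt_top)

/-- A block with large index is not known yet if its node precedes all sources so far. -/
theorem notMem_known (c : Receiver K q B R) (hg : Good K B R k) {X : ℕ}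
    (hX : R ≤ X + K (k + 1)) (hXR : X < R) (hB : k + 1 ≤ B X)
    (hs : ∀ j < k, X < source K B R j) : B X ∉ known K B R k := by
  intro he
  obtain ⟨t, ht, h0, hR, h1, -, h2⟩ := c.exists_witness hg he
  have hXt : X < t := by
    rcases h2 with rfl | ⟨j, hj, rfl⟩
    · exact hXR
    · exact hs j hj
  have := c.add_lt_of_block_eq hXt (lt_of_le_of_lt hR c.lt_top) ht
  have := c.mono hB
  rw [← ht] at this
  omega

/-- The block of a node that dominates the window above it gets known. -/
theorem mem_known_of_dominant (c : Receiver K q B R) (hg : Good K B R k) {P : ℕ} (h0 : 0 < P)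
    (hPR : P ≤ R) (hP : R < P + K k) (hpar : P - K (B P) + K k ≤ R)
    (hdom : ∀ x, P < x → x < R → B x < B P) : B P ∈ known K B R k := by
  rcases Nat.lt_or_eq_of_le hPR with hlt | rfl
  swap
  · exact self_mem_known k
  have hex : ∃ j, j < k ∧ P + K j ≤ R ∧ R < P + K (j + 1) := by
    clear hpar hdom
    induction k with
    | zero => rw [c.zero] at hP; omega
    | succ k ih =>
      rcases lt_or_ge R (P + K k) with hl | hl
      · obtain ⟨j, h1, h2⟩ := ih (hg.mono (Nat.le_succ k)) hl
        exact ⟨j, by omega, h2⟩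
      · exact ⟨k, by omega, hl, hP⟩
  obtain ⟨j, hj, h1, h2⟩ := hex
  by_cases hmem : B P ∈ known K B R j
  · exact known_subset hj.le hmem
  have hm := c.mono (show j + 1 ≤ k from hj)
  have hel : Eligible K B R j (known K B R j) P := ⟨h0, h1, h2.le, by omega, hmem⟩
  have hle := le_source hel
  rcases Nat.lt_or_eq_of_le hle with hl | he
  -- A larger source of round `j` has its parent below `P`, since `R - K (j + 1) < P`. Then `P` lies
  -- between the two and has a smaller block than the source, against dominance.
  · exfalso
    have hs := hg j hj
    have hsR := c.source_lt_R hg hj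
    have e1 := hdom _ hl hsR
    have e2 := c.block_lt _ hs.1 (hsR.trans c.lt_top) P (by have := hs.2.2.2.1; omega) hl
    omega
  · rw [he]
    exact mem_known_succ hj

/-- The last node with block at least `m > k` gets known if it lies in the window. -/
theorem last_mem_known (c : Receiver K q B R) (hg : Good K B R k) {P m : ℕ} (hm : k ≤ m)
    (h0 : 0 < P) (hPR : P ≤ R) (hP : R < P + K k) (hB : m ≤ B P)
    (hlast : ∀ x, P < x → x ≤ R → B x < m) : B P ∈ known K B R k := by
  refine c.mem_known_of_dominant hg h0 hPR hP ?_ fun x h1 h2 => by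
    have := hlast x h1 h2.le
    omega
  have h1 := c.skip_le P h0 (lt_of_le_of_lt hPR c.lt_top)
  have h2 := c.mono (hm.trans hB)
  omega

theorem exists_large_known (c : Receiver K q B R) (hg : Good K B R k) {X m : ℕ} (hkm : k ≤ m)
    (hm : m ≤ q + 1) (hX : R < X + K k) (h0 : 0 < X) (hXR : X ≤ R) (hB : m ≤ B X) :
    ∃ x, X ≤ x ∧ x ≤ R ∧ m ≤ B x ∧ B x ∈ known K B R k := by
  obtain ⟨P, h1, h2, h3⟩ := c.exists_last_block_ge hm R
  have hXP : X ≤ P := by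
    by_contra hc
    have := h3 X (by omega) hXR
    omega
  exact ⟨P, hXP, h1, h2, c.last_mem_known hg hkm (by omega) h1 (by omega) h2 h3⟩

theorem source_zero (c : Receiver K q B R) (hq : 0 < q) : source K B R 0 + 1 = R := by
  have h0 := c.zero
  have h1 := c.one
  have hR2 : 2 ≤ R := by
    have := c.mono (show 1 ≤ q from hq)
    have := c.skip_le_self
    omega
  have hel : Eligible K B R 0 (known K B R 0) (R - 1) := by
    have hp := c.pos (B (R - 1))
    refine ⟨by omega, by rw [h0]; omega, by rw [zero_add, h1]; omega, by rw [zero_add, h1]; omega, ?_⟩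
    intro hmem
    have hB : B (R - 1) = B R := Finset.mem_singleton.1 hmem
    have := c.add_lt_of_block_eq (show R - 1 < R by omega) c.lt_top hB.symm
    have := c.pos (B R)
    omega
  have := le_source hel
  have := (source_eligible hel).2.1
  omega

/-- Pigeonhole: `T` and `Finset.range m` are disjoint, so `S` is too small to contain both. -/
theorem exists_missing {S T : Finset ℕ} {m : ℕ} (hTS : T ⊆ S) (hT : ∀ x ∈ T, m ≤ x)
    (hc : S.card < T.card + m) : ∃ e < m, e ∉ S := by
  by_contra hcon
  push Not at hcon
  have hd : Disjoint T (Finset.range m) := by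
    rw [Finset.disjoint_left]
    intro x hx hxm
    have := hT x hx
    have := Finset.mem_range.1 hxm
    omega
  have := Finset.card_le_card (Finset.union_subset hTS fun x hx => hcon x (Finset.mem_range.1 hx))
  rw [Finset.card_union_of_disjoint hd, Finset.card_range] at this
  omega

theorem exists_missing_of_mem (c : Receiver K q B R) (hg : Good K B R k) {e : ℕ}
    (he : e ∈ known K B R k) (hke : k < e) : ∃ e' ≤ k, e' ∉ known K B R k := by
  obtain ⟨e', h1, h2⟩ := exists_missing (S := known K B R k) (T := {e}) (m := k + 1)
    (by simpa using he) (by simpa using hke) (by rw [c.card_known hg, Finset.card_singleton]; omega)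
  exact ⟨e', by omega, h2⟩

/-- If `R` is a child, with block `k + 1`, of the node `y = R - K (k + 1)`, then an earlier child
of `y` is eligible in round `k`. -/
theorem eligible_child (c : Receiver K q B R) (hg : Good K B R k) (hk : k < q)
    (hB : B R = k + 1) :
    ∃ y, y + K (k + 1) = R ∧ ∃ e ≤ k, Eligible K B R k (known K B R k) (y + K e) := by
  have hR := c.R_pos
  have hle := c.skip_le R hR c.lt_top
  have hbl := c.block_lt R hR c.lt_top
  have hpar := c.block_lt_parent R hR c.lt_top
  rw [hB] at hle hbl hpar
  obtain ⟨y, hy⟩ : ∃ y, y + K (k + 1) = R := ⟨R - K (k + 1), by omega⟩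
  rw [show R - K (k + 1) = y by omega] at hbl hpar
  refine ⟨y, hy, ?_⟩
  obtain ⟨e, he, hmem⟩ := c.exists_missing_of_mem hg (self_mem_known k) (by omega)
  have hchild : ∀ e ≤ k, B (y + K e) = e := fun e he => by
    have := c.lt (show e < k + 1 by omega)
    have := c.lt_top
    exact c.child' (by omega) hpar.le (by omega) fun x h1 h2 => hbl x h1 (by omega)
  have hd := c.double_le k
  have hd' := c.le_double k
  have hlt := c.lt_succ k
  -- Failure forces `e = k` and `K (k + 1) = 2 * K k - 1`. Then `y + K k` dominates the window above
  -- it, so its block `k` would be known.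
  have hcase : y + K e + K k ≤ R := by
    by_contra hc
    have hek : e = k := by
      by_contra hne
      have := c.lt (show e < k by omega)
      omega
    subst hek
    refine hmem ?_
    have h1 := hchild e le_rfl
    have h2 := c.mem_known_of_dominant hg (P := y + K e) (by have := c.pos e; omega) (by omega)
      (by omega) (by rw [h1]; omega) fun x hx hxR => by
        rw [h1]
        have := hbl x (by have := c.pos e; omega) hxR
        refine lt_of_le_of_ne (by omega) fun hxe => ?_
        have := c.add_lt_of_block_eq (x := y + K e) (t := x) hx (by have := c.lt_top; omega) (by omega)
        rw [hxe] at this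
        omega
    rwa [h1] at h2
  refine ⟨e, he, by have := c.pos e; omega, hcase, by omega, ?_, ?_⟩
  · rw [hchild e he]; omega
  · rwa [hchild e he]

/-- The eligible child from `eligible_child` lies strictly above `R - K (k + 1)`, and the source is
at least as large. -/
theorem source_ne_of_block_eq (c : Receiver K q B R) (hg : Good K B R k) (hk : k < q)
    (hB : B R = k + 1) : R < source K B R k + K (k + 1) := by
  obtain ⟨y, hy, e, he, hel⟩ := c.eligible_child hg hk hB
  have := le_source hel
  have := c.pos e
  omega

/-- If `R` accepts a node at the far end of its window, then block `0` is already known. -/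
theorem zero_mem_known (c : Receiver K q B R) (hk : k < q) (hg : Good K B R (k + 1))
    (he : source K B R k + K (k + 1) = R) (hB : k + 1 ≤ B (source K B R k)) :
    0 ∈ known K B R k := by
  set f := source K B R k with hf
  have hel := hg k (Nat.lt_succ_self k)
  have hlt := c.lt_succ k
  have hk1 := c.mono (show 1 ≤ k + 1 by omega)
  rw [c.one] at hk1
  have hRl := c.lt_top
  have hB0 : ∀ hc : B (f + 1) < B f, B (f + 1) = 0 := fun hc => by
    have := c.child f 0 (by rw [c.zero]; omega) (by omega) fun x h1 h2 => by
      rw [c.zero] at h2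
      rwa [show x = f + 1 by omega]
    rwa [c.zero] at this
  have hnot : ¬ Eligible K B R k (known K B R k) (f + 1) := fun hc => by
    have := le_source hc
    omega
  have hpar : f + 1 - K (B (f + 1)) ≤ f := by
    have := c.pos (B (f + 1))
    omega
  -- The node `f + 1` satisfies every other condition of eligibility but exceeds the source, so its
  -- block is not new.
  have hmem : B (f + 1) ∈ known K B R k := by
    by_contra hc
    exact hnot ⟨by omega, by omega, by omega, by omega, hc⟩
  rcases lt_or_ge (B (f + 1)) (B f) with hl | hl
  · rwa [hB0 hl] at hmem
  · exfalso
    have hne : B (f + 1) ≠ B f := fun h => by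
      have := c.add_lt_of_block_eq (show f < f + 1 by omega) (by omega) h
      have := c.pos (B (f + 1))
      omega
    -- A large block at `f + 1` can be known only if `f + 1` is an earlier source. The window
    -- lengths then force `k = 1`, and `source_zero` gives `K 2 = 2 = K 1`.
    refine c.notMem_known (hg.mono (Nat.le_succ k)) (X := f + 1) (by omega) (by omega) (by omega)
      (fun j hj => ?_) hmem
    have h1 := c.source_anti hg hj (Nat.lt_succ_self k)
    refine lt_of_le_of_ne h1 fun h2 => ?_
    have h3 := (hg j (by omega)).2.2.1
    have h4 := c.mono (show j + 1 ≤ k from hj)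
    have h5 := c.double_le k
    have hk1 : k = 1 := by
      by_contra hne
      have h6 := c.lt (show 1 < k by omega)
      rw [c.one] at h6
      omega
    subst hk1
    have hj0 : j = 0 := by omega
    subst hj0
    have h6 := c.source_zero (by omega)
    have h7 := c.one
    simp only [Nat.reduceAdd] at *
    omega

end Receiver

/-! ### Large blocks accepted at the far end of a window. -/

namespace Receiver
variable {K : ℕ → ℕ} {q : ℕ} {B : ℕ → ℕ} {R k : ℕ}

/-- `R` accepts in round `k` the node at the far end of its window, and its block is large.
This happens only next to a node whose subtree is strongly truncated. -/
structure FarLarge (K : ℕ → ℕ) (q : ℕ) (B : ℕ → ℕ) (R k : ℕ) : Prop where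
  lt : k + 1 < q
  good : Good K B R (k + 1)
  far : source K B R k + K (k + 1) = R
  large : k + 2 ≤ B (source K B R k)

theorem FarLarge.block_ne (w : FarLarge K q B R k) (c : Receiver K q B R) : B R ≠ k + 1 := fun h => by
  have h1 := c.source_ne_of_block_eq (w.good.mono (Nat.le_succ k)) (by have := w.lt; omega) h
  have := w.far
  omega

/-- A node between the far source and `R` cannot have block `k + 1`. -/
theorem FarLarge.block_ne' (w : FarLarge K q B R k) (c : Receiver K q B R) {x : ℕ}
    (hx : source K B R k < x) (hxR : x ≤ R) : B x ≠ k + 1 := fun h => by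
  have h1 := c.lt_top
  have h2 := c.add_le_of_block_le hx (by omega) (by have := w.large; omega)
  rw [h] at h2
  have := w.far
  exact w.block_ne c (by rwa [show R = x by omega])

/-- A witness of `k + 1` lies in the window that starts at the far source. It is not that source,
whose block is larger, and `FarLarge.block_ne'` excludes the rest. -/
theorem FarLarge.notMem (w : FarLarge K q B R k) (c : Receiver K q B R) :
    k + 1 ∉ known K B R (k + 1) := fun h => by
  obtain ⟨t, h1, h2, h3, h4, -⟩ := c.exists_witness w.good h
  have := w.far
  rcases Nat.lt_or_eq_of_le (show source K B R k ≤ t by omega) with hl | he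
  · exact w.block_ne' c hl h3 h1
  · have := w.large
    rw [he] at this
    omega

theorem FarLarge.exists_large (w : FarLarge K q B R k) (c : Receiver K q B R) :
    ∃ X, source K B R k < X ∧ X ≤ R ∧ k + 2 ≤ B X := by
  have h0 := c.lt_top
  have h1 := w.far
  have h2 := w.large
  obtain ⟨X, hX1, hX2, hX3⟩ := c.exists_block_ge (z := source K B R k) (m := k + 1) (by omega)
    (by omega)
  have := w.block_ne' c hX1 (by omega)
  exact ⟨X, hX1, by omega, by omega⟩

/-- Two of the `k + 2` known blocks exceed `k`: that of the far source and that of the last large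
node up to `R`. So one of the `k + 1` blocks up to `k` is missing. -/
theorem FarLarge.exists_missing_lt (w : FarLarge K q B R k) (c : Receiver K q B R) :
    ∃ e ≤ k, e ∉ known K B R (k + 1) := by
  obtain ⟨X, hX1, hX2, hX3⟩ := w.exists_large c
  have h1 := w.far
  have h2 := w.large
  have h3 := w.lt
  have h4 := c.lt_top
  obtain ⟨x, hx1, hx2, hx3, hx4⟩ := c.exists_large_known w.good (X := X) (m := k + 2) (by omega)
    (by omega) (by omega) (by omega) hX2 hX3
  have hne : B x ≠ B (source K B R k) := fun h => by
    have h5 := c.add_lt_of_block_eq (show source K B R k < x by omega) (by omega) h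
    have := c.mono (show k + 1 ≤ B x by omega)
    omega
  obtain ⟨e, he1, he2⟩ := exists_missing (S := known K B R (k + 1)) (m := k + 1)
    (T := {B x, B (source K B R k)}) (by
      intro z hz
      rcases Finset.mem_insert.1 hz with rfl | hz
      · exact hx4
      · rw [Finset.mem_singleton.1 hz]
        exact mem_known_succ (Nat.lt_succ_self k)) (by
      intro z hz
      rcases Finset.mem_insert.1 hz with rfl | hz
      · omega
      · rw [Finset.mem_singleton.1 hz]
        omega) (by rw [c.card_known w.good, Finset.card_pair hne]; omega)
  exact ⟨e, by omega, he2⟩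

theorem FarLarge.pos (w : FarLarge K q B R k) (c : Receiver K q B R) : 0 < k := by
  by_contra hk
  have hk0 : k = 0 := by omega
  subst hk0
  have h1 := w.far
  have h2 := c.source_zero (by have := w.lt; omega)
  have h3 := c.one
  simp only [zero_add] at h1
  omega

/-- Let `t` be a witness of block `k`, `f` the far source and `X` the first large node after `f`. If
`X < t`, distances give `t = R`, and `X` is the far source of round `k - 1` although `B R = k`,
against `source_ne_of_block_eq`. If `t < X`, then `t = f + K k`, and a child `f + K e` with a
missing `e < k` would have been preferred to `f`. -/
theorem FarLarge.notMem_self (w : FarLarge K q B R k) (c : Receiver K q B R) :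
    k ∉ known K B R (k + 1) := fun hmem => by
  have hg := w.good.mono (Nat.le_succ k)
  have hfar := w.far
  have hlarge := w.large
  have hq := w.lt
  have hRl := c.lt_top
  have hmem' : k ∈ known K B R k := by
    rw [known_succ, Finset.mem_insert] at hmem
    exact hmem.resolve_left (by omega)
  obtain ⟨t, h1, h2, h3, h4, -⟩ := c.exists_witness hg hmem'
  obtain ⟨X', hX1, hX2, hX3⟩ := w.exists_large c
  obtain ⟨X, hfX, hXX', hXB, hXf⟩ := BlockTree.exists_first_block_ge B hX1 hX3
  set f := source K B R k with hf
  have hpar := c.parent_le_of_first hfX (by omega) hXB hXf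
  have hlt := c.lt_succ k
  have hd := c.double_le k
  have hd' := c.le_double k
  have hKB := c.mono (show k + 1 ≤ B X by omega)
  -- `X` is too close to `R` to be eligible, or it is the source of the round before
  have hXk : R ≤ X + K k ∧ (X + K k = R → B X ∈ known K B R k) := by
    have key : X + K k ≤ R → B X ∈ known K B R k := fun hle => by
      by_contra hc
      have := le_source (show Eligible K B R k (known K B R k) X from
        ⟨by omega, hle, by omega, by omega, hc⟩)
      omega
    refine ⟨?_, fun he => key he.le⟩
    by_contra hc
    obtain ⟨u, hu1, hu2, hu3, hu4, -⟩ := c.exists_witness hg (key (by omega))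
    have := c.add_lt_of_block_eq (show X < u by omega) (by omega) hu1
    rw [hu1] at this
    omega
  have htf : f < t := by
    have := c.lt_succ k
    omega
  rcases lt_trichotomy X t with hXt | hXt | hXt
  · have h5 := c.add_le_of_block_le hXt (by omega) (by omega)
    rw [h1] at h5
    have htR : t = R := by omega
    have hXm := hXk.2 (by omega)
    obtain ⟨u, hu1, hu2, hu3, hu4, -, hu5⟩ := c.exists_witness hg hXm
    have huX : u = X := by
      by_contra hne
      have := c.add_lt_of_block_eq (show X < u by omega) (by omega) hu1
      rw [hu1] at this
      omega
    subst huX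
    rcases hu5 with rfl | ⟨i, hi, hui⟩
    · omega
    · have h6 := (hg i hi).2.2.1
      have hik : i + 1 = k := by
        by_contra hne
        have := c.lt (show i + 1 < k by omega)
        omega
      have h7 := c.source_ne_of_block_eq (hg.mono hi.le) (by omega)
        (show B R = i + 1 by rw [← htR, h1, hik])
      rw [hik, ← hui] at h7
      omega
  · rw [hXt] at hXB
    omega
  · have hsmall : ∀ x, f < x → x < X → B x < k + 1 := fun x hx1 hx2 => by
      have h5 := hXf x hx1 hx2
      have h6 := w.block_ne' c hx1 (by omega)
      omega
    have hpt := c.block_parent_ge (t := t) (P := f) (m := k + 1) (by omega) htf (by omega)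
      (by omega)
    have hbt := c.block_lt_parent t h2 (by omega)
    have hst := c.skip_le t h2 (by omega)
    rw [h1] at hpt hbt hst
    have htk : t = f + K k := by
      by_contra hne
      have := c.pos k
      have := hsmall (t - K k) (by omega) (by omega)
      omega
    obtain ⟨x, hx1, hx2, hx3, hx4⟩ := c.exists_large_known hg (X := X) (m := k + 2) (by omega)
      (by omega) (by omega) (by omega) (by omega) hXB
    obtain ⟨e, he1, he2⟩ := c.exists_missing_of_mem hg hx4 (by omega)
    have hek : e ≠ k := fun h => he2 (h ▸ hmem')
    have hKe := c.lt (show e < k by omega)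
    have hpe := c.pos e
    have hBe : B (f + K e) = e := c.child' (m := k + 1) (by omega) (by omega) (by omega)
      fun x h5 h6 => hsmall x h5 (by omega)
    have := le_source (show Eligible K B R k (known K B R k) (f + K e) from
      ⟨by omega, by omega, by omega, by rw [hBe]; omega, by rwa [hBe]⟩)
    omega

/-! ### Existence of a source in every round. -/

/-- The eligible nodes in round `k`, by the position of the last node `P` up to `R - K (k + 1)`
with block larger than `k`. -/
theorem round_cases (c : Receiver K q B R) (hg : Good K B R k) (hk : k < q) :
    (∃ X, R < X + K (k + 1) ∧ k + 1 ≤ B X ∧ Eligible K B R k (known K B R k) X) ∨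
    ∃ P, P + K (k + 1) ≤ R ∧ k + 1 ≤ B P ∧
      (∀ t, P < t → Eligible K B R k (known K B R k) t → B t ≤ k) ∧
      ((P + K (k + 1) = R ∧ ∃ t, Eligible K B R k (known K B R k) t) ∨
      (R < P + K k + K (k + 1) ∧ B (P + K k) = k ∧
        Eligible K B R k (known K B R k) (P + K k)) ∨
      (P + 1 + K (k + 1) = R ∧ B (P + 1) = 0 ∧ 0 ∈ known K B R k ∧
        ∃ t, Eligible K B R k (known K B R k) t) ∨
      (P + K k + K (k + 1) = R ∧ B (P + K k) = k ∧
        Eligible K B R k (known K B R k) (P + K k))) := by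
  have hRl := c.lt_top
  have hRy := c.skip_le_R (show k + 1 ≤ q from hk)
  have hlt := c.lt_succ k
  have hd := c.double_le k
  have hd' := c.le_double k
  have hpk := c.pos k
  obtain ⟨y, hy⟩ : ∃ y, y + K (k + 1) = R := ⟨R - K (k + 1), by omega⟩
  obtain ⟨f, hf⟩ : ∃ f, f + K k = R := ⟨R - K k, by omega⟩
  -- In this case the first large node after `y` is eligible: its parent is at most `y`, and its
  -- block is new by `notMem_known`.
  by_cases hA : ∃ X, y < X ∧ X ≤ f ∧ k + 1 ≤ B X ∧ ∀ j < k, X < source K B R j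
  · left
    obtain ⟨X0, h1, h2, h3, h4⟩ := hA
    obtain ⟨X, hyX, hXX, hXB, hXf⟩ := BlockTree.exists_first_block_ge B h1 h3
    have hpar := c.parent_le_of_first hyX (by omega) hXB hXf
    exact ⟨X, by omega, hXB, by omega, by omega, by omega, by omega,
      c.notMem_known hg (by omega) (by omega) hXB fun j hj => by have := h4 j hj; omega⟩
  right
  push Not at hA
  obtain ⟨P, hPy, hPB, hPlast⟩ := c.exists_last_block_ge (m := k + 1) (by omega) y
  have hPlast' : ∀ x, P < x → x ≤ y → B x ≤ k := fun x h1 h2 => by have := hPlast x h1 h2; omega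
  -- a large block in the window is at its end `f`, the source of the previous round
  have hlarge : ∀ x, y < x → x ≤ f → k + 1 ≤ B x → x = f ∧ ∃ j, j + 1 = k ∧
      source K B R j = f := fun x h1 h2 h3 => by
    obtain ⟨j, hj, h4⟩ := hA x h1 h2 h3
    have h5 := (hg j hj).2.2.1
    have hjk : j + 1 = k := by
      by_contra hne
      have := c.lt (show j + 1 < k by omega)
      omega
    rw [hjk] at h5
    exact ⟨by omega, j, hjk, by omega⟩
  have hsmall : ∀ x, P < x → x < f → B x ≤ k := fun x h1 h2 => by
    rcases le_or_gt x y with h3 | h3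
    · exact hPlast' x h1 h3
    · by_contra hc
      have := (hlarge x h3 h2.le (by omega)).1
      omega
  refine ⟨P, by omega, hPB, ?_, ?_⟩
  · intro t hPt hel
    have := hel.2.1
    rcases Nat.lt_or_eq_of_le (show t ≤ f by omega) with hl | he
    · exact hsmall t hPt hl
    · by_contra hc
      obtain ⟨-, j, hj, h⟩ := hlarge t (by omega) he.le (by omega)
      refine hel.2.2.2.2 ?_
      rw [he, ← h]
      exact mem_known_succ (by omega)
  have hchild : ∀ e ≤ k, P + K e < f → B (P + K e) = e := fun e he hef => by
    refine c.child' (m := k + 1) (by omega) (by omega) (by omega) fun x h1 h2 => ?_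
    have := hsmall x h1 (by omega)
    omega
  have helig : ∀ e ≤ k, B (P + K e) = e → P + K e ≤ f → y ≤ P + K e → e ∉ known K B R k →
      Eligible K B R k (known K B R k) (P + K e) := fun e he h1 h2 h3 h4 => by
    have := c.pos e
    exact ⟨by omega, by omega, by omega, by rw [h1]; omega, by rwa [h1]⟩
  rcases Nat.lt_or_eq_of_le hPy with hPlt | rfl
  swap
  · left
    refine ⟨hy, ?_⟩
    rcases Nat.eq_zero_or_pos P with rfl | hP0
    · rw [zero_add] at hy
      have hB := c.block_skip (show k + 1 ≤ q from hk)
      rw [hy] at hB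
      obtain ⟨y', -, e, -, he⟩ := c.eligible_child hg hk hB
      exact ⟨_, he⟩
    · have := c.pos (B P)
      refine ⟨P, hP0, by omega, by omega, by omega,
        c.notMem_known hg (by omega) (by omega) hPB fun j hj => ?_⟩
      have h1 := (hg j hj).2.2.1
      have h2 := c.mono (show j + 1 ≤ k from hj)
      omega
  right
  -- Since no large node lies strictly between `P` and `f`, this one shows that `P + K (k + 1)`
  -- reaches `f`.
  obtain ⟨X, hX1, hX2, hX3⟩ := c.exists_block_ge (z := P) (m := k + 1) hPB (by omega)
  have hXf : f ≤ X := by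
    by_contra hc
    have := hsmall X hX1 (by omega)
    omega
  -- A large block at `f` was accepted at the far end of the previous window; the `FarLarge` lemmas
  -- then provide a new block of size at most `k`.
  by_cases hBf : k + 1 ≤ B f
  · obtain ⟨-, j, rfl, hjf⟩ := hlarge f (by omega) le_rfl hBf
    have w : FarLarge K q B R j := ⟨hk, hg, by rw [hjf]; exact hf, by rw [hjf]; exact hBf⟩
    rcases lt_trichotomy (P + K (j + 1)) y with h1 | h1 | h1
    · omega
    · have hBy := hchild (j + 1) le_rfl (by omega)
      exact Or.inr (Or.inr ⟨by omega, hBy, helig _ le_rfl hBy (by omega) (by omega) (w.notMem c)⟩)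
    · rcases lt_or_ge (P + K (j + 1)) f with h2 | h2
      · have hBy := hchild (j + 1) le_rfl h2
        exact Or.inl ⟨by omega, hBy, helig _ le_rfl hBy (by omega) (by omega) (w.notMem c)⟩
      -- Here `2 * K k ≤ K (k + 1) + 1` leaves only `P + 1 = y`.
      · right; left
        have h0 : B (P + 1) = 0 := by
          have := hchild 0 (by omega) (by rw [c.zero]; omega)
          rwa [c.zero] at this
        obtain ⟨e, he, hem⟩ := w.exists_missing_lt c
        have hKe := c.lt (show e < j + 1 by omega)
        have := c.pos e
        exact ⟨by omega, h0, known_subset (Nat.le_succ j) (c.zero_mem_known (by omega) hg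
          (by rw [hjf]; exact hf) (by rw [hjf]; omega)), _,
          helig e (by omega) (hchild e (by omega) (by omega)) (by omega) (by omega) hem⟩
  · have hXf' : f < X := lt_of_le_of_ne hXf fun h => hBf (by rw [h]; exact hX3)
    have hsmall' : ∀ x, P < x → x ≤ f → B x ≤ k := fun x h1 h2 => by
      rcases Nat.lt_or_eq_of_le h2 with h3 | rfl
      · exact hsmall x h1 h3
      · omega
    have hchild' : ∀ e ≤ k, P + K e ≤ f → B (P + K e) = e := fun e he hef => by
      refine c.child' (m := k + 1) (by omega) (by omega) (by omega) fun x h1 h2 => ?_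
      have := hsmall' x h1 (by omega)
      omega
    have hBk := hchild' k le_rfl (by omega)
    by_cases hkm : k ∈ known K B R k
    swap
    · exact Or.inl ⟨by omega, hBk, helig k le_rfl hBk (by omega) (by omega) hkm⟩
    right; left
    obtain ⟨t, ht1, ht2, ht3, ht4, -, ht5⟩ := c.exists_witness hg hkm
    -- A second node with block `k` after `P + K k` would have its parent, of block above `k`,
    -- between `P` and `f`.
    have hparent : ∀ t, B t = k → 0 < t → t ≤ R → P + K k < t → False := fun t h1 h2 h3 h4 => by
      have h5 := c.add_lt_of_block_eq h4 (by omega) (by omega)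
      have h6 := c.block_lt_parent t h2 (by omega)
      rw [h1] at h5 h6
      have := hsmall' (t - K k) (by omega) (by omega)
      omega
    have htk : t = P + K k := by
      by_contra hne
      exact hparent t ht1 ht2 ht3 (by omega)
    have htf : t = f := by omega
    obtain ⟨x, hx1, hx2, hx3, hx4⟩ := c.exists_large_known hg (X := X) (m := k + 1) (by omega)
      (by omega) (by omega) (by omega) (by omega) hX3
    obtain ⟨e, he1, he2⟩ := c.exists_missing_of_mem hg hx4 (by omega)
    have hek : e ≠ k := fun h => he2 (h ▸ hkm)
    have hKe := c.lt (show e < k by omega)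
    have hpe := c.pos e
    have h0 : B (P + 1) = 0 := by
      have := hchild' 0 (by omega) (by rw [c.zero]; omega)
      rwa [c.zero] at this
    refine ⟨by omega, h0, ?_, _, helig e (by omega) (hchild' e (by omega) (by omega)) (by omega)
      (by omega) he2⟩
    rcases ht5 with rfl | ⟨j, hj, hjt⟩
    · omega
    · have h5 := (hg j hj).2.2.1
      have hjk : j + 1 = k := by
        by_contra hne
        have := c.lt (show j + 1 < k by omega)
        omega
      subst hjk
      exact known_subset (Nat.le_succ j) (c.zero_mem_known (by omega) hg (by omega)
        (by rw [← hjt]; omega))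

theorem good (c : Receiver K q B R) (hk : k ≤ q) : Good K B R k := by
  induction k with
  | zero => intro j hj; omega
  | succ k ih =>
    intro j hj
    rcases Nat.lt_or_eq_of_le (Nat.le_of_lt_succ hj) with hl | rfl
    · exact ih (by omega) j hl
    · rcases c.round_cases (ih (by omega)) hk with ⟨X, -, -, h⟩ | ⟨P, -, -, -, h⟩
      · exact source_eligible h
      · rcases h with ⟨-, t, h⟩ | ⟨-, -, h⟩ | ⟨-, -, -, t, h⟩ | ⟨-, -, h⟩ <;>
          exact source_eligible h

theorem eligible (c : Receiver K q B R) (hk : k < q) :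
    Eligible K B R k (known K B R k) (source K B R k) := c.good (Nat.succ_le_of_lt hk) k (Nat.lt_succ_self k)

/-- The parent of the source of round `k` has a large block, or a block that is not known yet. -/
theorem block_parent_source (c : Receiver K q B R) (hk : k < q) :
    k + 1 ≤ B (source K B R k - K (B (source K B R k))) ∨
      (B (source K B R k - K (B (source K B R k))) = k ∧ k ∉ known K B R k) := by
  have hg := c.good hk.le
  have hel := c.eligible hk
  have hsR := c.source_lt_R (c.good (Nat.succ_le_of_lt hk)) (Nat.lt_succ_self k)
  set t := source K B R k with ht
  have htl : t < K (q + 1) := hsR.trans c.lt_top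
  have hbp := c.block_lt_parent t hel.1 htl
  have hpp := c.pos (B t)
  rcases c.round_cases hg hk with ⟨X, h1, h2, h3⟩ | ⟨P, h1, h2, h3, h4⟩
  · left
    have h4 := le_source h3
    rcases Nat.lt_or_eq_of_le h4 with h5 | h5
    · have := c.block_lt t hel.1 htl X (by have := hel.2.2.2.1; omega) h5
      omega
    · have : B X = B t := congrArg B h5
      omega
  · have hPt : P ≤ t := by have := hel.2.2.1; omega
    rcases Nat.lt_or_eq_of_le hPt with hPt | rfl
    swap
    · left; omega
    have hBt := h3 t hPt hel
    have hpar := c.block_parent_ge htl hPt h2 (by omega)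
    rcases Nat.lt_or_eq_of_le hpar with hpl | hpe
    swap
    · left; rwa [← hpe]
    have hpy := hel.2.2.2.1
    -- The parent now lies beyond `P` and at most at `R - K (k + 1)`. Only the last case allows
    -- this, with the parent equal to `P + K k`, whose block `k` is new.
    rcases h4 with ⟨h5, -⟩ | ⟨h5, h6, h7⟩ | ⟨h5, h6, -⟩ | ⟨h5, h6, h7⟩
    · omega
    · have h8 := le_source h7
      rcases Nat.lt_or_eq_of_le h8 with h9 | h9
      · have := c.block_lt t hel.1 htl (P + K k) (by omega) h9
        omega
      · rw [h9] at h6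
        rw [h6] at hpl
        omega
    · rw [show t - K (B t) = P + 1 by omega] at hbp
      omega
    · right
      have h8 := le_source h7
      have h9 := h7.2.2.2.2
      rw [h6] at h9
      refine ⟨?_, h9⟩
      rcases Nat.lt_or_eq_of_le h8 with h10 | h10
      · have : t - K (B t) = P + K k := by
          by_contra hne
          have := c.block_lt t hel.1 htl (P + K k) (by omega) h10
          omega
        rw [this, h6]
      · rw [h10] at h6
        rw [h6] at hpl
        omega

/-- In the cases of `round_cases` the far end of the window lies below an eligible node, or is `P`,
or has the known block `0`, or is `P + K k` with block `k`. -/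
theorem le_block_source (c : Receiver K q B R) (hk : k < q) (hy : source K B R k + K (k + 1) = R) :
    k ≤ B (source K B R k) := by
  have hel := c.eligible hk
  rcases c.round_cases (c.good hk.le) hk with ⟨X, h1, h2, h3⟩ | ⟨P, h1, h2, h3, h4⟩
  · have := le_source h3
    omega
  · rcases Nat.lt_or_eq_of_le (show P ≤ source K B R k by omega) with hPt | rfl
    swap
    · omega
    rcases h4 with ⟨h5, -⟩ | ⟨h5, h6, h7⟩ | ⟨h5, h6, h7, -⟩ | ⟨h5, h6, h7⟩
    · omega
    · have := le_source h7
      omega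
    · rw [show source K B R k = P + 1 by omega] at hel
      exact absurd (h6 ▸ h7) hel.2.2.2.2
    · rw [show source K B R k = P + K k by omega, h6]

/-- The blocks of the proper ancestors of a source are not known yet. -/
theorem ancestor_notMem (c : Receiver K q B R) (hk : k < q) {a : ℕ}
    (ha : a < source K B R k) (hanc : ∀ x, a < x → x ≤ source K B R k → B x < B a) :
    B a ∉ known K B R k := by
  intro hmem
  have hg := c.good hk.le
  have hg' := c.good (Nat.succ_le_of_lt hk)
  have hel := c.eligible hk
  have hsR := c.source_lt_R hg' (Nat.lt_succ_self k)
  have hRl := c.lt_top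
  have hbps := c.block_parent_source hk
  set t := source K B R k with ht
  have hpp := c.pos (B t)
  have hpar : a ≤ t - K (B t) := by
    by_contra hc
    have h1 := c.block_lt t hel.1 (by omega) a (by omega) ha
    have h2 := hanc t ha le_rfl
    omega
  -- A known large block would recur at a node `u` after the source. The parent of `u` is then after
  -- the source too, which puts `u` beyond `R`.
  rcases lt_or_ge k (B a) with hlarge | hle
  · obtain ⟨u, hu1, hu2, hu3, hu4, -, hu5⟩ := c.exists_witness hg hmem
    have htu : t < u := by
      rcases hu5 with rfl | ⟨j, hj, rfl⟩
      · exact hsR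
      · exact c.source_anti hg' hj (Nat.lt_succ_self k)
    have h1 := c.add_lt_of_block_eq (ha.trans htu) (by omega) hu1
    have h2 := c.block_lt_parent u hu2 (by omega)
    rw [hu1] at h1 h2
    have h3 : t < u - K (B a) := by
      by_contra hc
      have := hanc (u - K (B a)) (by omega) (by omega)
      omega
    have h4 := c.mono (show k + 1 ≤ B a from hlarge)
    have := hel.2.2.1
    omega
  -- Blocks grow towards the root and the parent of the source has block at least `k`, so only the
  -- parent itself can have a block at most `k`.
  · have hae : a = t - K (B t) := by
      by_contra hne
      have h1 := hanc (t - K (B t)) (by omega) (by omega)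
      rcases hbps with h2 | h2 <;> omega
    rcases hbps with h2 | h2
    · rw [← hae] at h2
      omega
    · rw [← hae] at h2
      exact h2.2 (h2.1 ▸ hmem)

end Receiver

/-! ### The sender knows what it has to send. -/

namespace Receiver
variable {K : ℕ → ℕ} {q : ℕ} {B : ℕ → ℕ} {R k : ℕ}

/-- The first large node after `y` is eligible. A source above it has a still larger block, because
the parent of the source is at most `y`. -/
theorem exists_first_large (c : Receiver K q B R) (hk : k < q) {y x : ℕ}
    (hy : y + K (k + 1) = R) (hyx : y < x) (hx : x + K k < R) (hB : k + 1 ≤ B x) :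
    k + 1 ≤ B (source K B R k) := by
  have hg := c.good hk.le
  have hRl := c.lt_top
  have hpk := c.pos k
  have hel := c.eligible hk
  have hpt := hel.2.2.2.1
  obtain ⟨X, hyX, hXx, hXB, hXf⟩ := BlockTree.exists_first_block_ge B hyx hB
  have hpar := c.parent_le_of_first hyX (by omega) hXB hXf
  have hX : Eligible K B R k (known K B R k) X := ⟨by omega, by omega, by omega, by omega,
    c.notMem_known hg (by omega) (by omega) hXB fun j hj => by
      have h1 := (hg j hj).2.2.1
      have h2 := c.mono (show j + 1 ≤ k from hj)
      omega⟩
  have hle := le_source hX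
  rcases Nat.lt_or_eq_of_le hle with h | h
  · have := c.block_lt _ hel.1 (by have := hel.2.1; omega) X (by omega) h
    omega
  · rwa [← h]

/-- By `FarLarge.notMem_self` the block `k` is still new. Outside of degenerate positions some
eligible node with block at least `k` lies strictly above the far end of the window of round `k +
1`. A larger source has its parent below that node, hence a larger block. -/
theorem FarLarge.le_block_source (w : FarLarge K q B R k) (c : Receiver K q B R) :
    k ≤ B (source K B R (k + 1)) := by
  have hk := w.lt
  have hg := c.good hk.le
  have hRl := c.lt_top
  have hRy := c.skip_le_R (show k + 1 + 1 ≤ q from hk)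
  have hel := c.eligible hk
  have hfar := w.far
  have hpos := w.pos c
  have hlt := c.lt_succ k
  have hlt1 := c.lt_succ (k + 1)
  have hd := c.double_le k
  have hd1 := c.double_le (k + 1)
  have hd1' := c.le_double (k + 1)
  have h1k := c.mono (show 1 ≤ k from hpos)
  rw [c.one] at h1k
  have h0m : 0 ∈ known K B R (k + 1) := known_subset (Nat.le_succ k)
    (c.zero_mem_known (by omega) w.good hfar (by have := w.large; omega))
  obtain ⟨y, hy⟩ : ∃ y, y + K (k + 1 + 1) = R := ⟨R - K (k + 1 + 1), by omega⟩
  by_contra hcon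
  set t := source K B R (k + 1) with ht
  set f := source K B R k with hf
  have htf : t < f := c.source_anti (c.good hk) (Nat.lt_succ_self k) (Nat.lt_succ_self _)
  have hpt := hel.2.2.2.1
  have hyt := hel.2.2.1
  have htl : t < K (q + 1) := by omega
  have hpp := c.pos (B t)
  have hsm : ∀ x, y < x → x < f → B x ≤ k + 1 := fun x h1 h2 => by
    by_contra hc
    exact hcon (le_trans (by omega) (c.exists_first_large hk hy h1 (by omega) (by omega)))
  have habove : ∀ v, Eligible K B R (k + 1) (known K B R (k + 1)) v → k ≤ B v →
      R < v + K (k + 1 + 1) → False := fun v h1 h2 h3 => by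
    have h4 := le_source h1
    rcases Nat.lt_or_eq_of_le h4 with h5 | h5
    · have := c.block_lt t hel.1 htl v (by omega) h5
      omega
    · have : B v = B t := congrArg B h5
      omega
  -- the far end of the window cannot have a large block
  have hynot : ¬ k + 1 ≤ B y := fun hBy => by
    have hyt' : y < t := lt_of_le_of_ne (by omega) fun h => hcon (by rw [← h]; omega)
    have hsm' : ∀ x, y < x → x < f → B x < B y := fun x h1 h2 => by
      have h3 := hsm x h1 h2
      refine lt_of_le_of_ne (by omega) fun h4 => ?_
      have h5 := c.add_lt_of_block_eq h1 (by omega) h4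
      have h6 := c.mono (show k + 1 ≤ B x by omega)
      omega
    have hch : ∀ e, e ≤ k → y + K e < f → B (y + K e) = e := fun e he h =>
      c.child y e (by omega) (by omega) fun x h1 h2 => hsm' x h1 (by omega)
    rcases lt_or_ge (y + K k) f with h1 | h1
    · have hBk := hch k le_rfl h1
      exact habove (y + K k) ⟨by omega, by omega, by omega, by rw [hBk]; omega, by
        rw [hBk]; exact w.notMem_self c⟩ (by rw [hBk]) (by omega)
    · have hk1 : k = 1 := by
        by_contra hne
        have := c.lt (show 1 < k by omega)
        rw [c.one] at this
        omega
      have h3 := hch 0 (by omega) (by rw [c.zero]; omega)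
      rw [c.zero] at h3
      have h2 := c.one
      rw [← hk1] at h2
      have : t = y + 1 := by omega
      rw [← this] at h3
      exact hel.2.2.2.2 (h3 ▸ h0m)
  rcases c.round_cases hg hk with ⟨X, h1, h2, h3⟩ | ⟨P, h1, h2, h3, h4⟩
  · exact habove X h3 (by omega) h1
  · rcases h4 with ⟨h5, -⟩ | ⟨h5, h6, h7⟩ | ⟨h5, h6, -⟩ | ⟨h5, h6, h7⟩
    · exact hynot (by rw [show y = P by omega]; omega)
    · exact habove _ h7 (by omega) (by omega)
    · have hBk : B (P + K k) = k := by
        refine c.child' (m := k + 2) (by omega) (by omega) (by omega) fun x hx1 hx2 => ?_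
        rcases le_or_gt x y with h8 | h8
        · rw [show x = P + 1 by omega, h6]; omega
        · have := hsm x h8 (by omega)
          omega
      have helig : Eligible K B R (k + 1) (known K B R (k + 1)) (P + K k) :=
        ⟨by omega, by omega, by omega, by rw [hBk]; omega, by
          rw [hBk]; exact w.notMem_self c⟩
      rcases Nat.lt_or_eq_of_le (show y ≤ P + K k by omega) with h8 | h8
      · exact habove _ helig (by omega) (by omega)
      · rw [← h8, show y = P + 1 by omega, h6] at hBk
        omega
    · exact hynot (by rw [show y = P + K (k + 1) by omega, h6])

/-- The `k + 1` known blocks are distinct, so if none exceeds `k` they are all of `0, …, k`. -/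
theorem mem_known_of_forall_le (c : Receiver K q B R) (hg : Good K B R k)
    (h : ∀ a ∈ known K B R k, a ≤ k) {e : ℕ} (he : e ≤ k) : e ∈ known K B R k := by
  have : known K B R k = Finset.range (k + 1) :=
    Finset.eq_of_subset_of_card_le (fun a ha => Finset.mem_range.2 (by have := h a ha; omega))
      (by rw [c.card_known hg, Finset.card_range])
  rw [this]
  exact Finset.mem_range.2 (by omega)

/-- A source at the far end of the window of length `K k` is that of the last round. -/
theorem succ_eq_of_far (c : Receiver K q B R) (hg : Good K B R k) {i : ℕ} (hi : i < k)
    (h : source K B R i + K k ≤ R) : i + 1 = k := by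
  have h5 := (hg i hi).2.2.1
  by_contra hne
  have := c.lt (show i + 1 < k by omega)
  omega

section sender
variable {F f sh : ℕ}

/-- The window of the sender `F = f + sh`, as a copy of the window that ends with the
from-processor `f` of `R`. -/
structure Window (K : ℕ → ℕ) (q : ℕ) (B : ℕ → ℕ) (R k F f sh : ℕ) : Prop where
  receiver : Receiver K q B R
  sender : Receiver K q B F
  lt : k < q
  from_eq : f + K k = R
  copy_eq : F = f + sh
  block_copy : ∀ x, 0 < x → x ≤ f → B (x + sh) = B x
  block_root : q ≤ B sh

theorem Window.block_ge (w : Window K q B R k F f sh) {x : ℕ} (hx : x ≤ f)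
    (hB : k + 1 ≤ B x) : k + 1 ≤ B (x + sh) := by
  have := w.lt
  rcases Nat.eq_zero_or_pos x with rfl | h0
  · have := w.block_root
    rw [zero_add]
    omega
  · rwa [w.block_copy x h0 hx]

/-- If the first round in which the sender `F` could get the block of `R` passes, then `F` gets
the block of a larger sibling instead, which `R` already knows. -/
theorem Window.exists_sibling (w : Window K q B R k F f sh)
    (hlt : source K B R k < f)
    (hpar : source K B R k - K (B (source K B R k)) + K k ≤ f)
    (hfar : f < source K B R k + K k)
    (hnot : B (source K B R k) ∉ known K B F k) :
    ∃ j < k, ∃ t, F < source K B R k + sh + K (j + 1) ∧ source K B F j = t + sh ∧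
      source K B R k < t ∧ t < f ∧ B (source K B R k) < B t ∧ B t ≤ k ∧
      t - K (B t) ≤ source K B R k - K (B (source K B R k)) ∧ B t ∈ known K B R k := by
  have c := w.receiver
  have cF := w.sender
  have hk := w.lt
  have hel := c.eligible hk
  have hg := c.good hk.le
  have hgF := cF.good hk.le
  have hf := w.from_eq
  have hF := w.copy_eq
  have hRl := c.lt_top
  have hFl := cF.lt_top
  set t := source K B R k with ht
  have hBT := w.block_copy t hel.1 hlt.le
  have hst := c.skip_le t hel.1 (by omega)
  have hex : ∃ j, j < k ∧ t + sh + K j ≤ F ∧ F < t + sh + K (j + 1) := by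
    by_contra hc
    push Not at hc
    have hall : ∀ j ≤ k, t + sh + K j ≤ F := fun j => by
      induction j with
      | zero => intro; rw [c.zero]; omega
      | succ j ih => intro hj; exact hc j (by omega) (ih (by omega))
    have := hall k le_rfl
    omega
  obtain ⟨j, hj, hj1, hj2⟩ := hex
  have hm := c.mono (show j + 1 ≤ k from hj)
  have hjn : B t ∉ known K B F j := fun h => hnot (known_subset hj.le h)
  have hT : Eligible K B F j (known K B F j) (t + sh) := ⟨by omega, hj1, hj2.le, by
    rw [hBT]; omega, by rwa [hBT]⟩
  have hle := le_source hT
  have hne : t + sh ≠ source K B F j := fun h => hnot (by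
    rw [← hBT, h]; exact mem_known_succ hj)
  have hs := hgF j hj
  have hsF := cF.source_lt_R hgF hj
  obtain ⟨t1, ht1⟩ : ∃ t1, source K B F j = t1 + sh := ⟨source K B F j - sh, by omega⟩
  rw [ht1] at hs hsF hle hne
  have hB1 := w.block_copy t1 (by omega) (by omega)
  have hpar1 := hs.2.2.2.1
  have hst1 := c.skip_le t1 (by omega) (by omega)
  have hnest := c.parent_nested (x := t1 + sh) (t := t + sh) (by omega) (by omega) (by omega)
  have hblt := c.block_lt (t1 + sh) (by omega) (by omega) (t + sh) (by omega) (by omega)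
  rw [hBT, hB1] at hnest hblt
  -- The node `t1` meets the other conditions of eligibility for `R` in round `k` and exceeds the
  -- source of `R`.
  have hmem : B t1 ∈ known K B R k := by
    by_contra hc
    have := le_source (show Eligible K B R k (known K B R k) t1 from
      ⟨by omega, by omega, by have := hel.2.2.1; omega, by have := hel.2.2.2.1; omega, hc⟩)
    omega
  refine ⟨j, hj, t1, hj2, ht1, by omega, by omega, hblt, ?_, by omega, hmem⟩
  by_contra hc
  refine c.notMem_known hg (X := t1) (by have := hel.2.2.1; omega) (by omega) (by omega)
    (fun i hi => ?_) hmem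
  have h1 := (hg i hi).2.2.1
  have h2 := c.mono (show i + 1 ≤ k from hi)
  omega

/-- The first node after the source with a block above `k` would itself be eligible. -/
theorem Window.block_le (w : Window K q B R k F f sh) {x : ℕ} (hx : source K B R k < x)
    (hxf : x < f) : B x ≤ k := by
  have c := w.receiver
  have hk := w.lt
  have hg := c.good hk.le
  have hel := c.eligible hk
  have hf := w.from_eq
  have hRl := c.lt_top
  have hpk := c.pos k
  by_contra hc
  obtain ⟨X, hX1, hX2, hX3, hX4⟩ := BlockTree.exists_first_block_ge B hx (show k + 1 ≤ B x by omega)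
  have hpar := c.parent_le_of_first hX1 (by omega) hX3 hX4
  have hpy : X - K (B X) + K (k + 1) ≤ R := by
    have := hel.2.2.1
    have := hel.2.2.2.1
    have hm := c.mono hX3
    rcases Nat.lt_or_eq_of_le hpar with h | h
    · have := c.parent_nested (x := X) (by omega) h hX1
      omega
    · omega
  have := le_source (show Eligible K B R k (known K B R k) X from
    ⟨by omega, by omega, by have := hel.2.2.1; omega, hpy,
      c.notMem_known hg (by have := hel.2.2.1; omega) (by omega) hX3 fun j hj => by
        have h1 := (hg j hj).2.2.1
        have h2 := c.mono (show j + 1 ≤ k from hj)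
        omega⟩)
  omega

/-- The source `t` has block at least `k`, while `k` and `k + 1` are new to `R`. So a larger sibling
as in `exists_sibling` cannot exist. If the parent of `t` is too close for that lemma, `B t = k` and
the copy of `t` dominates the window of `F` above it. If `t` is too far away, a child of `t` with a
missing block would be eligible for `R` above `t`. -/
theorem Window.mem_known_of_farLarge (w : Window K q B R (k + 1) F f sh)
    (v : FarLarge K q B R k) : B (source K B R (k + 1)) ∈ known K B F (k + 1) := by
  have c := w.receiver
  have cF := w.sender
  have hk := w.lt
  have hg := c.good hk.le
  have hgF := cF.good hk.le
  have hel := c.eligible hk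
  have hf := w.from_eq
  have hF := w.copy_eq
  have hRl := c.lt_top
  have hFl := cF.lt_top
  have hfar := v.far
  have hff : source K B R k = f := by omega
  have htf : source K B R (k + 1) < f := by
    rw [← hff]
    exact c.source_anti (c.good hk) (Nat.lt_succ_self k) (Nat.lt_succ_self _)
  have hBk := v.le_block_source c
  have hlt := c.lt_succ k
  have hd := c.double_le k
  have hd' := c.le_double k
  have hd1 := c.double_le (k + 1)
  have hd1' := c.le_double (k + 1)
  have hst := c.skip_le _ hel.1 (by omega)
  have hyt := hel.2.2.1
  have hpt := hel.2.2.2.1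
  have hbl := @Window.block_le _ _ _ _ _ _ _ _ w
  have hsib := w.exists_sibling htf
  have hfin := fun h => c.le_block_source hk h
  have hmax : ∀ x, Eligible K B R (k + 1) (known K B R (k + 1)) x →
    x ≤ source K B R (k + 1) := fun x => le_source
  set t := source K B R (k + 1) with ht
  have hpp := c.pos (B t)
  by_contra hcon
  rcases lt_or_ge f (t + K (k + 1)) with h1 | h1
  · rcases le_or_gt (t - K (B t) + K (k + 1)) f with h2 | h2
    · obtain ⟨-, -, t1, -, -, -, -, h3, h4, -, h5⟩ := hsib h2 h1 hcon
      have : B t1 = k + 1 := by omega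
      exact v.notMem c (this ▸ h5)
    · -- the parent of `t` is just behind the window of `F`
      have hBt : B t = k := by
        by_contra hne
        have := c.mono (show k + 1 ≤ B t by omega)
        omega
      have hdom : ∀ x, t < x → x < f → B x < B t := fun x hx1 hx2 => by
        by_contra hc
        obtain ⟨X, hX1, hX2, hX3, hX4⟩ := BlockTree.exists_first_block_ge B hx1
          (show k ≤ B x by omega)
        have hpar := c.parent_le_of_first hX1 (by omega) hX3 hX4
        have hX5 := hbl hX1 (by omega)
        have hbp := c.block_lt_parent X (by omega) (by omega)
        have hnest := c.parent_nested (x := X) (t := t) (by omega) (lt_of_le_of_ne hpar fun h => by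
          rw [h] at hbp
          omega) hX1
        have := hmax X ⟨by omega, by omega, by omega, by omega, by
          rcases Nat.lt_or_eq_of_le hX5 with h | h
          · rw [show B X = k by omega]
            exact v.notMem_self c
          · rw [h]
            exact v.notMem c⟩
        omega
      have hBT := w.block_copy t hel.1 htf.le
      rw [hBt] at hpt hst h2 hdom hBT
      refine hcon (known_subset (Nat.le_succ k) ?_)
      have := cF.mem_known_of_dominant (cF.good (show k ≤ q by omega)) (P := t + sh) (by omega)
        (by omega) (by omega) (by rw [hBT]; omega) fun x hx1 hx2 => by
          obtain ⟨x', rfl⟩ : ∃ x', x = x' + sh := ⟨x - sh, by omega⟩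
          rw [hBT, w.block_copy x' (by omega) (by omega)]
          exact hdom x' (by omega) (by omega)
      rw [hBT] at this
      rw [hBt]
      exact this
  · have hB1 := hfin (by omega)
    have hdom : ∀ x, t < x → x < f → B x < B t := fun x hx1 hx2 => by
      have h3 := hbl hx1 hx2
      refine lt_of_le_of_ne (by omega) fun h4 => ?_
      have h5 := c.add_lt_of_block_eq hx1 (by omega) h4
      have h6 := c.mono (show k + 1 ≤ B x by omega)
      omega
    obtain ⟨e, he1, he2⟩ := v.exists_missing_lt c
    have hKe := c.lt (show e < k + 1 by omega)
    have hpe := c.pos e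
    have hch := c.child t e (by omega) (by omega) fun x hx1 hx2 => hdom x hx1 (by omega)
    have := hmax (t + K e) ⟨by omega, by omega, by omega, by rw [hch]; omega, by rwa [hch]⟩
    omega

/-- The core is a count. If `F` lacks one of `0, …, k`, it knows a block above `k`, and the node of
that block is at or before the copy of `P`, the last large node up to `f`. This pins it to the very
end of the window of `F`, where the order and the spacing of the sources of `F` exclude it. A source
with a large block at the far end is excluded by a child with a missing block. -/
theorem Window.mem_known_of_block_le (w : Window K q B R k F f sh)
    (hsmall : ∀ x, source K B R k < x → x ≤ f → B x ≤ k) :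
    B (source K B R k) ∈ known K B F k := by
  have c := w.receiver
  have cF := w.sender
  have hk := w.lt
  have hg := c.good hk.le
  have hgF := cF.good hk.le
  have hel := c.eligible hk
  have hf := w.from_eq
  have hF := w.copy_eq
  have hRl := c.lt_top
  have hFl := cF.lt_top
  have hd := c.double_le k
  have hd' := c.le_double k
  have hlt := c.lt_succ k
  have hpk := c.pos k
  have hst := c.skip_le _ hel.1 (by have := hel.2.1; omega)
  have hyt := hel.2.2.1
  have hpt := hel.2.2.2.1
  have hsib := w.exists_sibling
  have hmax : ∀ x, Eligible K B R k (known K B R k) x → x ≤ source K B R k :=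
    fun x => le_source
  set t := source K B R k with ht
  have htf' : t ≤ f := by have := hel.2.1; omega
  have hBT := w.block_copy t hel.1 htf'
  rcases Nat.lt_or_eq_of_le htf' with htf | htf
  swap
  · rw [← hBT, htf, ← hF]
    exact self_mem_known k
  have hpp := c.pos (B t)
  obtain ⟨P, hPf, hPB, hPl⟩ := c.exists_last_block_ge (m := k + 1) (by omega) f
  have hPt : P ≤ t := by
    by_contra hc
    have := hsmall P (by omega) hPf
    omega
  have hPBs := w.block_ge hPf hPB
  -- blocks of nodes of the window of `F` after the copy of `P`
  have hblock : ∀ u, P + sh < u → u ≤ F → B u ≤ k := fun u h1 h2 => by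
    obtain ⟨x, rfl⟩ : ∃ x, u = x + sh := ⟨u - sh, by omega⟩
    rw [w.block_copy x (by omega) (by omega)]
    have := hPl x (by omega) (by omega)
    omega
  have hall : P + sh + K k < F → B t ≤ k → B t ∈ known K B F k := fun h1 h2 => by
    refine cF.mem_known_of_forall_le hgF (fun a ha => ?_) h2
    obtain ⟨u, rfl, hu2, hu3, hu4, -⟩ := cF.exists_witness hgF ha
    exact hblock u (by omega) hu3
  by_contra hcon
  rcases lt_or_ge f (t + K k) with h1 | h1
  · rcases le_or_gt (t - K (B t) + K k) f with h2 | h2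
    · obtain ⟨j, hj, t1, hj2, hs1, ht1, ht1f, hb1, hb2, hp1, -⟩ := hsib htf h2 h1 hcon
      have hPt' : P < t := lt_of_le_of_ne hPt fun h => by rw [h] at hPB; omega
      have hpar := c.block_parent_ge (t := t) (by omega) hPt' hPB (by omega)
      have hpar1 := c.block_parent_ge (t := t1) (by omega) (by omega) hPB (by omega)
      have hst1 := c.skip_le t1 (by omega) (by omega)
      have hPf' : ¬ P + sh + K k < F := fun h => hcon (hall h (by omega))
      -- the copy of `P` is a source of `F`
      obtain ⟨a, ha1, ha2⟩ : ∃ a ∈ known K B F k, k < a := by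
        by_contra hc
        push Not at hc
        exact hcon (cF.mem_known_of_forall_le hgF hc (by omega))
      obtain ⟨u, rfl, hu2, hu3, hu4, -, hu5⟩ := cF.exists_witness hgF ha1
      have huP : u = P + sh := by
        by_contra hne
        have := hblock u (by omega) hu3
        omega
      have hbt1 : B t1 < k := by
        by_contra hc
        have := c.mono (show k ≤ B t1 by omega)
        omega
      rcases hu5 with rfl | ⟨i, hi, hui⟩
      · omega
      · have hik := cF.succ_eq_of_far hgF hi (by omega)
        have hji : j < i := by
          by_contra hc
          have := cF.source_anti' hgF (show i ≤ j by omega) hj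
          omega
        -- Now `t = P + K (B t)` with `B t < i`, and `K k ≥ 2 * K i - 1` puts its copy below the
        -- window of round `j`.
        have h3 := c.mono (show j + 1 ≤ i from hji)
        have h4 := c.lt (show B t < i by omega)
        have h5 := c.double_le i
        rw [hik] at h5
        omega
    · -- the parent of `t` is just behind the window of `F`
      have hBt : B t < k := by
        by_contra hc
        have := c.mono (show k ≤ B t by omega)
        omega
      have hPt' : P < t := lt_of_le_of_ne hPt fun h => by rw [h] at hPB; omega
      have hpar := c.block_parent_ge (t := t) (by omega) hPt' hPB (by omega)
      have hbp := c.block_lt_parent t hel.1 (by omega)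
      set y := t - K (B t) with hy
      have hPy : y ≤ P + 1 := by
        by_contra hc
        exact hcon (hall (by omega) (by omega))
      rcases Nat.lt_or_eq_of_le hpar with h3 | hPe
      · have h0 := c.child P 0 (by rw [c.zero]; omega) (by omega) fun x hx1 hx2 => by
          rw [c.zero] at hx2
          have := hPl x hx1 (by omega)
          omega
        rw [c.zero, show P + 1 = y by omega] at h0
        omega
      · have hsm : ∀ u, P + sh < u → u ≤ F → B u < k := fun u hu1 hu2 => by
          refine lt_of_le_of_ne (hblock u hu1 hu2) fun h => ?_
          have := c.add_le_of_block_le hu1 (by omega) (by omega)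
          rw [h] at this
          omega
        -- too many blocks are known to `F`
        have hcount : ∀ i ≤ k, (∀ a ∈ known K B F i, a < k ∨ a = B (P + sh)) →
            (known K B F i).card ≤ k := fun i hi h => by
          have hsub : known K B F i ⊆ insert (B (P + sh)) ((Finset.range k).erase (B t)) := by
            intro a ha
            rcases h a ha with h | h
            · refine Finset.mem_insert_of_mem (Finset.mem_erase.2 ⟨?_, Finset.mem_range.2 h⟩)
              rintro rfl
              exact hcon (known_subset hi ha)
            · exact h ▸ Finset.mem_insert_self _ _
          have h3 := Finset.card_le_card hsub
          have h4 := Finset.card_insert_le (B (P + sh)) ((Finset.range k).erase (B t))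
          rw [Finset.card_erase_of_mem (Finset.mem_range.2 hBt), Finset.card_range] at h4
          omega
        obtain ⟨a, ha1, ha2, ha3⟩ : ∃ a ∈ known K B F k, k ≤ a ∧ a ≠ B (P + sh) := by
          by_contra hc
          push Not at hc
          have := hcount k le_rfl fun a ha => by
            rcases lt_or_ge a k with h | h
            · exact Or.inl h
            · exact Or.inr (hc a ha h)
          rw [cF.card_known hgF] at this
          omega
        obtain ⟨u, rfl, hu2, hu3, hu4, -, hu5⟩ := cF.exists_witness hgF ha1
        have huP : u < P + sh := by
          by_contra hc
          rcases Nat.lt_or_eq_of_le (not_lt.1 hc) with h3 | h3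
          · have := hsm u h3 hu3
            omega
          · exact ha3 (by rw [h3])
        rcases hu5 with rfl | ⟨i, hi, hui⟩
        · omega
        have hik := cF.succ_eq_of_far hgF hi (by omega)
        have hgi := hgF.mono hi.le
        have hmemP : B (P + sh) ∈ known K B F i := by
          by_contra hc
          have hlei : ∀ a ∈ known K B F i, a < k := fun a ha => by
            obtain ⟨v, rfl, hv2, hv3, hv4, hv5, hv6⟩ := cF.exists_witness hgi ha
            have huv : u < v := by
              rcases hv6 with rfl | ⟨i', hi', rfl⟩
              · omega
              · rw [hui]
                exact cF.source_anti hgF hi' hi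
            rcases Nat.lt_or_eq_of_le (show P + sh ≤ v by omega) with h3 | h3
            · exact hsm v h3 hv3
            · exact absurd (h3 ▸ ha) hc
          have hsub : known K B F i ⊆ (Finset.range k).erase (B t) := fun a ha =>
            Finset.mem_erase.2 ⟨fun h => hcon (known_subset hi.le (h ▸ ha)),
              Finset.mem_range.2 (hlei a ha)⟩
          have h3 := Finset.card_le_card hsub
          rw [Finset.card_erase_of_mem (Finset.mem_range.2 hBt), Finset.card_range,
            cF.card_known hgi] at h3
          omega
        obtain ⟨v, hv1, hv2, hv3, hv4, -, hv6⟩ := cF.exists_witness hgi hmemP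
        have hvP : v = P + sh := by
          by_contra hne
          have := c.lt (show i < k from hi)
          have := hblock v (by omega) hv3
          omega
        rcases hv6 with rfl | ⟨i', hi', hvi⟩
        · omega
        have h3 := (hgi i' hi').2.2.1
        have h4 := c.mono (show i' + 1 ≤ i from hi')
        have h5 := c.double_le i
        rw [hik] at h5
        have hi1 : i = 1 := by
          by_contra hne
          have := c.lt (show 1 < i by omega)
          rw [c.one] at this
          omega
        have hi0 : i' = 0 := by omega
        rw [hi0] at hvi
        have h6 := cF.source_zero (by omega)
        have h7 := c.lt (show i < k from hi)
        rw [hi1, c.one] at h7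
        omega
  · -- `t` is at the far end of the windows of both `R` and `F`
    rcases le_or_gt (B t) k with h2 | h2
    · have : P < t := lt_of_le_of_ne hPt fun h => by rw [h] at hPB; omega
      exact hcon (hall (by omega) h2)
    · obtain ⟨X, hX1, hX2, hX3⟩ := c.exists_block_ge (z := t) (m := k + 1) h2 (by omega)
      have hXf : f < X := by
        by_contra hc
        have := hsmall X hX1 (by omega)
        omega
      obtain ⟨x, hx1, hx2, hx3, hx4⟩ := c.exists_large_known hg (X := X) (m := k + 1) (by omega)
        (by omega) (by omega) (by omega) (by omega) hX3
      obtain ⟨e, he1, he2⟩ := c.exists_missing_of_mem hg hx4 (by omega)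
      have hKe := c.mono he1
      have hpe := c.pos e
      have hch := c.child' (z := t) (e := e) (m := k + 1) (by omega) h2 (by omega)
        fun x hx1 hx2 => by
          have := hsmall x hx1 (by omega)
          omega
      have := hmax (t + K e) ⟨by omega, by omega, by omega, by rw [hch]; omega, by rwa [hch]⟩
      omega

/-- The block that `R` receives in round `k` is known by then to its from-processor. -/
theorem Window.mem_known (w : Window K q B R k F f sh) :
    B (source K B R k) ∈ known K B F k := by
  have c := w.receiver
  have hg := c.good w.lt.le
  have hf := w.from_eq
  -- The exceptional case is a large block at `f` that `R` has already accepted from `f` in the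
  -- previous round. Otherwise all blocks after the source up to `f` are at most `k`.
  by_cases h : k + 1 ≤ B f ∧ source K B R k < f ∧ B f ∈ known K B R k
  · obtain ⟨h1, h2, h3⟩ := h
    obtain ⟨u, hu1, hu2, hu3, hu4, -, hu5⟩ := c.exists_witness hg h3
    have hpk := c.pos k
    have huf : u = f := by
      by_contra hne
      have h4 := c.add_lt_of_block_eq (show f < u by omega) (lt_of_le_of_lt hu3 c.lt_top) hu1
      have h5 := c.mono (show k ≤ B u by omega)
      omega
    rcases hu5 with rfl | ⟨i, hi, hui⟩
    · omega
    · have hik := c.succ_eq_of_far hg hi (by omega)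
      subst hik
      exact w.mem_known_of_farLarge ⟨w.lt, hg, by omega, by rw [← hui, huf]; exact h1⟩
  · refine w.mem_known_of_block_le fun x hx1 hx2 => ?_
    rcases Nat.lt_or_eq_of_le hx2 with h1 | rfl
    · exact w.block_le hx1 h1
    · by_contra hc
      have hnm : B x ∉ known K B R k := fun h3 => h ⟨by omega, hx1, h3⟩
      have hel := c.eligible w.lt
      have hpx : x - K (B x) + K (k + 1) ≤ R := by
        have h5 : ∀ v, source K B R k < v → v < x → B v < k + 1 := fun v h6 h7 =>
          Nat.lt_succ_of_le (w.block_le h6 h7)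
        have hRl := c.lt_top
        have hpar := c.parent_le_of_first hx1 (by omega) (show k + 1 ≤ B x by omega) h5
        have := hel.2.2.1
        have := hel.2.2.2.1
        have hm := c.mono (show k + 1 ≤ B x by omega)
        rcases Nat.lt_or_eq_of_le hpar with h | h
        · have := c.parent_nested (x := x) (by omega) h hx1
          omega
        · have := c.pos k
          omega
      have := le_source (show Eligible K B R k (known K B R k) x from
        ⟨by omega, by omega, by have := hel.2.2.1; omega, hpx, hnm⟩)
      omega

end sender
end Receiver

/-! ### Tree paths and the tests of the search. -/

/-- The node `rc + K a` is a child of `rc`, and `t` is in its subtree. -/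
structure OnPath (K B : ℕ → ℕ) (rc a t : ℕ) : Prop where
  le : rc + K a ≤ t
  block : B (rc + K a) = a
  lt : ∀ x, rc + K a < x → x ≤ t → B x < a

/-- The last node with maximal block between `rc` and `t` is the required child: its parent has a
larger block, so it can only be `rc`. -/
theorem BlockTree.exists_onPath {K : ℕ → ℕ} {q : ℕ} {B : ℕ → ℕ} (h : BlockTree K q B) {rc t : ℕ}
    (hrt : rc < t) (ht : t < K (q + 1)) (hanc : ∀ x, rc < x → x ≤ t → B x < B rc) :
    ∃ a < B rc, OnPath K B rc a t := by
  obtain ⟨c, hc, hmax⟩ := Finset.exists_max_image (Finset.Ioc rc t) B ⟨t, by simp [hrt]⟩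
  rw [Finset.mem_Ioc] at hc
  have hcq := h.block_le c (by omega) (by omega)
  obtain ⟨P, hPt, hPB, hPl⟩ := h.exists_last_block_ge (m := B c) (by omega) t
  have hcP : c ≤ P := by
    by_contra hcon
    have := hPl c (by omega) hc.2
    omega
  have hBP := hmax P (Finset.mem_Ioc.2 ⟨by omega, hPt⟩)
  have hlt := hanc P (by omega) hPt
  have hpar := h.block_parent_ge (t := P) (by omega) (show rc < P by omega) le_rfl hlt
  have hsk := h.skip_le P (by omega) (by omega)
  have hbp := h.block_lt_parent P (by omega) (by omega)
  have hpos := h.pos (B P)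
  have hpe : P - K (B P) = rc := by
    by_contra hne
    have := hmax (P - K (B P)) (Finset.mem_Ioc.2 ⟨by omega, by omega⟩)
    omega
  have hP : rc + K (B P) = P := by omega
  exact ⟨B P, hlt, hP.le.trans hPt, by rw [hP], fun x h1 h2 => by
    have := hPl x (by omega) h2
    omega⟩

theorem OnPath.le_parent {K : ℕ → ℕ} {q : ℕ} {B : ℕ → ℕ} (h : BlockTree K q B) {rc a t : ℕ}
    (hp : OnPath K B rc a t) (ht : t < K (q + 1)) : rc ≤ t - K (B t) := by
  rcases Nat.lt_or_eq_of_le hp.le with h1 | h1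
  · have := h.block_parent_ge (t := t) ht h1 hp.block.ge (hp.lt t h1 le_rfl)
    omega
  · rw [← h1, hp.block]
    omega

theorem OnPath.block_lt {K : ℕ → ℕ} {q : ℕ} {B : ℕ → ℕ} (h : BlockTree K q B) {rc a t : ℕ}
    (hp : OnPath K B rc a t) (ht : t < K (q + 1)) : ∀ x, rc < x → x ≤ t → B x < B rc := by
  have hpos := h.pos a
  have hle := hp.le
  have hB := hp.block
  have hlt := h.block_lt_parent (rc + K a) (by omega) (by omega)
  rw [hB, Nat.add_sub_cancel] at hlt
  intro x hx hxt
  rcases lt_trichotomy x (rc + K a) with h1 | rfl | h1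
  · have := h.block_lt (rc + K a) (by omega) (by omega) x (by rw [hB]; omega) h1
    omega
  · omega
  · exact (hp.lt x h1 hxt).trans hlt

namespace Receiver
variable {K : ℕ → ℕ} {q : ℕ} {B : ℕ → ℕ} {R k rc a : ℕ}

/-- This guarantees that the search, which visits linked blocks only, can follow the path to the
source. -/
theorem onPath_notMem (c : Receiver K q B R) (hk : k < q)
    (hp : OnPath K B rc a (source K B R k)) : a ∉ known K B R k := by
  rcases Nat.lt_or_eq_of_le hp.le with h1 | h1
  · have := c.ancestor_notMem hk h1 (by rw [hp.block]; exact hp.lt)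
    rwa [hp.block] at this
  · have := (c.eligible hk).2.2.2.2
    rwa [← h1, hp.block] at this

/-- The nodes that the search tests successfully have no larger block in between. -/
theorem block_lt_of_near (c : Receiver K q B R) (hk : k < q) (hrc : rc + K (k + 1) ≤ R)
    (hnear : rc + K a + K k ≤ R)
    (hfresh : ∀ j < k, rc + K a < source K B R j)
    (hpath : source K B R k ≤ rc ∨ ∃ a' ≤ a, OnPath K B rc a' (source K B R k)) :
    ∀ x, rc < x → x ≤ rc + K a → B x < B rc := by
  have hg := c.good hk.le
  have hel := c.eligible hk
  have hRl := c.lt_top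
  have hpk := c.pos k
  have hny := c.le_block_source hk
  have hpb := c.block_parent_source hk
  have hmax : ∀ x, Eligible K B R k (known K B R k) x → x ≤ source K B R k := fun x => le_source
  set t := source K B R k with ht
  by_contra hcon
  push Not at hcon
  obtain ⟨X, hX1, hX2, hX3⟩ := hcon
  -- The first obstacle `C` lies above the source and has its parent at most at `rc`, so it failed
  -- to be chosen only because its block is known. That block is then at most `k`, which conflicts
  -- with the block of the source, if this is `rc`, or of its parent.
  obtain ⟨C, hC1, hC2, hC3, hC4⟩ := BlockTree.exists_first_block_ge B hX1 hX3
  have hCq := c.block_le C (by omega) (by omega)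
  have htC : source K B R k < C := by
    rw [← ht]
    by_contra h1
    rcases hpath with h2 | ⟨a', -, h2⟩
    · omega
    · have := h2.block_lt c.toBlockTree (by have := hel.2.1; omega) C hC1 (by omega)
      omega
  rw [← ht] at htC
  have hyt := hel.2.2.1
  have hpar := c.parent_le_of_first hC1 (by omega) hC3 hC4
  have hBC : B C ∈ known K B R k := by
    by_contra h1
    have := hmax C ⟨by omega, by omega, by omega, by omega, h1⟩
    omega
  have hBk : B C ≤ k := by
    by_contra h1
    exact c.notMem_known hg (X := C) (by omega) (by omega) (by omega)
      (fun j hj => lt_of_le_of_lt hC2 (by have := hfresh j hj; omega)) hBC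
  rcases hpath with h1 | ⟨a', -, h1⟩
  · have h2 : t = rc := by omega
    have h3 := hny (by omega)
    rw [h2] at h3
    have h4 := c.add_lt_of_block_eq hC1 (by omega) (by omega)
    have h5 : B C = k := by omega
    rw [h5] at h4
    have := c.le_double k
    omega
  · have htl : t < K (q + 1) := by omega
    have h2 := h1.le_parent c.toBlockTree htl
    have h3 := c.skip_le t hel.1 htl
    have h4 := c.pos (B t)
    have h5 : B (t - K (B t)) ≤ B rc := by
      rcases Nat.lt_or_eq_of_le h2 with h6 | h6
      · exact (h1.block_lt c.toBlockTree htl _ h6 (by omega)).le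
      · rw [← h6]
    rcases hpb with h6 | ⟨h6, h7⟩
    · omega
    · exact h7 (by rwa [show B C = k by omega] at hBC)

/-- Without obstacles `BlockTree.child` applies; `B rc ≤ a` would itself produce an obstacle by
`exists_block_ge`. -/
theorem block_add_of_near (c : Receiver K q B R) (hk : k < q) (hrc : rc + K (k + 1) ≤ R)
    (hnear : rc + K a + K k ≤ R) (hfresh : ∀ j < k, rc + K a < source K B R j)
    (hpath : source K B R k ≤ rc ∨ ∃ a' ≤ a, OnPath K B rc a' (source K B R k)) :
    a < B rc ∧ B (rc + K a) = a := by
  have hb := c.block_lt_of_near hk hrc hnear hfresh hpath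
  have hRl := c.lt_top
  have ha : a < B rc := by
    by_contra h
    have hm := c.mono (not_lt.1 h)
    obtain ⟨x, h1, h2, h3⟩ := c.exists_block_ge (z := rc) le_rfl (by omega)
    have := hb x h1 (by omega)
    omega
  exact ⟨ha, c.child rc a (by omega) ha hb⟩

/-- A failed test places `rc + K a` above `R - K k` or not below an earlier source. In both cases it
exceeds the source, so the path avoids it. -/
theorem path_skip (c : Receiver K q B R) (hk : k < q)
    (hskip : R < rc + K a + K k ∨ ∃ j < k, source K B R j ≤ rc + K a)
    (hpath : source K B R k ≤ rc ∨ ∃ a' ≤ a, OnPath K B rc a' (source K B R k)) :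
    source K B R k ≤ rc ∨ ∃ a' < a, a' ∉ known K B R k ∧ OnPath K B rc a' (source K B R k) := by
  rcases hpath with h | ⟨a', h1, h2⟩
  · exact Or.inl h
  · refine Or.inr ⟨a', lt_of_le_of_ne h1 ?_, c.onPath_notMem hk h2, h2⟩
    rintro rfl
    have hel := c.eligible hk
    have hle := h2.le
    rcases hskip with h3 | ⟨j, hj, h3⟩
    · have := hel.2.1
      omega
    · have := c.source_anti (c.good (Nat.succ_le_of_lt hk)) hj (Nat.lt_succ_self k)
      omega

theorem path_child (c : Receiver K q B R) (hk : k < q) (hB : B (rc + K a) = a)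
    (hpath : source K B R k ≤ rc ∨ ∃ a' ≤ a, OnPath K B rc a' (source K B R k)) :
    source K B R k ≤ rc + K a ∨ ∃ a' ≤ a, OnPath K B (rc + K a) a' (source K B R k) := by
  have hel := c.eligible hk
  have hRl := c.lt_top
  have htl : source K B R k < K (q + 1) := by have := hel.2.1; omega
  rcases hpath with h | ⟨a', h1, h2⟩
  · exact Or.inl (by omega)
  · rcases le_or_gt (source K B R k) (rc + K a) with h3 | h3
    · exact Or.inl h3
    · rcases Nat.lt_or_eq_of_le h1 with h4 | rfl
      · have := h2.lt (rc + K a) (by have := c.lt h4; omega) h3.le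
        omega
      · obtain ⟨a'', h4, h5⟩ := c.exists_onPath h3 htl fun x h6 h7 => by
          rw [hB]
          exact h2.lt x h6 h7
        exact Or.inr ⟨a'', by omega, h5⟩

/-- The parent of a source is at most `R - K (k + 1)`, so no source is a proper descendant of a node
beyond that point. This justifies omitting the recursive call. -/
theorem source_le_of_not_near (c : Receiver K q B R) (hk : k < q) (hB : B (rc + K a) = a)
    (hn : R < rc + K a + K (k + 1))
    (hpath : source K B R k ≤ rc ∨ ∃ a' ≤ a, OnPath K B rc a' (source K B R k)) :
    source K B R k ≤ rc + K a := by
  have hel := c.eligible hk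
  rcases c.path_child hk hB hpath with h | ⟨a', h1, h2⟩
  · exact h
  · have h3 := h2.le_parent c.toBlockTree (by have := hel.2.1; have := c.lt_top; omega)
    have := hel.2.2.2.1
    omega

theorem source_le_of_far (c : Receiver K q B R) (hk : k < q) (hrc : R < rc + K (k + 1))
    (hpath : source K B R k ≤ rc ∨ ∃ a, OnPath K B rc a (source K B R k)) :
    source K B R k ≤ rc := by
  have hel := c.eligible hk
  rcases hpath with h | ⟨a', h2⟩
  · exact h
  · have h3 := h2.le_parent c.toBlockTree (by have := hel.2.1; have := c.lt_top; omega)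
    have := hel.2.2.2.1
    omega

theorem exists_onPath_source (c : Receiver K q B R) (hk : k < q)
    (hblock : ∀ x, rc < x → x ≤ a → B x < B rc) (hle : source K B R k ≤ a) :
    source K B R k ≤ rc ∨
      ∃ a', a' ∉ known K B R k ∧ OnPath K B rc a' (source K B R k) := by
  have hel := c.eligible hk
  rcases le_or_gt (source K B R k) rc with h | h
  · exact Or.inl h
  · obtain ⟨a', h1, h2⟩ := c.exists_onPath h (by have := hel.2.1; have := c.lt_top; omega)
      fun x h1 h2 => hblock x h1 (by omega)
    exact Or.inr ⟨a', c.onPath_notMem hk h2, h2⟩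

/-- The two tests supply upper bounds for the node and its parent `rc`; the lower bound is inherited
from the source. -/
theorem eq_source (c : Receiver K q B R) (hk : k < q) (hB : B (rc + K a) = a)
    (hrc : rc + K (k + 1) ≤ R) (hnear : rc + K a + K k ≤ R) (ha : a ∉ known K B R k)
    (hle : source K B R k ≤ rc + K a) : source K B R k = rc + K a := by
  have hel := c.eligible hk
  have hyt := hel.2.2.1
  have hpos := c.pos a
  exact le_antisymm hle (le_source ⟨by omega, hnear, by omega, by rw [hB]; omega, by rwa [hB]⟩)

/-- Sources decrease, so the scan at `rc` need only continue with smaller blocks. -/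
theorem path_next (c : Receiver K q B R) (hk : k + 1 < q)
    (hblock : ∀ x, rc < x → x ≤ rc + K a → B x < B rc) (hn : source K B R k = rc + K a) :
    source K B R (k + 1) ≤ rc ∨
      ∃ a' < a, a' ∉ known K B R (k + 1) ∧ OnPath K B rc a' (source K B R (k + 1)) := by
  have hlt : source K B R (k + 1) < source K B R k :=
    c.source_anti (c.good (Nat.succ_le_of_lt hk)) (Nat.lt_succ_self k) (Nat.lt_succ_self (k + 1))
  rcases c.exists_onPath_source hk hblock (by omega) with h | ⟨a', h1, h2⟩
  · exact Or.inl h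
  · refine Or.inr ⟨a', ?_, h1, h2⟩
    have := h2.le
    exact c.lt_iff.1 (by omega)
end Receiver

/-! ### The amortized length of the scans. -/

theorem exists_three_lt {s : Finset ℕ} (h : 3 ≤ s.card) :
    ∃ x ∈ s, ∃ y ∈ s, ∃ z ∈ s, x < y ∧ y < z := by
  have f := s.orderEmbOfFin_mem rfl
  refine ⟨_, f ⟨0, by omega⟩, _, f ⟨1, by omega⟩, _, f ⟨2, by omega⟩, ?_, ?_⟩ <;>
    exact (s.orderEmbOfFin rfl).strictMono (by simp [Fin.lt_def])

theorem SkipSeq.two_pow_lt {K : ℕ → ℕ} (h : SkipSeq K) (e : ℕ) : 2 ^ e < K (e + 1) := by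
  induction e with
  | zero => rw [zero_add, h.one]; norm_num
  | succ e ih =>
    have := h.double_le (e + 1)
    rw [pow_succ]
    omega

theorem SkipSeq.le_log {K : ℕ → ℕ} (h : SkipSeq K) {e n : ℕ} (he : K e ≤ n) :
    e ≤ Nat.log 2 n + 1 := by
  rcases e with _ | e
  · omega
  · have := h.two_pow_lt e
    have h1 := Nat.le_log_of_pow_le (b := 2) (x := e) (y := n) (by norm_num) (by omega)
    omega

/-- With `l = Nat.log 2 (2 * q)` this makes the squared logarithm from the rounds with short skips
linear in `q`. -/
theorem sq_le_three_mul_two_pow (l : ℕ) : (l + 1) ^ 2 ≤ 3 * 2 ^ l := by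
  induction l with
  | zero => norm_num
  | succ l ih =>
    rw [pow_succ 2 l]
    rcases lt_or_ge l 2 with h | h
    · interval_cases l <;> norm_num
    · nlinarith

/-- A potential that bounds the length of a scan of the blocks `x < n` that are not known before
round `k`, in which blocks `x ≥ k` count whether known or not. -/
noncomputable def potential (K B : ℕ → ℕ) (R k n : ℕ) : ℕ :=
  (Finset.range (min n k) \ known K B R k).card + (n - k)

theorem potential_mono {K B : ℕ → ℕ} {R k m n : ℕ} (h : m ≤ n) :
    potential K B R k m ≤ potential K B R k n :=
  Nat.add_le_add (Finset.card_le_card (Finset.sdiff_subset_sdiff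
    (Finset.range_mono (by omega)) le_rfl)) (by omega)

theorem potential_lt {K B : ℕ → ℕ} {R k a m : ℕ} (ha : a ∉ known K B R k) (h : m ≤ a) :
    potential K B R k m < potential K B R k (a + 1) := by
  rcases lt_or_ge a k with h1 | h1
  · refine Nat.add_lt_add_of_lt_of_le (Finset.card_lt_card ?_) (by omega)
    refine (Finset.ssubset_iff_of_subset (Finset.sdiff_subset_sdiff
      (Finset.range_mono (by omega)) le_rfl)).2 ⟨a, ?_, ?_⟩
    · simp only [Finset.mem_sdiff, Finset.mem_range]
      exact ⟨by omega, ha⟩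
    · simp only [Finset.mem_sdiff, Finset.mem_range]
      omega
  · exact Nat.add_lt_add_of_le_of_lt (Finset.card_le_card (Finset.sdiff_subset_sdiff
      (Finset.range_mono (by omega)) le_rfl)) (by omega)

theorem potential_zero_le {K B : ℕ → ℕ} {R n : ℕ} : potential K B R 0 n ≤ n := by
  simp [potential]

namespace Receiver
variable {K : ℕ → ℕ} {q : ℕ} {B : ℕ → ℕ} {R : ℕ}

/-- Three known blocks at least `j` would have witnesses in a window of length `K j`, yet by `gap`
span at least `2 * K j - 2 * q > K j`. So at most two of the `j + 1` known blocks are that large. -/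
theorem card_small_le (c : Receiver K q B R) {j : ℕ} (hj : j ≤ q) (h0 : 0 < j) (hK : 2 * q < K j) :
    (Finset.range j \ known K B R j).card ≤ 1 := by
  have hg := c.good hj
  by_contra hcon
  have hL : 3 ≤ ((known K B R j).filter (j ≤ ·)).card := by
    have h1 := c.card_known hg
    have h2 := Finset.card_sdiff_add_card_inter (Finset.range j) (known K B R j)
    rw [Finset.card_range] at h2
    have h3 := Finset.card_filter_add_card_filter_not (s := known K B R j) (j ≤ ·)
    have h4 : (known K B R j).filter (fun x => ¬ j ≤ x) = Finset.range j ∩ known K B R j := by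
      ext x
      simp only [Finset.mem_filter, Finset.mem_inter, Finset.mem_range, not_le, and_comm]
    rw [h4] at h3
    omega
  have hw : ∀ e : ℕ, ∃ t, e ∈ (known K B R j).filter (j ≤ ·) →
      B t = e ∧ j ≤ B t ∧ t ≤ R ∧ R ≤ t + K j := fun e => by
    by_cases he : e ∈ (known K B R j).filter (j ≤ ·)
    · obtain ⟨h1, h2⟩ := Finset.mem_filter.1 he
      obtain ⟨t, h3, -, h4, h5, -⟩ := c.exists_witness hg h1
      exact ⟨t, fun _ => ⟨h3, h3 ▸ h2, h4, h5⟩⟩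
    · exact ⟨0, fun h => absurd h he⟩
  choose w hw using hw
  have hinj : Set.InjOn w ((known K B R j).filter (j ≤ ·) : Finset ℕ) := fun x hx y hy hxy => by
    rw [← (hw x hx).1, hxy, (hw y hy).1]
  rw [← Finset.card_image_of_injOn hinj] at hL
  obtain ⟨x, hx, y, hy, z, hz, hxy, hyz⟩ := exists_three_lt hL
  have hs : ∀ x ∈ Finset.image w ((known K B R j).filter (j ≤ ·)),
      j ≤ B x ∧ x ≤ R ∧ R ≤ x + K j := fun x hx => by
    obtain ⟨e, he, rfl⟩ := Finset.mem_image.1 hx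
    exact (hw e he).2
  have hx := hs x hx
  have hy := hs y hy
  have hz := hs z hz
  have hRl := c.lt_top
  have h1 := c.gap hxy (by omega) hx.1 hy.1
  have h2 := c.gap hyz (by omega) hy.1 hz.1
  have h3 := c.block_le y (by omega) (by omega)
  have h4 := c.block_le z (by omega) (by omega)
  omega

/-- Compare with a witness `x` of the largest known block. If `B x` is smaller than the new block
and at most `i + 1`, the rise of the maximum pays. If `B x` is at least the new block, `gap`
confines both to a window too short for them unless the new block has a skip of at most `2 * q`. -/
theorem block_source_le (c : Receiver K q B R) {i : ℕ} (hi : i < q) :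
    B (source K B R i) - (i + 1) ≤
      ((known K B R (i + 1)).sup id - (known K B R i).sup id) +
        if K (B (source K B R i)) ≤ 2 * q then B (source K B R i) else 0 := by
  have hg := c.good hi.le
  have hel := c.eligible hi
  have hRl := c.lt_top
  have hmem : B (source K B R i) ∈ known K B R (i + 1) := mem_known_succ (Nat.lt_succ_self i)
  have hsup := Finset.le_sup (f := id) hmem
  obtain ⟨e, he1, he2⟩ := Finset.exists_mem_eq_sup (known K B R i) ⟨_, self_mem_known i⟩ id
  rw [he2]
  simp only [id] at hsup ⊢
  obtain ⟨x, rfl, -, hx2, -, -, hx3⟩ := c.exists_witness hg he1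
  have hnx : source K B R i < x := by
    rcases hx3 with rfl | ⟨j, hj, rfl⟩
    · exact c.source_lt_R (c.good (Nat.succ_le_of_lt hi)) (Nat.lt_succ_self i)
    · exact c.source_anti (c.good (Nat.succ_le_of_lt hi)) hj (Nat.lt_succ_self i)
  set n := source K B R i with hn
  have hy := hel.2.2.1
  rcases le_or_gt (B n) (i + 1) with h | h
  · omega
  rcases lt_or_ge (B x) (B n) with h1 | h1
  · have h2 := c.add_le_of_block_le hnx (by omega) h1.le
    have h3 : B x ≤ i + 1 := by
      by_contra h4
      have := c.lt (not_le.1 h4)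
      omega
    omega
  · have h2 := c.gap hnx (by omega) le_rfl h1
    have h3 := c.block_le x (by omega) (by omega)
    have h4 := c.double_le (B n - 1)
    rw [show B n - 1 + 1 = B n by omega] at h4
    have h5 := c.mono (show i + 1 ≤ B n - 1 by omega)
    rw [if_pos (by omega)]
    omega

theorem potential_source_le (c : Receiver K q B R) {i : ℕ} (hi : i < q) :
    potential K B R (i + 1) (B (source K B R i)) ≤
      1 + ((known K B R (i + 1)).sup id - (known K B R i).sup id) +
        if i < Nat.log 2 (2 * q) + 1 then 2 * (Nat.log 2 (2 * q) + 1) else 0 := by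
  have h1 := c.block_source_le hi
  have h2 : (Finset.range (min (B (source K B R i)) (i + 1)) \ known K B R (i + 1)).card ≤
      (Finset.range (i + 1) \ known K B R (i + 1)).card :=
    Finset.card_le_card (Finset.sdiff_subset_sdiff (Finset.range_mono (by omega)) le_rfl)
  have h3 : (Finset.range (i + 1) \ known K B R (i + 1)).card ≤ i + 1 :=
    (Finset.card_le_card Finset.sdiff_subset).trans (Finset.card_range _).le
  have h4 : 2 * q < K (i + 1) → _ := c.card_small_le (Nat.succ_le_of_lt hi) (Nat.succ_pos i)
  have h5 : K (i + 1) ≤ 2 * q → i + 1 ≤ Nat.log 2 (2 * q) + 1 := c.le_log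
  have h6 : K (B (source K B R i)) ≤ 2 * q → B (source K B R i) ≤ Nat.log 2 (2 * q) + 1 := c.le_log
  have h7 : (Finset.range (i + 1) \ known K B R (i + 1)).card ≤
      1 + if i < Nat.log 2 (2 * q) + 1 then Nat.log 2 (2 * q) + 1 else 0 := by
    rcases le_or_gt (K (i + 1)) (2 * q) with h | h
    · rw [if_pos (by have := h5 h; omega)]
      have := h5 h
      omega
    · have := h4 h
      omega
  unfold potential
  rcases le_or_gt (K (B (source K B R i))) (2 * q) with h | h
  · rw [if_pos h] at h1
    have h8 := h6 h
    split_ifs at h7 ⊢ with h9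
    · omega
    · omega
  · rw [if_neg (by omega)] at h1
    split_ifs at h7 ⊢ with h9 <;> omega

/-- One unit per round contributes `q`, the maximum of the known blocks telescopes to at most `q`,
and the short skips contribute `2 * (l + 1) ^ 2 ≤ 12 * q`. -/
theorem sum_potential_le (c : Receiver K q B R) (hq : 0 < q) :
    ∑ i ∈ Finset.range q, potential K B R (i + 1) (B (source K B R i)) ≤ 14 * q := by
  have h1 : ∑ i ∈ Finset.range q, potential K B R (i + 1) (B (source K B R i)) ≤
      ∑ i ∈ Finset.range q, (1 + ((known K B R (i + 1)).sup id - (known K B R i).sup id) +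
        if i < Nat.log 2 (2 * q) + 1 then 2 * (Nat.log 2 (2 * q) + 1) else 0) :=
    Finset.sum_le_sum fun i hi => c.potential_source_le (Finset.mem_range.1 hi)
  rw [Finset.sum_add_distrib, Finset.sum_add_distrib,
    Finset.sum_range_tsub (f := fun i => (known K B R i).sup id) (fun i j hij =>
      Finset.sup_mono (known_subset hij)), ← Finset.sum_filter] at h1
  have h2 : (known K B R q).sup id ≤ q :=
    Finset.sup_le fun e he => c.block_le_of_mem (c.good le_rfl) he
  have h3 : ((Finset.range q).filter (fun i => i < Nat.log 2 (2 * q) + 1)).card ≤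
      Nat.log 2 (2 * q) + 1 := by
    refine (Finset.card_le_card (t := Finset.range (Nat.log 2 (2 * q) + 1)) ?_).trans
      (Finset.card_range _).le
    intro x hx
    exact Finset.mem_range.2 (Finset.mem_filter.1 hx).2
  rw [Finset.sum_const, smul_eq_mul, Finset.sum_const, smul_eq_mul, Finset.card_range] at h1
  have h4 := sq_le_three_mul_two_pow (Nat.log 2 (2 * q))
  have h5 := Nat.pow_log_le_self 2 (show 2 * q ≠ 0 by omega)
  have h6 := Nat.mul_le_mul_right (2 * (Nat.log 2 (2 * q) + 1)) h3
  have h7 : (Nat.log 2 (2 * q) + 1) * (2 * (Nat.log 2 (2 * q) + 1)) =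
    2 * (Nat.log 2 (2 * q) + 1) ^ 2 := by ring
  omega

end Receiver

/-! ### Evaluation rules for the machine. -/

namespace Memory

/-- Charge `n` steps. -/
def charge (m : Memory) (n : ℕ) : Memory := { m with steps := m.steps + n }

/-- Write `a[i] ← x`, free of charge. -/
def write (m : Memory) (a : ArrayName) (i x : ℤ) : Memory :=
  { m with cell := fun c j => if c = a ∧ j = i then some x else m.cell c j }

@[simp] theorem cell_charge (m : Memory) (n : ℕ) : (m.charge n).cell = m.cell := rfl

@[simp] theorem steps_charge (m : Memory) (n : ℕ) : (m.charge n).steps = m.steps + n := rfl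

@[simp] theorem steps_write (m : Memory) (a : ArrayName) (i x : ℤ) :
    (m.write a i x).steps = m.steps := rfl

theorem cell_write (m : Memory) (a c : ArrayName) (i j x : ℤ) :
    (m.write a i x).cell c j = if c = a ∧ j = i then some x else m.cell c j := rfl

theorem cell_write_same (m : Memory) (a : ArrayName) (i x : ℤ) :
    (m.write a i x).cell a i = some x := by rw [cell_write, if_pos ⟨rfl, rfl⟩]

theorem cell_write_of_ne (m : Memory) {a c : ArrayName} (h : c ≠ a) (i j x : ℤ) :
    (m.write a i x).cell c j = m.cell c j := by rw [cell_write, if_neg fun h1 => h h1.1]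

theorem cell_write_array (m : Memory) {a c : ArrayName} (h : c ≠ a) (i x : ℤ) :
    (m.write a i x).cell c = m.cell c := funext fun j => m.cell_write_of_ne h i j x

theorem cell_write_of_index_ne (m : Memory) (a c : ArrayName) {i j : ℤ} (h : j ≠ i) (x : ℤ) :
    (m.write a i x).cell c j = m.cell c j := by rw [cell_write, if_neg fun h1 => h h1.2]

end Memory

section run
variable {α β : Type} (m : Memory)

theorem run_bind {f : Comp α} {m m' : Memory} {x : α} (h : f m = some (x, m')) (g : α → Comp β) :
    (f >>= g) m = g x m' := by
  change (f m).bind (fun y => g y.1 y.2) = _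
  rw [h]
  rfl

theorem run_pure (x : α) : (pure x : Comp α) m = some (x, m) := rfl

theorem run_tick (g : Unit → Comp β) : (tick >>= g) m = g () (m.charge 1) := rfl

theorem run_add (x y : ℤ) (g : ℤ → Comp β) : (add x y >>= g) m = g (x + y) (m.charge 1) := rfl

theorem run_sub (x y : ℤ) (g : ℤ → Comp β) : (sub x y >>= g) m = g (x - y) (m.charge 1) := rfl

theorem run_half (x : ℤ) (g : ℤ → Comp β) : (half x >>= g) m = g (x / 2) (m.charge 1) := rfl

theorem run_isEq (x y : ℤ) (g : Bool → Comp β) :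
    (isEq x y >>= g) m = g (decide (x = y)) (m.charge 1) := rfl

theorem run_isLe (x y : ℤ) (g : Bool → Comp β) :
    (isLe x y >>= g) m = g (decide (x ≤ y)) (m.charge 1) := rfl

theorem run_isLt (x y : ℤ) (g : Bool → Comp β) :
    (isLt x y >>= g) m = g (decide (x < y)) (m.charge 1) := rfl

theorem load_eq {m : Memory} {a : ArrayName} {i x : ℤ} (h : m.cell a i = some x) :
    load a i m = some (x, m.charge 1) := by
  change ((m.charge 1).cell a i).map _ = _
  rw [Memory.cell_charge, h]
  rfl

theorem run_load {m : Memory} {a : ArrayName} {i x : ℤ} (h : m.cell a i = some x)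
    (g : ℤ → Comp β) : (load a i >>= g) m = g x (m.charge 1) :=
  run_bind (load_eq h) g

theorem store_eq {q : ℤ} {a : ArrayName} {i : ℤ} (h : InBounds q a i) (x : ℤ) :
    store q a i x m = some ((), (m.charge 1).write a i x) := by
  change (if InBounds q a i then _ else _) = _
  rw [if_pos h]
  rfl

theorem run_store {q : ℤ} {a : ArrayName} {i : ℤ} (h : InBounds q a i) (x : ℤ)
    (g : Unit → Comp β) : (store q a i x >>= g) m = g () ((m.charge 1).write a i x) :=
  run_bind (store_eq m h x) g

end run

/-! ### The linked list and the invariant of the search. -/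

/-- The elements of `A` are linked in decreasing order: `next` leads from an element to the largest
smaller one and `prev` to the smallest larger one, with `-1` standing for a missing element. -/
structure Linked (A : Finset ℕ) (m : Memory) : Prop where
  -- The shift by one encodes the end marker `-1` as `n = 0`.
  next : ∀ a ∈ A, ∃ n : ℕ, m.cell .next a = some ((n : ℤ) - 1) ∧ n ≤ a ∧
    (∀ x, n = x + 1 → x ∈ A) ∧ ∀ x ∈ A, x < a → x < n
  prev : ∀ a ∈ A, ∃ u : ℤ, m.cell .prev a = some u ∧
    ((u = -1 ∧ ∀ x ∈ A, x ≤ a) ∨ ∃ x ∈ A, u = x ∧ a < x ∧ ∀ y ∈ A, a < y → x ≤ y)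

theorem Linked.congr {A : Finset ℕ} {m m' : Memory} (h : Linked A m)
    (hn : m'.cell .next = m.cell .next) (hp : m'.cell .prev = m.cell .prev) : Linked A m' :=
  ⟨by rw [hn]; exact h.next, by rw [hp]; exact h.prev⟩

/-- At the ends of the list the writes hit index `-1`, of which `Linked` says nothing. The cell
`next[a]` survives, and the search reads it after the removal. -/
theorem Linked.unlink {A : Finset ℕ} {m : Memory} (h : Linked A m) {q a : ℕ} (ha : a ∈ A)
    (hA : ∀ x ∈ A, x ≤ q) : ∃ m', unlink q a m = some ((), m') ∧ Linked (A.erase a) m' ∧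
      m'.cell .next a = m.cell .next a ∧ m'.cell .skips = m.cell .skips ∧
      m'.cell .recv = m.cell .recv ∧ m'.steps = m.steps + 4 := by
  obtain ⟨n, hn, hna, hn1, hn2⟩ := h.next a ha
  obtain ⟨u, hu, hu1⟩ := h.prev a ha
  have hua : u ≠ a ∧ -1 ≤ u ∧ u ≤ q := by
    rcases hu1 with ⟨rfl, -⟩ | ⟨x, hx, rfl, hax, -⟩
    · omega
    · have := hA x hx
      omega
  have haq := hA a ha
  refine ⟨((((m.charge 1).charge 1).charge 1).write .next u ((n : ℤ) - 1)).charge 1 |>.write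
    .prev ((n : ℤ) - 1) u, ?_, ⟨?_, ?_⟩, ?_, ?_, ?_, ?_⟩
  · rw [CirculantBroadcast.unlink, run_load hu, run_load (by exact hn),
      run_store _ (show InBounds q .next u from hua.2),
      store_eq _ (show InBounds q .prev ((n : ℤ) - 1) from ⟨by omega, by omega⟩)]
  · intro y hy
    obtain ⟨hya, hyA⟩ := Finset.mem_erase.1 hy
    rw [Memory.cell_write_of_ne _ (by decide), Memory.cell_charge, Memory.cell_write]
    by_cases hyu : (y : ℤ) = u
    · rw [if_pos ⟨rfl, hyu⟩]
      rcases hu1 with ⟨h1, -⟩ | ⟨x, hx, h1, hax, h2⟩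
      · omega
      · obtain rfl : y = x := by omega
        refine ⟨n, rfl, by omega, fun x hx => Finset.mem_erase.2 ⟨by omega, hn1 x hx⟩,
          fun z hz hzy => ?_⟩
        obtain ⟨hza, hzA⟩ := Finset.mem_erase.1 hz
        refine hn2 z hzA (lt_of_le_of_ne ?_ hza)
        by_contra h3
        have := h2 z hzA (by omega)
        omega
    · rw [if_neg fun h1 => hyu h1.2]
      obtain ⟨n', h1, h2, h3, h4⟩ := h.next y hyA
      refine ⟨n', h1, h2, fun x hx => Finset.mem_erase.2 ⟨?_, h3 x hx⟩, fun z hz =>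
        h4 z (Finset.mem_of_mem_erase hz)⟩
      rintro rfl
      rcases hu1 with ⟨-, h5⟩ | ⟨z, hz, rfl, hxz, h5⟩
      · have := h5 y hyA
        omega
      · have h6 := h5 y hyA (by omega)
        have h7 : ¬ z < y := fun h7 => by
          have := h4 z hz h7
          omega
        omega
  · intro y hy
    obtain ⟨hya, hyA⟩ := Finset.mem_erase.1 hy
    rw [Memory.cell_write, Memory.cell_charge, Memory.cell_write_of_ne _ (by decide)]
    by_cases hyn : (y : ℤ) = (n : ℤ) - 1
    · rw [if_pos ⟨rfl, hyn⟩]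
      refine ⟨u, rfl, ?_⟩
      rcases hu1 with ⟨rfl, h1⟩ | ⟨x, hx, rfl, hax, h1⟩
      · refine Or.inl ⟨rfl, fun x hx => ?_⟩
        obtain ⟨hxa, hxA⟩ := Finset.mem_erase.1 hx
        have h2 := h1 x hxA
        have := hn2 x hxA (by omega)
        omega
      · refine Or.inr ⟨x, Finset.mem_erase.2 ⟨by omega, hx⟩, rfl, by omega, fun z hz hyz => ?_⟩
        obtain ⟨hza, hzA⟩ := Finset.mem_erase.1 hz
        refine h1 z hzA ?_
        by_contra h2
        have := hn2 z hzA (by omega)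
        omega
    · rw [if_neg fun h1 => hyn h1.2]
      obtain ⟨u', h1, h2⟩ := h.prev y hyA
      refine ⟨u', h1, ?_⟩
      rcases h2 with ⟨rfl, h2⟩ | ⟨x, hx, rfl, hyx, h2⟩
      · exact Or.inl ⟨rfl, fun x hx => h2 x (Finset.mem_of_mem_erase hx)⟩
      · refine Or.inr ⟨x, Finset.mem_erase.2 ⟨?_, hx⟩, rfl, hyx, fun z hz =>
          h2 z (Finset.mem_of_mem_erase hz)⟩
        intro hxa
        rw [hxa] at hyx h2
        have h3 := hn2 y hyA hyx
        obtain ⟨z, hz⟩ : ∃ z, n = z + 1 := ⟨n - 1, by omega⟩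
        have h4 := h2 z (hn1 z hz)
        omega
  · rw [Memory.cell_write_of_ne _ (by decide), Memory.cell_charge,
      Memory.cell_write_of_index_ne _ _ _ (Ne.symm hua.1)]
    rfl
  · rw [Memory.cell_write_array _ (by decide), Memory.cell_charge,
      Memory.cell_write_array _ (by decide)]
    rfl
  · rw [Memory.cell_write_array _ (by decide), Memory.cell_charge,
      Memory.cell_write_array _ (by decide)]
    rfl
  · simp

/-- The blocks that are not known before round `k`. -/
noncomputable def alive (K B : ℕ → ℕ) (q R k : ℕ) : Finset ℕ :=
  Finset.range (q + 1) \ known K B R k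

theorem mem_alive {K B : ℕ → ℕ} {q R k a : ℕ} :
    a ∈ alive K B q R k ↔ a ≤ q ∧ a ∉ known K B R k := by
  rw [alive, Finset.mem_sdiff, Finset.mem_range, Nat.lt_succ_iff]

theorem alive_succ (K B : ℕ → ℕ) (q R k : ℕ) :
    alive K B q R (k + 1) = (alive K B q R k).erase (B (source K B R k)) := by
  ext x
  simp only [Finset.mem_erase, mem_alive, known_succ, Finset.mem_insert, not_or]
  tauto

/-- The contents of the arrays when the first `k` receive blocks have been found. -/
structure SearchState (K B : ℕ → ℕ) (q R k : ℕ) (m : Memory) : Prop where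
  skips : ∀ i ≤ q, m.cell .skips i = some (K i : ℤ)
  recv : ∀ j < k, m.cell .recv j = some (B (source K B R j) : ℤ)
  linked : Linked (alive K B q R k) m

theorem SearchState.congr {K B : ℕ → ℕ} {q R k : ℕ} {m m' : Memory}
    (h : SearchState K B q R k m) (hc : m'.cell = m.cell) : SearchState K B q R k m' :=
  ⟨by rw [hc]; exact h.skips, by rw [hc]; exact h.recv,
    h.linked.congr (by rw [hc]) (by rw [hc])⟩

/-- The number of iterations charged to accepting the block of round `i`. -/
noncomputable def acceptCost (K B : ℕ → ℕ) (R i : ℕ) : ℕ :=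
  2 * potential K B R (i + 1) (B (source K B R i)) + 2

/-- The outcome `k'`, `m'` of a search at the node `rc` that starts in round `k` with the memory `m`
and the block `n - 1`. -/
structure Searched (K B : ℕ → ℕ) (q R rc n k : ℕ) (m : Memory) (k' : ℕ) (m' : Memory) : Prop where
  le : k ≤ k'
  le_top : k' ≤ q
  state : SearchState K B q R k' m'
  source_le : k' < q → source K B R k' ≤ rc
  near : k' = k ∨ rc + K k' ≤ R
  block_lt : ∀ j, k ≤ j → j < k' → B (source K B R j) < B rc
  -- An iteration takes at most 23 steps. A skipped block lowers the doubled potential by at least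
  -- two, which pays for the iteration and for a possible rise of the indicator. A recursive call
  -- re-examines the same block at unchanged potential; there the indicator drops, since the new
  -- node has block `n - 1`.
  steps : m'.steps ≤ m.steps + 23 * (2 * potential K B R k n + (if n ≤ B rc then 1 else 0) + 1 +
    ∑ i ∈ Finset.Ico k k', acceptCost K B R i)

/-- After `q` rounds the `q + 1` known blocks exhaust `0, …, q`. -/
theorem Receiver.lt_of_alive {K : ℕ → ℕ} {q : ℕ} {B : ℕ → ℕ} {R k a : ℕ} (c : Receiver K q B R)
    (hk : k ≤ q) (ha : a ∈ alive K B q R k) : k < q := by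
  refine lt_of_le_of_ne hk ?_
  rintro rfl
  have hg := c.good hk
  have h1 : known K B R k = Finset.range (k + 1) :=
    Finset.eq_of_subset_of_card_le
      (fun x hx => Finset.mem_range.2 (Nat.lt_succ_of_le (c.block_le_of_mem hg hx)))
      (by rw [c.card_known hg, Finset.card_range])
  rw [alive, h1, Finset.sdiff_self] at ha
  exact absurd ha (Finset.notMem_empty a)

/-- The invariant: the pending source is at most `rc`, or the path to it starts with a child of `rc`
whose block the scan has not passed. The fuel suffices because `n` falls along a scan and `K (q + 1)
- rc` falls with each call. -/
theorem allblocks_spec {K : ℕ → ℕ} {q : ℕ} {B : ℕ → ℕ} {R : ℕ} (c : Receiver K q B R) (fuel : ℕ) :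
    ∀ (rc s n k : ℕ) (m : Memory), k ≤ q → SearchState K B q R k m →
      (∀ a, n = a + 1 → a ∈ alive K B q R k) → rc < K (q + 1) →
      (k = 0 ∧ s = K (q + 1) ∨ ∃ j, k = j + 1 ∧ s = source K B R j) →
      (k < q → source K B R k ≤ rc ∨ ∃ a < n, OnPath K B rc a (source K B R k)) →
      n + (K (q + 1) - rc) < fuel →
      ∃ (k' : ℕ) (m' : Memory), allblocks q R fuel rc s ((n : ℤ) - 1) k m = some ((k' : ℤ), m') ∧
        Searched K B q R rc n k m k' m' := by
  induction fuel with
  | zero => intro rc s n k m _ _ _ _ _ _ h; omega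
  | succ fuel ih =>
  intro rc s n k m hkq hS hn hrc hs hpath hf
  rw [allblocks, run_isEq]
  rcases n with _ | a
  · rw [if_pos (by simp), run_pure]
    refine ⟨k, _, rfl, le_rfl, hkq, hS.congr rfl, fun h => ?_, Or.inl rfl, fun j _ _ => by omega, ?_⟩
    · rcases hpath h with h | ⟨a, h, -⟩
      · exact h
      · omega
    · rw [Memory.steps_charge]
      omega
  have ha := hn a rfl
  have hk := c.lt_of_alive hkq ha
  obtain ⟨haq, hak⟩ := mem_alive.1 ha
  have hRl := c.lt_top
  have hg := c.good hkq
  have hpk := c.pos k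
  have hpa := c.pos a
  have hmk := c.lt_succ k
  have hfa : a + 1 + (K (q + 1) - (rc + K a)) < fuel := by
    clear hpath
    omega
  specialize hpath hk
  have hpath' : source K B R k ≤ rc ∨ ∃ a' ≤ a, OnPath K B rc a' (source K B R k) :=
    hpath.imp_right fun ⟨a', h1, h2⟩ => ⟨a', Nat.le_of_lt_succ h1, h2⟩
  rw [show ((a + 1 : ℕ) : ℤ) - 1 = a by push_cast; ring, if_neg (by simp),
    run_load (by exact hS.skips a haq), run_add, run_load (by exact hS.skips k hkq), run_sub, run_isLe, run_isLt,
    ← Nat.cast_add]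
  obtain ⟨n', hn1, hn2, hn3, hn4⟩ := hS.linked.next a ha
  by_cases hnf : rc + K a + K k ≤ R ∧ rc + K a < s
  swap
  · -- the block is skipped
    rw [if_neg (by
      rw [Bool.and_eq_true, decide_eq_true_eq, decide_eq_true_eq]
      omega), run_load (by exact hn1)]
    have hp := c.path_skip hk (a := a) (rc := rc) (by
      rcases hs with ⟨rfl, rfl⟩ | ⟨j, rfl, rfl⟩
      · omega
      · by_cases h : rc + K a + K (j + 1) ≤ R
        · exact Or.inr ⟨j, Nat.lt_succ_self j, by omega⟩
        · omega) hpath'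
    obtain ⟨k', m', h1, h2⟩ := ih rc s n' k ((((((((m.charge 1).charge 1).charge 1).charge 1).charge
      1).charge 1).charge 1).charge 1) hkq (hS.congr rfl) (fun x hx => hn3 x hx) hrc hs
      (fun _ => hp.imp_right fun ⟨a', h1, h2, h3⟩ => ⟨a', hn4 a'
        (mem_alive.2 ⟨by omega, h2⟩) h1, h3⟩) (by omega)
    refine ⟨k', m', h1, h2.le, h2.le_top, h2.state, h2.source_le, h2.near, h2.block_lt, ?_⟩
    have h3 := h2.steps
    have h4 := potential_lt hak hn2
    simp only [Memory.steps_charge] at h3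
    have h5 : (if n' ≤ B rc then 1 else 0) ≤ 1 := by split_ifs <;> omega
    omega
  · obtain ⟨hnear, hfr⟩ := hnf
    have hfresh : ∀ j < k, rc + K a < source K B R j := fun j hj => by
      rcases hs with ⟨rfl, -⟩ | ⟨i, rfl, rfl⟩
      · omega
      · exact lt_of_lt_of_le hfr (c.source_anti' hg (Nat.le_of_lt_succ hj) (Nat.lt_succ_self i))
    rw [if_pos (by
      rw [Bool.and_eq_true, decide_eq_true_eq, decide_eq_true_eq]
      omega), run_add, ← Nat.cast_one, ← Nat.cast_add, run_load (by exact hS.skips (k + 1) hk), run_sub]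
    have hcan : rc + K (k + 1) ≤ R → a < B rc ∧ B (rc + K a) = a ∧
        ∀ x, rc < x → x ≤ rc + K a → B x < B rc := fun h =>
      ⟨(c.block_add_of_near hk h hnear hfresh hpath').1,
        (c.block_add_of_near hk h hnear hfresh hpath').2,
        c.block_lt_of_near hk h hnear hfresh hpath'⟩
    obtain ⟨m₁, hm₁⟩ : ∃ m₁ : Memory, m₁ = (((((((((m.charge 1).charge 1).charge 1).charge 1).charge
      1).charge 1).charge 1).charge 1).charge 1).charge 1 := ⟨_, rfl⟩
    have hS₁ : SearchState K B q R k m₁ := hS.congr (by rw [hm₁]; rfl)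
    have hst₁ : m₁.steps = m.steps + 10 := by rw [hm₁]; rfl
    rw [← hm₁]
    -- the recursive call
    have hrec : ∃ (k₂ : ℕ) (m₂ : Memory), (do
          if ← isLe ((rc + K a : ℕ) : ℤ) ((R : ℤ) - (K (k + 1) : ℕ)) then
            tick
            allblocks q R fuel ((rc + K a : ℕ) : ℤ) s a k
          else
            pure (k : ℤ) : Comp ℤ) m₁ = some ((k₂ : ℤ), m₂) ∧
        k ≤ k₂ ∧ k₂ < q ∧ SearchState K B q R k₂ m₂ ∧ rc + K a + K k₂ ≤ R ∧
        a ∉ known K B R k₂ ∧ (∀ j, k ≤ j → j < k₂ → B (source K B R j) < B rc) ∧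
        (R < rc + K (k₂ + 1) → source K B R k₂ ≤ rc) ∧
        (rc + K (k₂ + 1) ≤ R → source K B R k₂ ≤ rc + K a ∧ a < B rc ∧ B (rc + K a) = a ∧
          ∀ x, rc < x → x ≤ rc + K a → B x < B rc) ∧
        m₂.steps ≤ m₁.steps + 2 + 23 * (2 * potential K B R k (a + 1) +
          (if a + 1 ≤ B rc then 1 else 0) + ∑ i ∈ Finset.Ico k k₂, acceptCost K B R i) := by
      rw [run_isLe]
      by_cases hle : rc + K a + K (k + 1) ≤ R
      · rw [if_pos (by rw [decide_eq_true_eq]; omega), run_tick]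
        obtain ⟨h1, h2, h3⟩ := hcan (by omega)
        have hp := c.path_child hk h2 hpath'
        obtain ⟨k₂, m₂, h4, h5⟩ := ih (rc + K a) s (a + 1) k ((m₁.charge 1).charge 1) hkq
          (hS₁.congr rfl) hn (by omega) hs
          (fun _ => hp.imp_right fun ⟨a', h1, h2⟩ => ⟨a', Nat.lt_succ_of_le h1, h2⟩) hfa
        rw [show ((a + 1 : ℕ) : ℤ) - 1 = a by push_cast; ring] at h4
        have hbl := h5.block_lt
        rw [h2] at hbl
        -- The call accepts only blocks below that of its node, so `a` is still in the list.
        have hak₂ : a ∉ known K B R k₂ := fun h => by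
          rcases mem_known_iff.1 h with h6 | ⟨j, hj, h6⟩
          · exact hak (h6 ▸ self_mem_known k)
          · rcases lt_or_ge j k with h7 | h7
            · exact hak (h6 ▸ mem_known_succ h7)
            · have := hbl j h7 hj
              omega
        have hk₂ := c.lt_of_alive h5.le_top (mem_alive.2 ⟨haq, hak₂⟩)
        have hsl := h5.source_le hk₂
        have hnr : rc + K a + K k₂ ≤ R := by
          rcases h5.near with h6 | h6
          · rw [h6]; exact hnear
          · exact h6
        refine ⟨k₂, m₂, h4, h5.le, hk₂, h5.state, hnr, hak₂,
          fun j hj hj' => (hbl j hj hj').trans h1, fun h6 => ?_, fun _ => ⟨hsl, h1, h2, h3⟩, ?_⟩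
        · exact c.source_le_of_far hk₂ h6 ((c.exists_onPath_source hk₂ h3 hsl).imp_right
            fun ⟨a', _, h⟩ => ⟨a', h⟩)
        · have h6 := h5.steps
          simp only [Memory.steps_charge, h2] at h6
          rw [if_neg (by omega)] at h6
          rw [if_pos (by omega)]
          omega
      · rw [if_neg (by rw [decide_eq_true_eq]; omega), run_pure]
        refine ⟨k, _, rfl, le_rfl, hk, hS₁.congr rfl, hnear, hak, fun j _ _ => by omega,
          fun h1 => c.source_le_of_far hk h1 (hpath.imp_right fun ⟨a', _, h⟩ => ⟨a', h⟩),
          fun h1 => ⟨c.source_le_of_not_near hk (hcan h1).2.1 (by omega) hpath', hcan h1⟩, ?_⟩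
        rw [Memory.steps_charge]
        omega
    obtain ⟨k₂, m₂, hr, hkk₂, hk₂, hS₂, hnear₂, hak₂, hbl₂, hfar₂, hcan₂, hst₂⟩ := hrec
    rw [run_bind hr, run_add, ← Nat.cast_add, run_load (by exact hS₂.skips (k₂ + 1) hk₂), run_sub,
      run_isLt]
    -- Either `rc` is too close to `R` to be the parent of the pending source, and the call returns,
    -- or the pending source is exactly the child `rc + K a`.
    by_cases hret : R < rc + K (k₂ + 1)
    · rw [if_pos (by rw [decide_eq_true_eq]; omega), run_pure]
      refine ⟨k₂, _, rfl, hkk₂, hk₂.le, hS₂.congr rfl, fun _ => hfar₂ hret, Or.inr (by omega), hbl₂, ?_⟩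
      simp only [Memory.steps_charge]
      omega
    · obtain ⟨hsl, hab, hB, hblock⟩ := hcan₂ (not_lt.1 hret)
      have hsrc := c.eq_source hk₂ hB (not_lt.1 hret) hnear₂ hak₂ hsl
      have hBs : B (source K B R k₂) = a := by rw [hsrc, hB]
      rw [if_neg (by rw [decide_eq_true_eq]; omega), run_store _ (show InBounds q .recv k₂ from
        ⟨by omega, by omega⟩), run_add, ← Nat.cast_add]
      obtain ⟨m₃, hm₃⟩ : ∃ m₃ : Memory, m₃ = ((((((m₂.charge 1).charge 1).charge 1).charge 1).charge
        1).write .recv k₂ a).charge 1 := ⟨_, rfl⟩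
      have hsk₃ : m₃.cell .skips = m₂.cell .skips := by
        rw [hm₃, Memory.cell_charge, Memory.cell_write_array _ (by decide)]; rfl
      have hnx₃ : m₃.cell .next = m₂.cell .next := by
        rw [hm₃, Memory.cell_charge, Memory.cell_write_array _ (by decide)]; rfl
      have hpv₃ : m₃.cell .prev = m₂.cell .prev := by
        rw [hm₃, Memory.cell_charge, Memory.cell_write_array _ (by decide)]; rfl
      have hst₃ : m₃.steps = m₂.steps + 6 := by rw [hm₃]; rfl
      have ha₂ : a ∈ alive K B q R k₂ := mem_alive.2 ⟨haq, hak₂⟩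
      obtain ⟨m₄, hu, hL, hnx₄, hsk₄, hrv₄, hst₄⟩ := (hS₂.linked.congr hnx₃ hpv₃).unlink (q := q) ha₂
        fun x hx => (mem_alive.1 hx).1
      obtain ⟨n₂, hn₂1, hn₂2, hn₂3, hn₂4⟩ := hS₂.linked.next a ha₂
      rw [← hm₃, run_bind hu, run_load (by rw [hnx₄, hnx₃]; exact hn₂1)]
      have hS₄ : SearchState K B q R (k₂ + 1) (m₄.charge 1) := by
        refine ⟨fun i hi => ?_, fun j hj => ?_, ?_⟩
        · rw [Memory.cell_charge, hsk₄, hsk₃]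
          exact hS₂.skips i hi
        · rw [Memory.cell_charge, hrv₄, hm₃, Memory.cell_charge]
          rcases Nat.lt_or_eq_of_le (Nat.le_of_lt_succ hj) with h | rfl
          · rw [Memory.cell_write_of_index_ne _ _ _ (by omega)]
            exact hS₂.recv j h
          · rw [Memory.cell_write_same, hBs]
        · rw [alive_succ, hBs]
          exact hL.congr rfl rfl
      obtain ⟨k', m', h1, h2⟩ := ih rc (rc + K a) n₂ (k₂ + 1) (m₄.charge 1) hk₂ hS₄
        (fun x hx => by
          rw [alive_succ, hBs, Finset.mem_erase]
          exact ⟨by omega, hn₂3 x hx⟩) hrc (Or.inr ⟨k₂, rfl, hsrc.symm⟩)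
        (fun h => (c.path_next h hblock hsrc).imp_right fun ⟨a', h1, h2, h3⟩ =>
          ⟨a', hn₂4 a' (mem_alive.2 ⟨by omega, fun h4 =>
            h2 (known_subset (Nat.le_succ _) h4)⟩) h1, h3⟩) (by omega)
      have h3 := h2.le
      refine ⟨k', m', h1, by omega, h2.le_top, h2.state, h2.source_le, Or.inr ?_,
        fun j hj hj' => ?_, ?_⟩
      · rcases h2.near with h4 | h4
        · rw [h4]; omega
        · exact h4
      · rcases lt_trichotomy j k₂ with h4 | rfl | h4
        · exact hbl₂ j hj h4
        · rw [hBs]; exact hab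
        · exact h2.block_lt j h4 hj'
      · have h4 := h2.steps
        rw [Memory.steps_charge] at h4
        have h5 : (if n₂ ≤ B rc then 1 else 0) ≤ 1 := by split_ifs <;> omega
        have h6 := potential_mono (K := K) (B := B) (R := R) (k := k₂ + 1) hn₂2
        have h7 : ∑ i ∈ Finset.Ico k k', acceptCost K B R i =
            ∑ i ∈ Finset.Ico k k₂, acceptCost K B R i + (acceptCost K B R k₂ +
              ∑ i ∈ Finset.Ico (k₂ + 1) k', acceptCost K B R i) := by
          rw [← Finset.sum_eq_sum_Ico_succ_bot (by omega),
            Finset.sum_Ico_consecutive _ hkk₂ (by omega)]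
        have h8 : acceptCost K B R k₂ = 2 * potential K B R (k₂ + 1) a + 2 := by
          rw [acceptCost, hBs]
        rw [h7, h8]
        omega

/-! ### The skips of `p` and their extension by doubling. -/

/-- Repeated halving with rounding up amounts to one rounded division, `⌈p / 2 ^ i⌉`. This yields
the first skip and the lower bound for the others. -/
theorem halvings_bounds (p i : ℕ) :
    2 ^ i * halvings p i < p + 2 ^ i ∧ p ≤ 2 ^ i * halvings p i := by
  induction i with
  | zero => simp [halvings]
  | succ i ih =>
    have h1 : 2 * halvings p (i + 1) ≤ halvings p i + 1 := by simp only [halvings]; omega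
    have h2 : halvings p i ≤ 2 * halvings p (i + 1) := by simp only [halvings]; omega
    have h3 := Nat.mul_le_mul_left (2 ^ i) h1
    have h4 := Nat.mul_le_mul_left (2 ^ i) h2
    rw [pow_succ, Nat.mul_assoc]
    rw [Nat.mul_add, Nat.mul_one] at h3
    omega

theorem skip_rounds (p : ℕ) : skip p (rounds p) = p := by simp [skip, halvings]

theorem skip_eq_half {p k : ℕ} (hk : k < rounds p) : skip p k = (skip p (k + 1) + 1) / 2 := by
  rw [skip, skip, show rounds p - k = rounds p - (k + 1) + 1 by omega, halvings]

theorem skip_zero {p : ℕ} (hp : 2 ≤ p) : skip p 0 = 1 := by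
  obtain ⟨h1, h2⟩ := halvings_bounds p (rounds p)
  have h3 : p ≤ 2 ^ rounds p := Nat.le_pow_clog (by norm_num) p
  have h4 : 0 < 2 ^ rounds p := by positivity
  rw [skip, Nat.sub_zero]
  rcases lt_trichotomy (halvings p (rounds p)) 1 with h | h | h
  · rw [Nat.lt_one_iff.1 h] at h2
    omega
  · exact h
  · have := Nat.mul_le_mul_left (2 ^ rounds p) (show 2 ≤ _ from h)
    omega

theorem two_le_skip {p k : ℕ} (hk : 0 < k) (hkq : k ≤ rounds p) : 2 ≤ skip p k := by
  obtain ⟨h1, h2⟩ := halvings_bounds p (rounds p - k)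
  have h3 : 2 ^ (rounds p - k) < p :=
    Nat.pow_lt_of_lt_clog (show rounds p - k < rounds p by omega)
  rw [skip]
  by_contra h
  have := Nat.mul_le_mul_left (2 ^ (rounds p - k)) (show halvings p (rounds p - k) ≤ 1 by omega)
  omega

/-- The skips, continued by doubling beyond `q`. -/
def extSkip (p i : ℕ) : ℕ := if i ≤ rounds p then skip p i else 2 ^ (i - rounds p) * p

theorem extSkip_of_le {p i : ℕ} (h : i ≤ rounds p) : extSkip p i = skip p i := if_pos h

theorem extSkip_add (p i : ℕ) : extSkip p (rounds p + i) = 2 ^ i * p := by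
  rcases i with _ | i
  · rw [extSkip_of_le (by omega), Nat.add_zero, skip_rounds, pow_zero, Nat.one_mul]
  · rw [extSkip, if_neg (by omega), Nat.add_sub_cancel_left]

theorem skipSeq_extSkip {p : ℕ} (hp : 2 ≤ p) : SkipSeq (extSkip p) := by
  have key : ∀ i, extSkip p i < extSkip p (i + 1) ∧ extSkip p (i + 1) ≤ 2 * extSkip p i ∧
      2 * extSkip p i ≤ extSkip p (i + 1) + 1 := fun i => by
    rcases lt_or_ge i (rounds p) with h | h
    · rw [extSkip_of_le h.le, extSkip_of_le (show i + 1 ≤ rounds p from h), skip_eq_half h]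
      have : 2 ≤ skip p (i + 1) := two_le_skip (Nat.succ_pos i) h
      omega
    · obtain ⟨j, rfl⟩ := Nat.exists_eq_add_of_le h
      rw [Nat.add_assoc, extSkip_add, extSkip_add, pow_succ]
      have : 0 < 2 ^ j * p := by positivity
      rw [show 2 ^ j * 2 * p = 2 * (2 ^ j * p) by ring]
      omega
  exact ⟨by rw [extSkip_of_le (Nat.zero_le _), skip_zero hp], fun i => (key i).1,
    fun i => (key i).2.1, fun i => (key i).2.2⟩

/-- The smallest index of the canonical skip sequence of a processor in `[0, 2p)`. -/
def block (p : ℕ) : ℕ → ℕ := greedyBlock (extSkip p) (rounds p + 1) (rounds p + 1)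

theorem extSkip_rounds (p : ℕ) : extSkip p (rounds p) = p := by
  have := extSkip_add p 0
  rwa [Nat.add_zero, pow_zero, Nat.one_mul] at this

theorem extSkip_rounds_succ (p : ℕ) : extSkip p (rounds p + 1) = 2 * p := by
  rw [extSkip_add, pow_one]

theorem blockTree_block {p : ℕ} (hp : 2 ≤ p) : BlockTree (extSkip p) (rounds p) (block p) :=
  blockTree_greedyBlock (skipSeq_extSkip hp) _ (by rw [extSkip_rounds_succ, extSkip_rounds])

theorem receiver_block {p r : ℕ} (hp : 2 ≤ p) (hr : r < p) :
    Receiver (extSkip p) (rounds p) (block p) (p + r) where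
  toBlockTree := blockTree_block hp
  skip_le_self := by rw [extSkip_rounds]; omega
  lt_top := by rw [extSkip_rounds_succ]; omega

theorem rounds_pos {p : ℕ} (hp : 2 ≤ p) : 0 < rounds p := Nat.clog_pos (by norm_num) hp

theorem greedyBlock_top {K : ℕ → ℕ} (h : SkipSeq K) (top top' : ℕ) {n x : ℕ} (h0 : 0 < x)
    (hx : x < K n) : greedyBlock K top n x = greedyBlock K top' n x := by
  induction n generalizing x with
  | zero => rw [h.zero] at hx; omega
  | succ n ih =>
    have := h.le_double n
    rw [greedyBlock, greedyBlock]
    split_ifs with h1 h2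
    · rfl
    · exact ih (by omega) (by omega)
    · exact ih h0 (by omega)

/-- The baseblock of processor `r` is the block of the copy `p + r`. -/
theorem greedyBlock_eq_block {p r : ℕ} (hp : 2 ≤ p) (hr : r < p) :
    greedyBlock (extSkip p) (rounds p) (rounds p) r = block p (p + r) := by
  have hK := skipSeq_extSkip hp
  -- For the root no skip is taken, and the default value `q` is the block of its copy `p`.
  rcases Nat.eq_zero_or_pos r with rfl | h0
  · have := (blockTree_block hp).block_skip (le_refl (rounds p))
    rw [extSkip_rounds] at this
    rw [greedyBlock_zero hK, Nat.add_zero, this]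
  · rw [block, greedyBlock, extSkip_rounds, if_neg (by omega), if_pos (by omega),
      Nat.add_sub_cancel_left]
    exact greedyBlock_top hK _ _ h0 (by rw [extSkip_rounds]; exact hr)

/-! ### Loops -/

theorem forUp_spec (body : ℤ → Comp Unit) (P : ℕ → (ArrayName → ℤ → Option ℤ) → Prop) (n d : ℕ)
    (hbody : ∀ i < n, ∀ m : Memory, P i m.cell →
      ∃ m', body i m = some ((), m') ∧ P (i + 1) m'.cell ∧ m'.steps ≤ m.steps + d)
    (fuel : ℕ) : ∀ (i : ℕ) (m : Memory), i ≤ n → n - i < fuel → P i m.cell →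
      ∃ m', forUp body fuel i ((n : ℤ) - 1) m = some ((), m') ∧ P n m'.cell ∧
        m'.steps ≤ m.steps + (d + 2) * (n - i) + 1 := by
  induction fuel with
  | zero => intro i m _ h; omega
  | succ fuel ih =>
    intro i m hi hf hP
    rw [forUp, run_isLe]
    by_cases h : i < n
    · obtain ⟨m₁, h1, h2, h3⟩ := hbody i h (m.charge 1) hP
      obtain ⟨m₂, h4, h5, h6⟩ := ih (i + 1) (m₁.charge 1) h (by omega) h2
      rw [if_pos (by rw [decide_eq_true_eq]; omega), run_bind h1, run_add, ← Nat.cast_one,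
        ← Nat.cast_add, Nat.cast_one]
      refine ⟨m₂, h4, h5, ?_⟩
      rw [Memory.steps_charge] at h3 h6
      rw [show n - i = n - (i + 1) + 1 by omega, Nat.mul_add]
      omega
    · rw [if_neg (by rw [decide_eq_true_eq]; omega), run_pure]
      obtain rfl : i = n := by omega
      exact ⟨_, rfl, hP, by rw [Memory.steps_charge]; omega⟩

theorem skipsLoop_spec {p : ℕ} (fuel : ℕ) : ∀ (k : ℕ) (m : Memory), k < fuel → k ≤ rounds p →
    (∀ i, k ≤ i → i ≤ rounds p → m.cell .skips i = some (skip p i : ℤ)) →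
    ∃ m', skipsLoop (rounds p) fuel k m = some ((), m') ∧
      (∀ i ≤ rounds p, m'.cell .skips i = some (skip p i : ℤ)) ∧ m'.steps ≤ m.steps + 6 * k + 1 := by
  induction fuel with
  | zero => intro k m h; omega
  | succ fuel ih =>
    intro k m hf hk hm
    rw [skipsLoop, run_isLt]
    rcases k with _ | k
    · rw [if_neg (by simp), run_pure]
      exact ⟨_, rfl, fun i hi => hm i (Nat.zero_le i) hi, le_rfl⟩
    · rw [if_pos (by simp), run_load (by exact hm (k + 1) le_rfl hk), run_half, run_sub,
        run_sub, show ((k + 1 : ℕ) : ℤ) - 1 = k by push_cast; ring,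
        run_store _ (show InBounds (rounds p) .skips k from ⟨by omega, by omega⟩)]
      have hsk : (skip p (k + 1) : ℤ) - (skip p (k + 1) : ℤ) / 2 = skip p k := by
        rw [skip_eq_half (show k < rounds p from hk)]
        omega
      rw [hsk]
      obtain ⟨m', h1, h2, h3⟩ := ih k ((((((((m.charge 1).charge 1).charge 1).charge 1).charge
        1).charge 1).write .skips k (skip p k))) (by omega) (by omega) fun i hi hiq => by
          rcases Nat.lt_or_eq_of_le hi with h | rfl
          · rw [Memory.cell_write_of_index_ne _ _ _ (by omega)]
            exact hm i h hiq
          · rw [Memory.cell_write_same]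
      refine ⟨m', h1, h2, h3.trans ?_⟩
      simp only [Memory.steps_write, Memory.steps_charge]
      omega

theorem computeSkips_spec {p fuel : ℕ} (hf : rounds p < fuel) (m : Memory) :
    ∃ m', computeSkips fuel p (rounds p) m = some ((), m') ∧
      (∀ i ≤ rounds p, m'.cell .skips i = some (skip p i : ℤ)) ∧
      m'.steps ≤ m.steps + 6 * rounds p + 3 := by
  obtain ⟨m', h1, h2, h3⟩ := skipsLoop_spec (p := p) fuel (rounds p)
    (((m.charge 1).charge 1).write .skips (rounds p) p) hf le_rfl fun i hi hiq => by
      rw [show i = rounds p by omega, Memory.cell_write_same, skip_rounds]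
  refine ⟨m', ?_, h2, ?_⟩
  · rw [computeSkips, run_tick, run_store _ (show InBounds (rounds p) .skips (rounds p) from
      ⟨by omega, by omega⟩)]
    exact h1
  · simp only [Memory.steps_write, Memory.steps_charge] at h3
    omega

theorem baseblockLoop_spec {K : ℕ → ℕ} {q r : ℕ} (fuel : ℕ) : ∀ (k rc : ℕ) (m : Memory),
    k < fuel → k < q → rc ≤ r → (∀ i ≤ q, m.cell .skips i = some (K i : ℤ)) →
    ∃ m', baseblockLoop q r fuel ((k : ℤ) + 1) rc m =
      some ((greedyBlock K q (k + 1) (r - rc) : ℤ), m') ∧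
      m'.cell = m.cell ∧ m'.steps ≤ m.steps + 6 * (k + 1) := by
  induction fuel with
  | zero => intro k rc m h; omega
  | succ fuel ih =>
    intro k rc m hf hk hrc hm
    rw [baseblockLoop, run_sub, add_sub_cancel_right, run_load (by exact hm k hk.le), run_add,
      run_isEq, greedyBlock]
    by_cases h1 : rc + K k = r
    · rw [if_pos (by rw [decide_eq_true_eq]; omega), if_pos (by omega), run_pure]
      exact ⟨_, rfl, rfl, by simp only [Memory.steps_charge]; omega⟩
    · rw [if_neg (by rw [decide_eq_true_eq]; omega), if_neg (by omega), run_isLt]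
      obtain ⟨rc', hrc', h2, h3⟩ : ∃ rc' : ℕ, (if decide ((rc : ℤ) + K k < r) = true then
          (rc : ℤ) + K k else rc) = rc' ∧ rc' ≤ r ∧
          (if K k < r - rc then greedyBlock K q k (r - rc - K k) else
            greedyBlock K q k (r - rc)) = greedyBlock K q k (r - rc') := by
        by_cases h : rc + K k < r
        · refine ⟨rc + K k, ?_, h.le, ?_⟩
          · rw [if_pos (by rw [decide_eq_true_eq]; omega), Nat.cast_add]
          · rw [if_pos (by omega), Nat.sub_sub]
        · refine ⟨rc, ?_, hrc, ?_⟩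
          · rw [if_neg (by rw [decide_eq_true_eq]; omega)]
          · rw [if_neg (by omega)]
      simp only [hrc', h3]
      rw [run_isEq]
      rcases k with _ | k
      · rw [if_pos (by simp), run_pure]
        exact ⟨_, rfl, rfl, by simp only [Memory.steps_charge]; omega⟩
      · rw [if_neg (by rw [decide_eq_true_eq]; omega)]
        obtain ⟨m', h4, h5, h6⟩ := ih k rc' ((((((m.charge 1).charge 1).charge 1).charge 1).charge
          1).charge 1) (by omega) (by omega) h2 hm
        refine ⟨m', by rw [Nat.cast_succ]; exact h4, h5.trans rfl, h6.trans ?_⟩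
        simp only [Memory.steps_charge]
        omega

theorem baseblock_spec {p r fuel : ℕ} (hp : 2 ≤ p) (hr : r < p) (hf : rounds p ≤ fuel) (m : Memory)
    (hm : ∀ i ≤ rounds p, m.cell .skips i = some (extSkip p i : ℤ)) :
    ∃ m', baseblock fuel (rounds p) r m = some ((block p (p + r) : ℤ), m') ∧
      m'.cell = m.cell ∧ m'.steps ≤ m.steps + 6 * rounds p + 1 := by
  have hq := rounds_pos hp
  obtain ⟨m', h1, h2, h3⟩ := baseblockLoop_spec (r := r) fuel (rounds p - 1) 0 (m.charge 1)
    (by omega) (by omega) (Nat.zero_le r) hm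
  rw [Nat.sub_add_cancel hq, Nat.sub_zero, greedyBlock_eq_block hp hr,
    show ((rounds p - 1 : ℕ) : ℤ) + 1 = rounds p by omega] at h1
  refine ⟨m', by rw [baseblock, run_tick]; exact h1, h2.trans rfl, ?_⟩
  rw [Memory.steps_charge] at h3
  omega

theorem Receiver.sum_acceptCost_le {K : ℕ → ℕ} {q : ℕ} {B : ℕ → ℕ} {R : ℕ} (c : Receiver K q B R)
    (hq : 0 < q) : ∑ i ∈ Finset.Ico 0 q, acceptCost K B R i ≤ 30 * q := by
  have h := c.sum_potential_le hq
  simp only [acceptCost]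
  rw [← Finset.range_eq_Ico, Finset.sum_add_distrib, ← Finset.mul_sum, Finset.sum_const,
    Finset.card_range, smul_eq_mul]
  omega

/-- The search as it is called by `recvschedule`. -/
theorem allblocks_root {K : ℕ → ℕ} {q : ℕ} {B : ℕ → ℕ} {R : ℕ} (c : Receiver K q B R) (hq : 0 < q)
    {fuel : ℕ} (hf : q + 2 + K (q + 1) < fuel) {m : Memory} (hS : SearchState K B q R 0 m)
    (hnext : B R = q → m.cell .next q = some ((q : ℤ) - 1)) :
    ∃ m', allblocks q R fuel 0 (K (q + 1) : ℕ) q 0 m = some ((q : ℤ), m') ∧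
      SearchState K B q R q m' ∧ m'.steps ≤ m.steps + 800 * q + 100 := by
  have hRl := c.lt_top
  have hK0 := c.zero
  have hel := c.eligible hq
  have hbr := c.block_le R c.R_pos hRl
  have hsum := c.sum_acceptCost_le hq
  have ht : source K B R 0 < K (q + 1) := by have := hel.2.1; omega
  have halive : ∀ a, a ≤ q → (a ∈ alive K B q R 0 ↔ a ≠ B R) := fun a h => by
    rw [mem_alive, known, Finset.mem_singleton]
    exact ⟨fun h => h.2, fun h1 => ⟨h, h1⟩⟩
  obtain ⟨a, ha, hpath⟩ := c.exists_onPath hel.1 ht fun x h0 h1 => by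
    have := c.block_le x h0 (by omega)
    rw [c.root]
    omega
  rw [c.root] at ha
  -- A search that ends early has the next source at most at its node, here `0`, but sources are
  -- positive.
  have hend : ∀ {n k' : ℕ} {m m' : Memory}, Searched K B q R 0 n 0 m k' m' →
      k' = q := fun {n k' m m'} h => by
    by_contra hne
    have h1 := h.le_top
    have h2 := h.source_le (by omega)
    have := (c.eligible (show k' < q by omega)).1
    omega
  -- The bound is `23 * (2 * (q + 1) + 2 + 30 * q)`.
  have hcost : ∀ {n : ℕ} {m m' : Memory}, n ≤ q + 1 → Searched K B q R 0 n 0 m q m' →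
      m'.steps ≤ m.steps + 800 * q + 92 := fun {n m m'} hn h => by
    have h1 := h.steps
    have h2 := potential_zero_le (K := K) (B := B) (R := R) (n := n)
    have h3 : (if n ≤ B 0 then 1 else 0) ≤ 1 := by split_ifs <;> omega
    omega
  by_cases hb : B R = q
  · -- the block `q` is not in the list
    have hRq : R = K q := by
      have h1 := c.skip_le R c.R_pos hRl
      rcases Nat.lt_or_eq_of_le c.skip_le_self with h | h
      · have h2 := c.block_add (x := R - K q) (by omega) (by have := c.top_double; omega)
        rw [Nat.sub_add_cancel h.le, hb] at h2
        have h3 := c.skip_le (R - K q) (by omega) (by omega)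
        have := c.top_double
        rw [← h2] at h3
        omega
      · exact h.symm
    obtain ⟨fuel, rfl⟩ : ∃ f, fuel = f + 1 := ⟨fuel - 1, by omega⟩
    have h0 : (0 : ℤ) = ((0 : ℕ) : ℤ) := rfl
    -- The search starts at `q` although `q` is unlinked. The first test fails because `K q = R > R
    -- - K 0`, and the stale entry `next[q]` leads into the list.
    rw [allblocks, run_isEq, if_neg (by rw [decide_eq_true_eq]; omega),
      run_load (by exact hS.skips q le_rfl), run_add, run_load (by exact hS.skips 0 (Nat.zero_le q)),
      run_sub, run_isLe, run_isLt, if_neg (by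
        rw [Bool.and_eq_true, decide_eq_true_eq, decide_eq_true_eq]
        omega), run_load (by exact hnext hb)]
    have haq : a < q := by
      have h1 := hpath.le
      have h2 := hel.2.1
      exact c.lt_iff.1 (by omega)
    obtain ⟨k', m', h1, h2⟩ := allblocks_spec c fuel 0 (K (q + 1)) q 0
      ((((((((m.charge 1).charge 1).charge 1).charge 1).charge 1).charge 1).charge 1).charge 1)
      (Nat.zero_le q) (hS.congr rfl) (fun a h => (halive a (by omega)).2 (by omega)) (c.pos _)
      (Or.inl ⟨rfl, rfl⟩) (fun _ => Or.inr ⟨a, haq, hpath⟩) (by omega)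
    obtain rfl := hend h2
    refine ⟨m', h1, h2.state, (hcost (by omega) h2).trans ?_⟩
    simp only [Memory.steps_charge]
    omega
  · obtain ⟨k', m', h1, h2⟩ := allblocks_spec c fuel 0 (K (q + 1)) (q + 1) 0 m
      (Nat.zero_le q) hS (fun a h => (halive a (by omega)).2 (by omega)) (c.pos _)
      (Or.inl ⟨rfl, rfl⟩) (fun _ => Or.inr ⟨a, ha, hpath⟩) (by omega)
    obtain rfl := hend h2
    rw [Nat.cast_succ, add_sub_cancel_right] at h1
    exact ⟨m', h1, h2.state, (hcost le_rfl h2).trans (by omega)⟩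

theorem Linked.init {q : ℕ} {m : Memory}
    (hn : ∀ e ≤ q, m.cell .next e = some ((e : ℤ) - 1))
    (hp : ∀ e < q, m.cell .prev e = some ((e : ℤ) + 1)) (hq : m.cell .prev q = some (-1)) :
    Linked (Finset.range (q + 1)) m := by
  refine ⟨fun a ha => ?_, fun a ha => ?_⟩ <;> rw [Finset.mem_range, Nat.lt_succ_iff] at ha
  · exact ⟨a, hn a ha, le_rfl, fun x hx => Finset.mem_range.2 (by omega), fun x _ hx => hx⟩
  · rcases Nat.lt_or_eq_of_le ha with h | rfl
    · exact ⟨_, hp a h, Or.inr ⟨a + 1, Finset.mem_range.2 (by omega), by push_cast; rfl,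
        Nat.lt_succ_self a, fun y _ hy => hy⟩⟩
    · exact ⟨_, hq, Or.inl ⟨rfl, fun x hx => Nat.le_of_lt_succ (Finset.mem_range.1 hx)⟩⟩

/-- The receive schedule of processor `r`. -/
noncomputable def recvBlock (p r k : ℕ) : ℤ :=
  if block p (source (extSkip p) (block p) (p + r) k) = rounds p then (block p (p + r) : ℤ)
  else (block p (source (extSkip p) (block p) (p + r) k) : ℤ) - rounds p

theorem initList_spec (q : ℕ) {fuel : ℕ} (hf : q + 1 < fuel) (m : Memory) :
    ∃ m', forUp (fun e => do
        let d ← sub e 1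
        store q .next e d
        let u ← add e 1
        store q .prev e u) fuel 0 q m = some ((), m') ∧
      (∀ e ≤ q, m'.cell .next e = some ((e : ℤ) - 1)) ∧
      (∀ e ≤ q, m'.cell .prev e = some ((e : ℤ) + 1)) ∧
      m'.cell .skips = m.cell .skips ∧ m'.steps ≤ m.steps + 6 * q + 7 := by
  obtain ⟨m', h1, h2, h3⟩ := forUp_spec (fun e => do
        let d ← sub e 1
        store q .next e d
        let u ← add e 1
        store q .prev e u)
    (fun i cell => (∀ e < i, cell .next e = some ((e : ℤ) - 1)) ∧
      (∀ e < i, cell .prev e = some ((e : ℤ) + 1)) ∧ cell .skips = m.cell .skips) (q + 1) 4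
    (fun i hi m₁ ⟨h1, h2, h3⟩ => by
      refine ⟨((((m₁.charge 1).charge 1).write .next i ((i : ℤ) - 1)).charge 1).charge 1 |>.write
        .prev i ((i : ℤ) + 1), ?_, ⟨fun e he => ?_, fun e he => ?_, ?_⟩, ?_⟩
      · simp only [run_sub]
        rw [run_store _ (show InBounds q .next i from ⟨by omega, by omega⟩), run_add,
          store_eq _ (show InBounds q .prev i from ⟨by omega, by omega⟩)]
      · rw [Memory.cell_write_of_ne _ (by decide), Memory.cell_charge, Memory.cell_charge]
        rcases Nat.lt_or_eq_of_le (Nat.le_of_lt_succ he) with h | rfl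
        · rw [Memory.cell_write_of_index_ne _ _ _ (by omega)]
          exact h1 e h
        · rw [Memory.cell_write_same]
      · rcases Nat.lt_or_eq_of_le (Nat.le_of_lt_succ he) with h | rfl
        · rw [Memory.cell_write_of_index_ne _ _ _ (by omega), Memory.cell_charge,
            Memory.cell_charge, Memory.cell_write_of_ne _ (by decide)]
          exact h2 e h
        · rw [Memory.cell_write_same]
      · rw [Memory.cell_write_array _ (by decide), Memory.cell_charge, Memory.cell_charge,
          Memory.cell_write_array _ (by decide)]
        exact h3
      · simp)
    fuel 0 m (Nat.zero_le _) (by omega)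
    ⟨fun e he => by omega, fun e he => by omega, rfl⟩
  rw [Nat.cast_succ, add_sub_cancel_right] at h1
  exact ⟨m', h1, fun e he => h2.1 e (by omega), fun e he => h2.2.1 e (by omega), h2.2.2,
    h3.trans (by omega)⟩

theorem adjust_spec (q : ℕ) (b : ℤ) (g : ℕ → ℕ) {fuel : ℕ} (hf : q < fuel) {m : Memory}
    (hm : ∀ k < q, m.cell .recv k = some (g k : ℤ)) :
    ∃ m', forUp (fun k => do
        let x ← load .recv k
        if ← isEq x q then
          store q .recv k b
        else
          let y ← sub x q
          store q .recv k y) fuel 0 ((q : ℤ) - 1) m = some ((), m') ∧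
      (∀ k < q, m'.cell .recv k = some (if g k = q then b else (g k : ℤ) - q)) ∧
      m'.cell .skips = m.cell .skips ∧ m'.steps ≤ m.steps + 6 * q + 1 := by
  obtain ⟨m', h1, h2, h3⟩ := forUp_spec (fun k => do
        let x ← load .recv k
        if ← isEq x q then
          store q .recv k b
        else
          let y ← sub x q
          store q .recv k y)
    (fun i cell => (∀ k < i, cell .recv k = some (if g k = q then b else (g k : ℤ) - q)) ∧
      (∀ k, i ≤ k → k < q → cell .recv k = some (g k : ℤ)) ∧ cell .skips = m.cell .skips) q 4
    (fun i hi m₁ ⟨h1, h2, h3⟩ => by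
      have hb : InBounds q .recv i := ⟨by omega, by omega⟩
      have key : ∀ (m₂ : Memory) (x : ℤ), m₂.cell = m₁.cell →
          x = (if g i = q then b else (g i : ℤ) - q) →
          (∀ k < i + 1, (m₂.write .recv i x).cell .recv k =
            some (if g k = q then b else (g k : ℤ) - q)) ∧
          (∀ k, i + 1 ≤ k → k < q → (m₂.write .recv i x).cell .recv k = some (g k : ℤ)) ∧
          (m₂.write .recv i x).cell .skips = m.cell .skips := fun m₂ x hc hx => by
        refine ⟨fun k hk => ?_, fun k hk hkq => ?_, ?_⟩
        · rcases Nat.lt_or_eq_of_le (Nat.le_of_lt_succ hk) with h | rfl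
          · rw [Memory.cell_write_of_index_ne _ _ _ (by omega), hc]
            exact h1 k h
          · rw [Memory.cell_write_same, hx]
        · rw [Memory.cell_write_of_index_ne _ _ _ (by omega), hc]
          exact h2 k (by omega) hkq
        · rw [Memory.cell_write_array _ (by decide), hc, h3]
      rw [run_load (by exact h2 i le_rfl hi), run_isEq]
      by_cases h : g i = q
      · rw [if_pos (by rw [decide_eq_true_eq]; omega), store_eq _ hb]
        exact ⟨_, rfl, key _ _ rfl (by rw [if_pos h]), by simp⟩
      · rw [if_neg (by rw [decide_eq_true_eq]; omega), run_sub, store_eq _ hb]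
        exact ⟨_, rfl, key _ _ rfl (by rw [if_neg h]), by simp⟩)
    fuel 0 m (Nat.zero_le _) (by omega)
    ⟨fun e he => by omega, fun k _ hk => hm k hk, rfl⟩
  exact ⟨m', h1, h2.1, h2.2.2, h3.trans (by omega)⟩

theorem recvschedule_spec {p r fuel : ℕ} (hp : 2 ≤ p) (hr : r < p) (hf : rounds p + 2 + 2 * p < fuel)
    {m : Memory} (hm : ∀ i ≤ rounds p, m.cell .skips i = some (skip p i : ℤ)) :
    ∃ m', recvschedule fuel p (rounds p) r m = some ((), m') ∧
      (∀ k ≤ rounds p, m'.cell .skips k = some (skip p k : ℤ)) ∧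
      (∀ k < rounds p, m'.cell .recv k = some (recvBlock p r k)) ∧
      m'.steps ≤ m.steps + 818 * rounds p + 125 := by
  have c := receiver_block hp hr
  have hq := rounds_pos hp
  have hbq := c.block_le _ c.R_pos c.lt_top
  rw [recvschedule, run_tick]
  obtain ⟨m₁, h1, hn₁, hp₁, hs₁, hst₁⟩ := initList_spec (rounds p) (fuel := fuel) (by omega)
    (m.charge 1)
  rw [run_bind h1, run_store _ (show InBounds (rounds p) .prev (rounds p) from ⟨by omega, le_rfl⟩),
    run_store _ (show InBounds (rounds p) .next (-1) from ⟨le_rfl, by omega⟩),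
    run_store _ (show InBounds (rounds p) .prev (-1) from ⟨le_rfl, by omega⟩)]
  obtain ⟨m₂, hm₂⟩ : ∃ m₂ : Memory, m₂ = (((((m₁.charge 1).write .prev (rounds p) (-1)).charge
    1).write .next (-1) (rounds p)).charge 1).write .prev (-1) 0 := ⟨_, rfl⟩
  rw [← hm₂]
  have hst₂ : m₂.steps = m₁.steps + 3 := by rw [hm₂]; rfl
  have hs₂ : m₂.cell .skips = m.cell .skips := by
    rw [hm₂, Memory.cell_write_array _ (by decide), Memory.cell_charge,
      Memory.cell_write_array _ (by decide), Memory.cell_charge,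
      Memory.cell_write_array _ (by decide), Memory.cell_charge, hs₁]
    rfl
  have hn₂ : ∀ e ≤ rounds p, m₂.cell .next e = some ((e : ℤ) - 1) := fun e he => by
    rw [hm₂, Memory.cell_write_of_ne _ (by decide), Memory.cell_charge,
      Memory.cell_write_of_index_ne _ _ _ (by omega), Memory.cell_charge,
      Memory.cell_write_of_ne _ (by decide), Memory.cell_charge, hn₁ e he]
  have hL₂ : Linked (Finset.range (rounds p + 1)) m₂ := by
    refine Linked.init hn₂ (fun e he => ?_) ?_
    · rw [hm₂, Memory.cell_write_of_index_ne _ _ _ (by omega), Memory.cell_charge,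
        Memory.cell_write_of_ne _ (by decide), Memory.cell_charge,
        Memory.cell_write_of_index_ne _ _ _ (by omega), Memory.cell_charge, hp₁ e he.le]
    · rw [hm₂, Memory.cell_write_of_index_ne _ _ _ (by omega), Memory.cell_charge,
        Memory.cell_write_of_ne _ (by decide), Memory.cell_charge, Memory.cell_write_same]
  have hsk : ∀ i ≤ rounds p, m₂.cell .skips i = some (extSkip p i : ℤ) := fun i hi => by
    rw [hs₂, extSkip_of_le hi]
    exact hm i hi
  obtain ⟨m₃, h3, hc₃, hst₃⟩ := baseblock_spec hp hr (show rounds p ≤ fuel by omega) m₂ hsk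
  obtain ⟨m₄, h4, hL₄, hn₄, hs₄, -, hst₄⟩ := (hL₂.congr (m' := m₃) (by rw [hc₃]) (by rw [hc₃])).unlink
    (q := rounds p) (Finset.mem_range.2 (Nat.lt_succ_of_le hbq))
    fun x hx => Nat.le_of_lt_succ (Finset.mem_range.1 hx)
  rw [run_bind h3, run_bind h4, run_add, run_add, run_tick, ← Nat.cast_add, ← Nat.cast_add,
    show p + p = extSkip p (rounds p + 1) by rw [extSkip_rounds_succ]; omega]
  have hS₄ : SearchState (extSkip p) (block p) (rounds p) (p + r) 0
      (((m₄.charge 1).charge 1).charge 1) := by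
    refine ⟨fun i hi => ?_, fun j hj => by omega, ?_⟩
    · change m₄.cell .skips i = _
      rw [hs₄, hc₃]
      exact hsk i hi
    · rw [alive, known, ← Finset.erase_eq]
      exact hL₄.congr rfl rfl
  have hnq : block p (p + r) = rounds p → m₄.cell .next (rounds p) = some ((rounds p : ℤ) - 1) :=
    fun hb => by
      rw [hb] at hn₄
      rw [hn₄, hc₃]
      exact hn₂ _ le_rfl
  obtain ⟨m₅, h5, hS₅, hst₅⟩ := allblocks_root c hq (fuel := fuel)
    (by rw [extSkip_rounds_succ]; omega) hS₄ hnq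
  rw [run_bind h5, run_sub]
  obtain ⟨m₆, h6, hr₆, hs₆, hst₆⟩ := adjust_spec (rounds p) (block p (p + r))
    (fun k => block p (source (extSkip p) (block p) (p + r) k)) (show rounds p < fuel by omega)
    (m := m₅.charge 1) hS₅.recv
  refine ⟨m₆, h6, fun k hk => ?_, hr₆, ?_⟩
  · rw [hs₆, ← extSkip_of_le hk]
    exact hS₅.skips k hk
  · simp only [Memory.steps_charge] at *
    omega

/-! ### The circulant graph -/

theorem skip_strictMonoOn {p i j : ℕ} (hp : 2 ≤ p) (hij : i < j) (hj : j ≤ rounds p) :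
    skip p i < skip p j := by
  rw [← extSkip_of_le hj, ← extSkip_of_le (hij.le.trans hj)]
  exact (skipSeq_extSkip hp).lt hij

theorem skip_lt {p k : ℕ} (hp : 2 ≤ p) (hk : k < rounds p) : skip p k < p := by
  have := skip_strictMonoOn hp hk le_rfl
  rwa [skip_rounds] at this

theorem toProc_fromProc {p r k : ℕ} (hp : 2 ≤ p) (hr : r < p) (hk : k < rounds p) :
    toProc p (fromProc p r k) k = r := by
  have := skip_lt hp hk
  rw [toProc, fromProc, Nat.mod_add_mod, show r + p - skip p k + skip p k = r + p by omega,
    Nat.add_mod_right, Nat.mod_eq_of_lt hr]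

theorem fromProc_toProc {p r k : ℕ} (hp : 2 ≤ p) (hr : r < p) (hk : k < rounds p) :
    fromProc p (toProc p r k) k = r := by
  have := skip_lt hp hk
  rw [toProc, fromProc, Nat.add_sub_assoc this.le, Nat.mod_add_mod,
    show r + skip p k + (p - skip p k) = r + p by omega, Nat.add_mod_right, Nat.mod_eq_of_lt hr]

theorem toProc_injOn {p : ℕ} (hp : 2 ≤ p) (r : ℕ) :
    Set.InjOn (toProc p r) (Finset.range (rounds p)) := by
  intro i hi j hj hij
  rw [Finset.mem_coe, Finset.mem_range] at hi hj
  have h1 : skip p i = skip p j :=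
    (Nat.ModEq.add_left_cancel' r hij).eq_of_lt_of_lt (skip_lt hp hi) (skip_lt hp hj)
  rcases lt_trichotomy i j with h | h | h
  · have := skip_strictMonoOn hp h hj.le
    omega
  · exact h
  · have := skip_strictMonoOn hp h hi.le
    omega

theorem fromProc_injOn {p r : ℕ} (hp : 2 ≤ p) (hr : r < p) :
    Set.InjOn (fromProc p r) (Finset.range (rounds p)) := by
  intro i hi j hj hij
  refine toProc_injOn hp (fromProc p r i) hi hj ?_
  rw [Finset.mem_coe, Finset.mem_range] at hi hj
  rw [toProc_fromProc hp hr hi, hij, toProc_fromProc hp hr hj]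

theorem encard_image_fin {p q : ℕ} (g : ℕ → ℕ) (hg : ∀ k, g k < p)
    (hinj : Set.InjOn g (Finset.range q)) :
    {w : Fin p | ∃ k < q, (w : ℕ) = g k}.encard = q := by
  have h1 : {w : Fin p | ∃ k < q, (w : ℕ) = g k} =
      (fun k => (⟨g k, hg k⟩ : Fin p)) '' (Finset.range q) := by
    ext w
    simp only [Set.mem_ofPred_eq, Set.mem_image, Finset.mem_coe, Finset.mem_range, Fin.ext_iff,
      eq_comm]
  rw [h1, Set.InjOn.encard_image (fun i hi j hj hij => hinj hi hj (Fin.ext_iff.1 hij)),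
    Set.encard_coe_eq_coe_finsetCard, Finset.card_range]

theorem isRegularOfDegree_circulantGraph {p : ℕ} (hp : 2 ≤ p) :
    IsRegularOfDegree (circulantGraph p) (rounds p) := by
  intro v
  refine ⟨encard_image_fin (toProc p v) (fun k => Nat.mod_lt _ (by omega)) (toProc_injOn hp v), ?_⟩
  rw [← encard_image_fin (fromProc p v) (fun k => Nat.mod_lt _ (by omega)) (fromProc_injOn hp v.2)]
  congr 1
  ext w
  refine exists_congr fun k => and_congr_right fun hk => ⟨fun h => ?_, fun h => ?_⟩
  · rw [h, fromProc_toProc hp w.2 hk]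
  · rw [h, toProc_fromProc hp v.2 hk]

/-! ### Correctness -/

namespace Receiver
variable {K : ℕ → ℕ} {q : ℕ} {B : ℕ → ℕ} {R k : ℕ}

theorem exists_source_block (c : Receiver K q B R) {e : ℕ} (he : e ≤ q) (hne : e ≠ B R) :
    ∃ k < q, B (source K B R k) = e := by
  by_contra h
  push Not at h
  have : e ∈ alive K B q R q := mem_alive.2 ⟨he, fun h1 => by
    rcases mem_known_iff.1 h1 with h2 | ⟨k, hk, h2⟩
    · exact hne h2
    · exact h k hk h2.symm⟩
  exact absurd (c.lt_of_alive le_rfl this) (lt_irrefl q)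

theorem block_source_le_top (c : Receiver K q B R) (hk : k < q) : B (source K B R k) ≤ q := by
  have hel := c.eligible hk
  exact c.block_le _ hel.1 (by have := hel.2.1; have := c.lt_top; omega)

theorem block_source_ne (c : Receiver K q B R) (hk : k < q) : B (source K B R k) ≠ B R :=
  fun h => (c.eligible hk).2.2.2.2 (h ▸ self_mem_known k)

theorem block_source_inj (c : Receiver K q B R) {i j : ℕ} (hi : i < q) (hj : j < q)
    (h : B (source K B R i) = B (source K B R j)) : i = j := by
  rcases lt_trichotomy i j with h1 | h1 | h1
  · exact absurd (h ▸ mem_known_succ h1) (c.eligible hj).2.2.2.2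
  · exact h1
  · exact absurd (h ▸ mem_known_succ h1) (c.eligible hi).2.2.2.2

end Receiver

/-- The parent has a block above `q`, and only `0` has one. -/
theorem BlockTree.eq_skip_of_block_eq {K : ℕ → ℕ} {q : ℕ} {B : ℕ → ℕ} (h : BlockTree K q B) {t : ℕ}
    (h0 : 0 < t) (ht : t < K (q + 1)) (hB : B t = q) : t = K q := by
  have h1 := h.skip_le t h0 ht
  have h2 := h.block_lt_parent t h0 ht
  rw [hB] at h1 h2
  by_contra hne
  have := h.block_le (t - K q) (by omega) (by omega)
  omega

section correct
variable {p r k : ℕ}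

theorem block_add (hp : 2 ≤ p) (h0 : 0 < r) (hr : r < p) : block p (r + p) = block p r := by
  have := (blockTree_block hp).block_add (x := r) h0 (by rwa [extSkip_rounds])
  rwa [extSkip_rounds] at this

theorem block_self (hp : 2 ≤ p) : block p p = rounds p := by
  have := (blockTree_block hp).block_skip (le_refl (rounds p))
  rwa [extSkip_rounds] at this

theorem block_lt_rounds (hp : 2 ≤ p) (h0 : 0 < r) (hr : r < p) :
    block p (p + r) < rounds p := by
  have h := blockTree_block hp
  have h1 := h.skip_le r h0 (by rw [extSkip_rounds_succ]; omega)
  rw [Nat.add_comm, block_add hp h0 hr]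
  refine h.lt_iff.1 ?_
  rw [extSkip_rounds]
  omega

theorem recvBlock_injOn (hp : 2 ≤ p) (hr : r < p) :
    Set.InjOn (recvBlock p r) (Set.Iio (rounds p)) := by
  have c := receiver_block hp hr
  intro i hi j hj hij
  refine c.block_source_inj hi hj ?_
  have h1 := c.block_source_le_top hi
  have h2 := c.block_source_le_top hj
  unfold recvBlock at hij
  split_ifs at hij <;> omega

theorem recvBlock_image (hp : 2 ≤ p) (h0 : 0 < r) (hr : r < p) :
    recvBlock p r '' Set.Iio (rounds p) =
      (Set.Icc (-(rounds p : ℤ)) (-1) \ {(block p (p + r) : ℤ) - rounds p}) ∪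
        {(block p (p + r) : ℤ)} := by
  have c := receiver_block hp hr
  have hb := block_lt_rounds hp h0 hr
  ext x
  simp only [Set.mem_image, Set.mem_Iio, Set.mem_union, Set.mem_sdiff, Set.mem_Icc,
    Set.mem_singleton_iff]
  constructor
  · rintro ⟨k, hk, rfl⟩
    have h1 := c.block_source_le_top hk
    have h2 := c.block_source_ne hk
    unfold recvBlock
    split_ifs with h
    · exact Or.inr rfl
    · refine Or.inl ⟨⟨by omega, by omega⟩, by omega⟩
  · rintro (⟨⟨h1, h2⟩, h3⟩ | rfl)
    · obtain ⟨k, hk, h4⟩ := c.exists_source_block (e := (x + rounds p).toNat) (by omega) (by omega)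
      refine ⟨k, hk, ?_⟩
      rw [recvBlock, h4, if_neg (by omega)]
      omega
    · obtain ⟨k, hk, h4⟩ := c.exists_source_block le_rfl hb.ne'
      exact ⟨k, hk, by rw [recvBlock, if_pos h4]⟩

theorem recvBlock_image_root (hp : 2 ≤ p) :
    recvBlock p 0 '' Set.Iio (rounds p) = Set.Icc (-(rounds p : ℤ)) (-1) := by
  have c := receiver_block hp (show 0 < p by omega)
  have hb : block p (p + 0) = rounds p := block_self hp
  ext x
  simp only [Set.mem_image, Set.mem_Iio, Set.mem_Icc]
  constructor
  · rintro ⟨k, hk, rfl⟩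
    have h1 := c.block_source_le_top hk
    have h2 := c.block_source_ne hk
    rw [recvBlock, if_neg (by omega)]
    omega
  · rintro ⟨h1, h2⟩
    obtain ⟨k, hk, h4⟩ := c.exists_source_block (e := (x + rounds p).toNat) (by omega) (by omega)
    refine ⟨k, hk, ?_⟩
    rw [recvBlock, h4, if_neg (by omega)]
    omega

/-- `Receiver.Window.mem_known` settles this for tree blocks. What remains is the block `q`, which
stands for a different baseblock at each processor. -/
theorem inducedSend_known (hp : 2 ≤ p) (h0 : 0 < r) (hr : r < p) (hk : k < rounds p) :
    (∃ j < k, inducedSend p (recvBlock p) r k = recvBlock p r j) ∨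
      inducedSend p (recvBlock p) r k = (block p (p + r) : ℤ) - rounds p := by
  have hs := skip_lt hp hk
  have hsk := extSkip_of_le hk.le
  obtain ⟨r', hr'⟩ : ∃ r', toProc p r k = r' := ⟨_, rfl⟩
  have hr'p : r' < p := hr' ▸ Nat.mod_lt _ (by omega)
  have hcase : r' = r + skip p k ∨ r' + p = r + skip p k := by
    rw [toProc] at hr'
    rcases lt_or_ge (r + skip p k) p with h | h
    · rw [Nat.mod_eq_of_lt h] at hr'
      omega
    · rw [Nat.mod_eq_sub_mod h, Nat.mod_eq_of_lt (by omega)] at hr'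
      omega
  have cR := receiver_block hp hr'p
  have cF := receiver_block hp hr
  have hbF := block_lt_rounds hp h0 hr
  have hmem : block p (source (extSkip p) (block p) (p + r') k) ∈
      known (extSkip p) (block p) (p + r) k := by
    -- Without wrap-around the from-processor is the node `p + r` itself; with it, the node is `r`,
    -- and `p + r` is its copy.
    rcases hcase with h | h
    · exact Receiver.Window.mem_known (f := p + r) (sh := 0)
        ⟨cR, cF, hk, by omega, rfl, fun x _ _ => rfl, by rw [cR.root]; omega⟩
    · exact Receiver.Window.mem_known (f := r) (sh := p)
        ⟨cR, cF, hk, by omega, by omega, fun x h1 h2 => block_add hp h1 (by omega),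
          (block_self hp).ge⟩
  rw [inducedSend, hr', recvBlock]
  split_ifs with he
  · rw [he] at hmem
    rcases mem_known_iff.1 hmem with h1 | ⟨j, hj, h1⟩
    · omega
    · refine Or.inl ⟨j, hj, ?_⟩
      rw [recvBlock, if_pos h1.symm]
      have hel := cR.eligible hk
      have hRl := cR.lt_top
      -- The source is `p`, so `r'` lies between `K k` and `K (k + 1)`. There is no wrap-around, the
      -- upper end is excluded, and `add_skip` identifies the baseblocks of `r` and `r'`.
      have ht := cR.eq_skip_of_block_eq hel.1 (by have := hel.2.1; omega) he
      rw [extSkip_rounds] at ht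
      have h2 := hel.2.1
      have h3 := hel.2.2.1
      rw [ht] at h2 h3
      have h4 : r' = r + skip p k := by omega
      have h5 : r' ≠ extSkip p (k + 1) := fun h5 => by
        have h6 := cR.source_ne_of_block_eq (cR.good hk.le) hk (by
          rw [Nat.add_comm, block_add hp (by omega) hr'p, h5]
          exact cR.block_skip hk)
        omega
      have h6 := cR.add_skip k hk.le r h0 (by omega)
      rw [Nat.add_comm p, Nat.add_comm p, block_add hp h0 hr, block_add hp (by omega) hr'p, h4,
        ← hsk, h6]
  · rcases mem_known_iff.1 hmem with h1 | ⟨j, hj, h1⟩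
    · exact Or.inr (by rw [h1])
    · refine Or.inl ⟨j, hj, ?_⟩
      rw [recvBlock, ← h1, if_neg he]

/-- For `R = p + K k` the from-processor node `p` is the largest candidate, and its block `q` is
new. So the receiver gets its own baseblock, which is `k`. -/
theorem inducedSend_root (hp : 2 ≤ p) (hk : k < rounds p) :
    inducedSend p (recvBlock p) 0 k = k := by
  have hs := skip_lt hp hk
  have hsk := extSkip_of_le hk.le
  have c := receiver_block hp hs
  have hpk := c.pos k
  have hRl := c.lt_top
  have hmk := c.lt_succ k
  have hkq := c.mono (show k + 1 ≤ rounds p from hk)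
  rw [extSkip_rounds] at hkq
  have hb : block p (p + skip p k) = k := by
    rw [Nat.add_comm, block_add hp (by omega) hs, ← hsk]
    exact c.block_skip hk.le
  have hel := c.eligible hk
  have hnot : rounds p ∉ known (extSkip p) (block p) (p + skip p k) k := fun h => by
    rcases mem_known_iff.1 h with h1 | ⟨j, hj, h1⟩
    · omega
    · have he := c.eligible (hj.trans hk)
      have h2 := c.eq_skip_of_block_eq he.1 (by have := he.2.1; omega) h1.symm
      rw [extSkip_rounds] at h2
      have h3 := he.2.2.1
      have h4 := c.mono (show j + 1 ≤ k from hj)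
      have h5 : j + 1 = k := by
        by_contra h5
        have := c.lt (show j + 1 < k by omega)
        omega
      have h6 := c.source_ne_of_block_eq (c.good (hj.trans hk).le) (hj.trans hk) (by omega)
      rw [h5] at h6
      omega
  have hle := le_source (K := extSkip p) (B := block p) (R := p + skip p k) (k := k) (t := p)
    ⟨by omega, by omega, by omega, by rw [block_self hp, extSkip_rounds]; omega, by
      rw [block_self hp]; exact hnot⟩
  have hsrc : source (extSkip p) (block p) (p + skip p k) k = p := by
    have := hel.2.1
    omega
  rw [inducedSend, toProc, Nat.zero_add, Nat.mod_eq_of_lt hs, recvBlock, hsrc, block_self hp,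
    if_pos rfl, hb]

theorem isCorrect_recvBlock (hp : 2 ≤ p) :
    IsCorrect p (fun r => (block p (p + r) : ℤ)) (recvBlock p) (inducedSend p (recvBlock p)) where
  recv_eq r hr k hk := by rw [inducedSend, toProc_fromProc hp hr hk]
  send_eq r hr k hk := rfl
  recv_distinct r hr := recvBlock_injOn hp hr
  base_mem r hr h0 := ⟨Int.natCast_nonneg _, by exact_mod_cast block_lt_rounds hp h0 hr⟩
  recv_set r hr h0 := recvBlock_image hp h0 hr
  recv_set_root := recvBlock_image_root hp
  send_known r hr h0 k hk := inducedSend_known hp h0 hr hk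
  send_root k hk := inducedSend_root hp hk

theorem computesBaseblock (hp : 2 ≤ p) (hr : r < p) : ComputesBaseblock p r (block p (p + r)) := by
  obtain ⟨m₁, h1, h2, -⟩ := computeSkips_spec (p := p) (Nat.lt_succ_self _) Memory.init
  obtain ⟨m₂, h3, -⟩ := baseblock_spec hp hr (Nat.le_succ _) m₁ fun i hi => by
    rw [extSkip_of_le hi]
    exact h2 i hi
  exact ⟨rounds p + 1, m₂, by rw [baseblockProgram, run_bind h1]; exact h3⟩

theorem computesRecv (hp : 2 ≤ p) (hr : r < p) :
    ∃ n ≤ 1000 * rounds p, ComputesRecv p r (recvBlock p r) n := by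
  have hq := rounds_pos hp
  obtain ⟨m₁, h1, h2, h3⟩ := computeSkips_spec (p := p) (fuel := rounds p + 3 + 2 * p) (by omega)
    Memory.init
  obtain ⟨m₂, h4, h5, h6, h7⟩ := recvschedule_spec hp hr (fuel := rounds p + 3 + 2 * p) (by omega) h2
  have h8 : Memory.init.steps = 0 := rfl
  exact ⟨m₂.steps, by omega, _, m₂, by rw [recvProgram, run_bind h1]; exact h4, h5, h6, rfl⟩

theorem rounds_le_two_mul_logb (hp : 2 ≤ p) : (rounds p : ℝ) ≤ 2 * Real.logb 2 p := by
  have h2 : (2 : ℝ) ≤ p := by exact_mod_cast hp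
  have h1 : (1 : ℝ) ≤ Real.logb 2 p := by
    rw [Real.le_logb_iff_rpow_le (by norm_num) (by linarith), Real.rpow_one]
    exact h2
  have h3 : ((rounds p - 1 : ℕ) : ℝ) ≤ Real.logb 2 p := by
    rw [Real.le_logb_iff_rpow_le (by norm_num) (by linarith), Real.rpow_natCast]
    exact_mod_cast (Nat.pow_lt_of_lt_clog
      (show rounds p - 1 < rounds p by have := rounds_pos hp; omega)).le
  rw [Nat.cast_sub (rounds_pos hp), Nat.cast_one] at h3
  linarith

end correct

end CirculantBroadcast

theorem theorem2 :
    ∃ C : ℝ, ∀ p : ℕ, 2 ≤ p →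
      CirculantBroadcast.IsRegularOfDegree (CirculantBroadcast.circulantGraph p) (Nat.clog 2 p) ∧
      ∃ (b : ℕ → ℤ) (recv : ℕ → ℕ → ℤ),
        (∀ r < p, CirculantBroadcast.ComputesBaseblock p r (b r)) ∧
        (∀ r < p, ∃ n : ℕ, CirculantBroadcast.ComputesRecv p r (recv r) n ∧
          (n : ℝ) ≤ C * Real.logb 2 p) ∧
        CirculantBroadcast.IsCorrect p b recv (CirculantBroadcast.inducedSend p recv) := by
  -- At most `1000 * q` steps are taken, and `q ≤ 2 * log₂ p`.
  refine ⟨2000, fun p hp => ⟨CirculantBroadcast.isRegularOfDegree_circulantGraph hp, _, _,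
    fun r hr => CirculantBroadcast.computesBaseblock hp hr, fun r hr => ?_,
    CirculantBroadcast.isCorrect_recvBlock hp⟩⟩
  obtain ⟨n, hn, h⟩ := CirculantBroadcast.computesRecv hp hr
  refine ⟨n, h, ?_⟩
  have h1 := CirculantBroadcast.rounds_le_two_mul_logb hp
  have h2 : (n : ℝ) ≤ 1000 * CirculantBroadcast.rounds p := by exact_mod_cast hn
  linarith
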